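/- **Setting.** Let $d=n+2\in\{3,4\}$. For smooth $\varrho,a^1,\dots,a^n$ on $\mathbb R^d$ the Nambu--Poisson bracket is $\{f,g\}=\varrho\det\bigl(\partial(f,g,a^1,\dots,a^n)/\partial(x_1,\dots,x_d)\bigr)$, with bi-vector $P^{ij}=\{x_i,x_j\}$. A micro-graph over dimension $d$ has a sink $0$, three sources $1,2,3$ and the vertices $3l+s$ ($1\le l\le n$, $1\le s\le 3$), the copies of the Casimirs $a^l$. Each source has $d$ ordered outgoing edges; the last $n$ edges of the source $s$ go to $3+s,\dots,3n+s$. It is encoded by the lists of targets $(\cdot;\cdot;\cdot)$ of the edges of the sources $1,2,3$; no source has two edges with the same target. The formula $\phi(\Gamma)$ is the vector field, depending on $(\varrho,a^1,\dots,a^n)$, that one gets by writing $\varepsilon^{i_1\dots i_d}\varrho$ in each source, where $i_1,\dots,i_d$ are the indices on its ordered outgoing edges, and $a^l$ in the vertices $3l+s$, differentiating the content of each vertex with respect to $x_i$ along every incoming edge with index $i$, replacing the edge with index $i$ into the sink by $\partial/\partial x_i$, multiplying, and summing over all indices. $\Gamma$ is *vanishing* if $\phi(\Gamma)=0$. The *sunflower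 micro-graphs* over dimension $d$ are the descendants of the 2D graphs $(0,1;1,3;1,2)$ and $(0,2;1,3;1,2)$: each edge that goes to a vertex $v\in\{1,2,3\}$ is redirected to $v$ or to one of $v+3,\dots,v+3n$, and the edges to the Casimirs are adjoined. A *4D-descendant* of a 3D micro-graph is obtained by adjoining the edges to $7,8,9$ and by redirecting each of the first two edges of each source that goes to $v\in\{4,5,6\}$ to $v$ or $v+3$. A vector field $X$ depending on $(\varrho,a^1,\dots,a^n)$ is *trivialising* if $Q(P)=[\![P,X]\!]$ for all smooth $\varrho,a^1,\dots,a^n$, where $[\![P,X]\!]=-L_XP$ is the Schouten bracket and $Q$ is the tetrahedral flow, $Q^{ij}=T_1^{ij}+3(T_2^{ij}-T_2^{ji})$ with (summation over repeated indices) $$T_1^{ij}=\partial_k\partial_l\partial_mP^{ij}\,\partial_{l'}P^{kk'}\,\partial_{m'}P^{ll'}\,\partial_{k'}P^{mm'},\qquad T_2^{im}=\partial_k\partial_lP^{ij}\,\partial_{k'}\partial_{l'}P^{km}\,\partial_{m'}P^{k'l}\,\partial_jP^{m'l'}.$$ **The known 4D solution** is $X=\sum_\Gamma c_\Gamma\cdot\tfrac12\bigl(\phi(\Gamma)(\varrho,a^1,a^2)-\phi(\Gamma)(\varrho,a^2,a^1)\bigr)$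 over the following 27 micro-graphs $\Gamma$ with coefficients $c_\Gamma$: $(0,1,4,7;1,3,5,8;1,2,6,9)$: $1$, $(0,1,4,7;1,6,5,8;4,2,6,9)$: $6$, $(0,1,4,7;4,3,5,8;4,2,6,9)$: $2$, $(0,1,4,7;4,6,5,8;4,2,6,9)$: $6$, $(0,1,4,7;4,9,5,8;4,2,6,9)$: $6$, $(0,1,4,7;4,3,5,8;7,2,6,9)$: $2$, $(0,1,4,7;4,6,5,8;7,2,6,9)$: $6$, $(0,1,4,7;1,6,5,8;1,5,6,9)$: $-3/2$, $(0,1,4,7;4,6,5,8;4,5,6,9)$: $3$, $(0,1,4,7;4,9,5,8;7,5,6,9)$: $-3$, $(0,1,4,7;7,6,5,8;7,5,6,9)$: $3$, $(0,2,4,7;1,3,5,8;1,2,6,9)$: $2$, $(0,2,4,7;1,3,5,8;1,5,6,9)$: $4$, $(0,2,4,7;1,6,5,8;1,5,6,9)$: $3/2$, $(0,2,4,7;1,9,5,8;4,5,6,9)$: $-6$, $(0,2,4,7;1,9,5,8;7,5,6,9)$: $6$, $(0,2,4,7;4,3,5,8;1,5,6,9)$: $4$, $(0,2,4,7;7,3,5,8;1,5,6,9)$: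 $4$, $(0,5,4,7;1,3,5,8;1,2,6,9)$: $6$, $(0,5,4,7;1,9,5,8;1,2,6,9)$: $6$, $(0,5,4,7;1,9,5,8;4,2,6,9)$: $12$, $(0,5,4,7;4,9,5,8;4,2,6,9)$: $6$, $(0,5,4,7;7,9,5,8;4,2,6,9)$: $6$, $(0,5,4,7;7,9,5,8;7,2,6,9)$: $6$, $(0,5,4,7;1,6,5,8;1,5,6,9)$: $-3$, $(0,5,4,7;4,6,5,8;7,5,6,9)$: $-6$, $(0,5,4,7;4,9,5,8;7,5,6,9)$: $-6$. The micro-graphs *occurring* in it are these $\Gamma=\Gamma(a^1,a^2)$ and the $\Gamma(a^2,a^1)$, that is, $\Gamma$ with the vertices $4,5,6$ and $7,8,9$ interchanged and the last two edges of each source put back into their standard order. **The vanishing list:** 1. $(0,1,4;1,6,5;4,5,6)$; 2. $(0,1,4;4,6,5;1,5,6)$; 3. $(0,2,4;1,3,5;4,2,6)$; 4. $(0,5,4;4,3,5;1,2,6)$; 5. $(0,5,4;1,3,5;4,2,6)$; 6. $(0,5,4;4,6,5;1,2,6)$; 7. $(0,5,4;1,6,5;4,2,6)$; 8. $(0,2,4;1,3,5;4,5,6)$;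 9. $(0,2,4;4,6,5;1,5,6)$; 10. $(0,2,4;1,6,5;4,5,6)$; 11. $(0,5,4;1,3,5;4,5,6)$; 12. $(0,5,4;4,3,5;4,5,6)$; 13. $(0,5,4;4,6,5;4,5,6)$. **The basis list:** 1. $(0,1,4;1,3,5;1,2,6)$; 2. $(0,1,4;1,6,5;1,2,6)$; 3. $(0,1,4;1,3,5;4,2,6)$; 4. $(0,1,4;1,6,5;4,2,6)$; 5. $(0,1,4;4,6,5;1,2,6)$; 6. $(0,1,4;4,3,5;4,2,6)$; 7. $(0,1,4;4,6,5;4,2,6)$; 8. $(0,1,4;1,6,5;1,5,6)$; 9. $(0,1,4;4,6,5;4,5,6)$; 10. $(0,2,4;1,3,5;1,2,6)$; 11. $(0,2,4;1,6,5;1,2,6)$; 12. $(0,2,4;4,3,5;4,2,6)$; 13. $(0,2,4;4,6,5;4,2,6)$; 14. $(0,2,4;1,3,5;1,5,6)$; 15. $(0,2,4;1,6,5;1,5,6)$; 16. $(0,2,4;4,3,5;1,5,6)$; 17. $(0,5,4;1,3,5;1,2,6)$; 18. $(0,5,4;4,3,5;4,2,6)$; 19. $(0,5,4;1,3,5;1,5,6)$;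 20. $(0,5,4;1,6,5;1,5,6)$. **Proposition.** (1) The micro-graphs occurring in $X$ are 4D sunflower micro-graphs, and $X$ is trivialising. (2) The vanishing list consists of all the vanishing 3D sunflower micro-graphs. The formulas of the 20 micro-graphs of the basis list, which are 3D sunflower micro-graphs, form a basis of the real vector space spanned by the formulas of all 3D sunflower micro-graphs. (3) There is a set $S$ of exactly seventeen 3D sunflower micro-graphs such that every micro-graph occurring in $X$ is a 4D-descendant of an element of $S$, and every set of 3D sunflower micro-graphs with this property contains $S$. Even if it is only required that every micro-graph occurring in $X$ be isomorphic (as a directed graph with labelled contents, up to the order of the outgoing edges) to a 4D-descendant of an element of the set, at least seventeen 3D sunflower micro-graphs are needed. (4) Exactly three elements of $S$ are in the vanishing list (numbers 7, 10, 13), exactly twelve are in the basis list (numbers 1, 4, 6, 7, 8, 9, 10, 14, 15, 16, 17, 20), and the remaining two are $(0,5,4;1,6,5;1,2,6)$ and $(0,5,4;4,6,5;4,2,6)$. These two are non-vanishing and not in the basis list, and their formulas are linear combinations of the 20 formulas of the basis list. -/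

import Mathlib

open scoped ContDiff

namespace NambuMicro

/-! ### Micro-graphs and their encodings

A micro-graph over dimension `n + 2` has `n` Casimirs `a¹, …, aⁿ`. Its vertices are numbered as
follows: `0` is the sink, `1, 2, 3` are the sources (each one contains `ε ϱ`), and the `s`-th copy
of `aˡ` has the number `3 * l + s`. So over dimension 3 the copies of `a¹` are `4, 5, 6`, and over
dimension 4 the copies of `a²` are `7, 8, 9`. In Lean `l : Fin n` and `s : Fin 3` start at zero. -/

abbrev Vertex (n : ℕ) := Fin (3 * n + 4)

def source (n : ℕ) (s : Fin 3) : Vertex n := ⟨s + 1, by omega⟩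

def casimir {n : ℕ} (l : Fin n) (s : Fin 3) : Vertex n := ⟨3 * (l + 1) + s + 1, by omega⟩

/-- The encoding `(t₁, …, t_d; t₁', …, t_d'; t₁'', …, t_d'')` of a micro-graph: for each of the
three sources, the ordered list of the targets of its `d = n + 2` outgoing edges. -/
abbrev MicroGraph (n : ℕ) := Fin 3 → Fin (n + 2) → Vertex n

/-- The last `n` edges of the `s`-th source go to the `s`-th copies of the `n` Casimirs, and no two
edges have the same source and the same target (with such a double edge the
formula is zero, because the Levi-Civita symbol is skew). -/
def WellFormed {n : ℕ} (H : MicroGraph n) : Prop :=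
  (∀ (s : Fin 3) (l : Fin n), H s l.succ.succ = casimir l s) ∧ ∀ s, Function.Injective (H s)

/-- An edge that goes to `v` in a 2D Kontsevich graph may go to `t` in a descendant: an edge to the
sink stays, an edge to the `s`-th source acts by the Leibniz rule on that source and on its
Casimirs. -/
def Redirects (n : ℕ) (v : Vertex 0) (t : Vertex n) : Prop :=
  (v = 0 ∧ t = 0) ∨ ∃ s, v = source 0 s ∧ (t = source n s ∨ ∃ l : Fin n, t = casimir l s)

/-- `H` is an `(n + 2)`-dimensional descendant of the 2D Kontsevich graph `K`. -/
def IsDescendant {n : ℕ} (K : MicroGraph 0) (H : MicroGraph n) : Prop :=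
  WellFormed H ∧ ∀ s, Redirects n (K s 0) (H s 0) ∧ Redirects n (K s 1) (H s 1)

/-- The two Kontsevich graphs `Γ₁`, `Γ₂` of the sunflower `1 · Γ₁ + 2 · Γ₂`. -/
def sunflowerΓ₁ : MicroGraph 0 := ![![0, 1], ![1, 3], ![1, 2]]
def sunflowerΓ₂ : MicroGraph 0 := ![![0, 2], ![1, 3], ![1, 2]]

/-- The sunflower micro-graphs over dimension `n + 2`. -/
def sunflower (n : ℕ) : Set (MicroGraph n) :=
  {H | IsDescendant sunflowerΓ₁ H ∨ IsDescendant sunflowerΓ₂ H}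

/-- In the step from 3D to 4D an edge that goes to `v` may go to `t`: an edge to the sink or to a
source stays, an edge to a copy of `a¹` acts by the Leibniz rule on it and on the
corresponding copy of the new Casimir `a²`. -/
def Redirects₃₄ (v : Vertex 1) (t : Vertex 2) : Prop :=
  t.val = v.val ∨ ∃ s, v = casimir 0 s ∧ t = casimir 1 s

/-- `H` is a 4D-descendant of the 3D micro-graph `G`. -/
def IsDescendant₃₄ (G : MicroGraph 1) (H : MicroGraph 2) : Prop :=
  WellFormed H ∧ ∀ s, Redirects₃₄ (G s 0) (H s 0) ∧ Redirects₃₄ (G s 1) (H s 1)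

/-- The set of all 4D-descendants of the elements of `A`. -/
def descendants₃₄ (A : Set (MicroGraph 1)) : Set (MicroGraph 2) :=
  {H | ∃ G ∈ A, IsDescendant₃₄ G H}

/-- Isomorphism of directed graphs, with the content of the vertices preserved and the order of the
outgoing edges forgotten (reordering them changes a formula at most by a sign). -/
def Isomorphic {n : ℕ} (G H : MicroGraph n) : Prop :=
  ∃ (α : Equiv.Perm (Vertex n)) (β : Equiv.Perm (Fin 3)) (γ : Fin n → Equiv.Perm (Fin 3)),
    α 0 = 0 ∧ (∀ s, α (source n s) = source n (β s)) ∧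
    (∀ l s, α (casimir l s) = casimir l (γ l s)) ∧
    ∀ s t, t ∈ Set.range (G s) ↔ α t ∈ Set.range (H (β s))

/-! ### Nambu-Poisson structures and formulas of micro-graphs -/

/-- The partial derivative in the `i`-th coordinate of `ℝᵈ`. -/
noncomputable def pd {d : ℕ} (i : Fin d) (f : (Fin d → ℝ) → ℝ) : (Fin d → ℝ) → ℝ :=
  fun x => fderiv ℝ f x (Pi.single i 1)

/-- The iterated partial derivative. -/
noncomputable def pds {d : ℕ} (L : List (Fin d)) (f : (Fin d → ℝ) → ℝ) : (Fin d → ℝ) → ℝ :=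
  L.foldr pd f

/-- Components of vector fields and of bi-vector fields on `ℝᵈ`. -/
abbrev VectorField (d : ℕ) := Fin d → (Fin d → ℝ) → ℝ
abbrev BivectorField (d : ℕ) := Fin d → Fin d → (Fin d → ℝ) → ℝ

/-- The inverse density `ϱ` and the Casimirs `a¹, …, aⁿ` of a Nambu-determinant Poisson bracket on
`ℝⁿ⁺²`. -/
structure NambuData (n : ℕ) where
  rho : (Fin (n + 2) → ℝ) → ℝ
  cas : Fin n → (Fin (n + 2) → ℝ) → ℝ
  rho_smooth : ContDiff ℝ ∞ rho
  cas_smooth : ∀ l, ContDiff ℝ ∞ (cas l)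

/-- `{f, g} = ϱ · det (∂(f, g, a¹, …, aⁿ) / ∂(x₁, …, x_{n+2}))`. -/
noncomputable def NambuData.bracket {n : ℕ} (N : NambuData n) (f g : (Fin (n + 2) → ℝ) → ℝ) :
    (Fin (n + 2) → ℝ) → ℝ :=
  fun x => N.rho x *
    (Matrix.of fun r c : Fin (n + 2) => pd c (Matrix.vecCons f (Matrix.vecCons g N.cas) r) x).det

/-- The components `Pⁱʲ = {xᵢ, xⱼ}` of the Nambu-Poisson bi-vector. -/
noncomputable def NambuData.bivector {n : ℕ} (N : NambuData n) : BivectorField (n + 2) :=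
  fun i j => N.bracket (fun x => x i) (fun x => x j)

/-- The same density, with the Casimirs permuted. -/
def NambuData.permute {n : ℕ} (N : NambuData n) (π : Equiv.Perm (Fin n)) : NambuData n where
  rho := N.rho
  cas := fun l => N.cas (π l)
  rho_smooth := N.rho_smooth
  cas_smooth := fun l => N.cas_smooth (π l)

/-- A vector field that depends on the Nambu-Poisson structure. -/
abbrev Formula (n : ℕ) := NambuData n → VectorField (n + 2)

/-- The indices on the edges that go to `v`, if the `e`-th edge of the source `s` carries the index
`σ s e`. -/
def incoming {n : ℕ} (G : MicroGraph n) (σ : Fin 3 → Equiv.Perm (Fin (n + 2))) (v : Vertex n) :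
    List (Fin (n + 2)) :=
  ((List.finRange 3 ×ˢ List.finRange (n + 2)).filter fun q => G q.1 q.2 = v).map fun q => σ q.1 q.2

/-- The formula `φ(Γ)` of a micro-graph: the sum over all indices on the edges (only permutations
contribute, with their signs, because of the Levi-Civita symbols in the sources) of the product of
the contents of the vertices, each differentiated along its incoming edges. The edge that
goes to the sink carries the index `m` of the component `∂/∂xₘ`. -/
noncomputable def φ {n : ℕ} (G : MicroGraph n) : Formula n := fun N m x =>
  ∑ σ : Fin 3 → Equiv.Perm (Fin (n + 2)),
    (∏ s, ((Equiv.Perm.sign (σ s) : ℤ) : ℝ)) *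
      (if incoming G σ 0 = [m] then 1 else 0) *
      (∏ s, pds (incoming G σ (source n s)) N.rho x) *
      ∏ l, ∏ s, pds (incoming G σ (casimir l s)) (N.cas l) x

/-! ### The tetrahedral flow and its trivialising vector fields -/

/-- The Schouten bracket `⟦P, X⟧` of a bi-vector field and a vector field (minus the Lie derivative
of `P` along `X`). -/
noncomputable def schouten {d : ℕ} (P : BivectorField d) (X : VectorField d) : BivectorField d :=
  fun i j x => ∑ k, (P k j x * pd k (X i) x + P i k x * pd k (X j) x - X k x * pd k (P i j) x)

/-- The bi-vector `Γ₁(P)` of the tetrahedral flow: the orientation of the tetrahedron in which three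
edges go to one vertex. -/
noncomputable def tetra₁ {d : ℕ} (P : BivectorField d) : BivectorField d := fun i j x =>
  ∑ k, ∑ l, ∑ m, ∑ k', ∑ l', ∑ m',
    pds [k, l, m] (P i j) x * pd l' (P k k') x * pd m' (P l l') x * pd k' (P m m') x

/-- The bi-differential expression `Γ₂(P)` of the tetrahedral flow, before it is made skew. -/
noncomputable def tetra₂ {d : ℕ} (P : BivectorField d) : BivectorField d := fun i m x =>
  ∑ j, ∑ k, ∑ l, ∑ k', ∑ l', ∑ m',
    pds [k, l] (P i j) x * pds [k', l'] (P k m) x * pd m' (P k' l) x * pd j (P m' l') x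

/-- The tetrahedral flow of Kontsevich, `Q(P) = 1 · Γ₁(P) + 6 · Alt Γ₂(P)`, where
`Alt T = (T - Tᵀ) / 2`. -/
noncomputable def tetraFlow {d : ℕ} (P : BivectorField d) : BivectorField d := fun i j x =>
  tetra₁ P i j x + 6 * ((tetra₂ P i j x - tetra₂ P j i x) / 2)

/-- `X` trivialises the tetrahedral flow on Nambu-Poisson structures: `Q(P) = ⟦P, X(P)⟧`. -/
def IsTrivialising {n : ℕ} (X : Formula n) : Prop :=
  ∀ N : NambuData n, tetraFlow N.bivector = schouten N.bivector (X N)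

/-! ### The known 4D solution -/

/-- The skew pair `(φ(Γ(a¹, a²)) - φ(Γ(a², a¹))) / 2`. -/
noncomputable def skewPair (H : MicroGraph 2) : Formula 2 := fun N =>
  (1 / 2 : ℝ) • (φ H N - φ H (N.permute (Equiv.swap 0 1)))

/-- The coefficients and the micro-graphs `Γ` of the 27 skew pairs of the known 4D solution. -/
def knownTerms : List (ℚ × MicroGraph 2) :=
  [(1, ![![0, 1, 4, 7], ![1, 3, 5, 8], ![1, 2, 6, 9]]),
   (6, ![![0, 1, 4, 7], ![1, 6, 5, 8], ![4, 2, 6, 9]]),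
   (2, ![![0, 1, 4, 7], ![4, 3, 5, 8], ![4, 2, 6, 9]]),
   (6, ![![0, 1, 4, 7], ![4, 6, 5, 8], ![4, 2, 6, 9]]),
   (6, ![![0, 1, 4, 7], ![4, 9, 5, 8], ![4, 2, 6, 9]]),
   (2, ![![0, 1, 4, 7], ![4, 3, 5, 8], ![7, 2, 6, 9]]),
   (6, ![![0, 1, 4, 7], ![4, 6, 5, 8], ![7, 2, 6, 9]]),
   (-3/2, ![![0, 1, 4, 7], ![1, 6, 5, 8], ![1, 5, 6, 9]]),
   (3, ![![0, 1, 4, 7], ![4, 6, 5, 8], ![4, 5, 6, 9]]),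
   (-3, ![![0, 1, 4, 7], ![4, 9, 5, 8], ![7, 5, 6, 9]]),
   (3, ![![0, 1, 4, 7], ![7, 6, 5, 8], ![7, 5, 6, 9]]),
   (2, ![![0, 2, 4, 7], ![1, 3, 5, 8], ![1, 2, 6, 9]]),
   (4, ![![0, 2, 4, 7], ![1, 3, 5, 8], ![1, 5, 6, 9]]),
   (3/2, ![![0, 2, 4, 7], ![1, 6, 5, 8], ![1, 5, 6, 9]]),
   (-6, ![![0, 2, 4, 7], ![1, 9, 5, 8], ![4, 5, 6, 9]]),
   (6, ![![0, 2, 4, 7], ![1, 9, 5, 8], ![7, 5, 6, 9]]),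
   (4, ![![0, 2, 4, 7], ![4, 3, 5, 8], ![1, 5, 6, 9]]),
   (4, ![![0, 2, 4, 7], ![7, 3, 5, 8], ![1, 5, 6, 9]]),
   (6, ![![0, 5, 4, 7], ![1, 3, 5, 8], ![1, 2, 6, 9]]),
   (6, ![![0, 5, 4, 7], ![1, 9, 5, 8], ![1, 2, 6, 9]]),
   (12, ![![0, 5, 4, 7], ![1, 9, 5, 8], ![4, 2, 6, 9]]),
   (6, ![![0, 5, 4, 7], ![4, 9, 5, 8], ![4, 2, 6, 9]]),
   (6, ![![0, 5, 4, 7], ![7, 9, 5, 8], ![4, 2, 6, 9]]),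
   (6, ![![0, 5, 4, 7], ![7, 9, 5, 8], ![7, 2, 6, 9]]),
   (-3, ![![0, 5, 4, 7], ![1, 6, 5, 8], ![1, 5, 6, 9]]),
   (-6, ![![0, 5, 4, 7], ![4, 6, 5, 8], ![7, 5, 6, 9]]),
   (-6, ![![0, 5, 4, 7], ![4, 9, 5, 8], ![7, 5, 6, 9]])]

/-- The known 4D solution. -/
noncomputable def knownSolution : Formula 2 :=
  (knownTerms.map fun q => (q.1 : ℝ) • skewPair q.2).sum

/-- The micro-graph `Γ(a², a¹)`: the copies of `a¹` and `a²` are interchanged, and the last two edges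
of each source are put back into the order `a¹`, `a²`. -/
def swapCasimirs (H : MicroGraph 2) : MicroGraph 2 := fun s e =>
  (![0, 1, 2, 3, 7, 8, 9, 4, 5, 6] : Fin 10 → Fin 10) (H s (Equiv.swap 2 3 e))

/-- The 4D micro-graphs that occur in the skew pairs of the known solution. -/
def occurring : Set (MicroGraph 2) :=
  {H | ∃ q ∈ knownTerms, H = q.2 ∨ H = swapCasimirs q.2}

/-! ### The lists of 3D sunflower micro-graphs

The graph with the number `k` in the list has the index `k - 1`. -/

/-- The 13 vanishing micro-graphs. -/
def vanishing : Fin 13 → MicroGraph 1 :=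
  ![![![0, 1, 4], ![1, 6, 5], ![4, 5, 6]],
    ![![0, 1, 4], ![4, 6, 5], ![1, 5, 6]],
    ![![0, 2, 4], ![1, 3, 5], ![4, 2, 6]],
    ![![0, 5, 4], ![4, 3, 5], ![1, 2, 6]],
    ![![0, 5, 4], ![1, 3, 5], ![4, 2, 6]],
    ![![0, 5, 4], ![4, 6, 5], ![1, 2, 6]],
    ![![0, 5, 4], ![1, 6, 5], ![4, 2, 6]],
    ![![0, 2, 4], ![1, 3, 5], ![4, 5, 6]],
    ![![0, 2, 4], ![4, 6, 5], ![1, 5, 6]],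
    ![![0, 2, 4], ![1, 6, 5], ![4, 5, 6]],
    ![![0, 5, 4], ![1, 3, 5], ![4, 5, 6]],
    ![![0, 5, 4], ![4, 3, 5], ![4, 5, 6]],
    ![![0, 5, 4], ![4, 6, 5], ![4, 5, 6]]]

/-- The 20 basic micro-graphs. -/
def basis : Fin 20 → MicroGraph 1 :=
  ![![![0, 1, 4], ![1, 3, 5], ![1, 2, 6]],
    ![![0, 1, 4], ![1, 6, 5], ![1, 2, 6]],
    ![![0, 1, 4], ![1, 3, 5], ![4, 2, 6]],
    ![![0, 1, 4], ![1, 6, 5], ![4, 2, 6]],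
    ![![0, 1, 4], ![4, 6, 5], ![1, 2, 6]],
    ![![0, 1, 4], ![4, 3, 5], ![4, 2, 6]],
    ![![0, 1, 4], ![4, 6, 5], ![4, 2, 6]],
    ![![0, 1, 4], ![1, 6, 5], ![1, 5, 6]],
    ![![0, 1, 4], ![4, 6, 5], ![4, 5, 6]],
    ![![0, 2, 4], ![1, 3, 5], ![1, 2, 6]],
    ![![0, 2, 4], ![1, 6, 5], ![1, 2, 6]],
    ![![0, 2, 4], ![4, 3, 5], ![4, 2, 6]],
    ![![0, 2, 4], ![4, 6, 5], ![4, 2, 6]],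
    ![![0, 2, 4], ![1, 3, 5], ![1, 5, 6]],
    ![![0, 2, 4], ![1, 6, 5], ![1, 5, 6]],
    ![![0, 2, 4], ![4, 3, 5], ![1, 5, 6]],
    ![![0, 5, 4], ![1, 3, 5], ![1, 2, 6]],
    ![![0, 5, 4], ![4, 3, 5], ![4, 2, 6]],
    ![![0, 5, 4], ![1, 3, 5], ![1, 5, 6]],
    ![![0, 5, 4], ![1, 6, 5], ![1, 5, 6]]]

/-- The two remaining micro-graphs. -/
def extra₁ : MicroGraph 1 := ![![0, 5, 4], ![1, 6, 5], ![1, 2, 6]]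
def extra₂ : MicroGraph 1 := ![![0, 5, 4], ![4, 6, 5], ![4, 2, 6]]

end NambuMicro

/-!
**The known 4D solution is trivialising.** Over dimension four put
`D = Q(P) - ⟦P, X⟧`, the `defect` of `X`. In linear coordinates `x = A y` the Nambu-Poisson bi-vector
and the formula of a micro-graph become their transforms, times the powers `det A` and `(det A) ^ 3`,
because an alternating sum over the vectors of a frame depends on the frame only through its
determinant (`sum_sign_frame`). All contractions in `Q` and in the Schouten bracket pair a vector with
a covector (`contract_frame`), so `D` is a bi-vector times `(det A) ^ 4` (`defect_comp`), and it is
enough that it vanishes at each point in some frame. Along a family of data that is polynomial in a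
parameter `t` the defect is continuous in `t`, so it is also enough to treat generic data
(`SolvesAt.of_generic`). Both facts together reduce the problem to points where the differentials of
the Casimirs are `dx₂` and `dx₃`, and most of the entries of the Hessian of `a¹` outside the diagonal
are zero (`isTrivialising_of_isNormalAt`); by skewness and by the interchange of the first two
coordinates, four components of `D` are left. Each one is a polynomial, with integer coefficients after
clearing denominators, in the partial derivatives of order at most four of `ϱ, a¹, a²`. The kernel
expands these polynomials and finds that all the terms cancel.

**The polynomials.** A partial derivative is represented by a prime number and a monomial by the
product of its variables. The primes are free generators of the monoid of positive integers, so all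
assignments of real values to them extend to homomorphisms of monoids with zero
(`exists_hom_of_primes`). Hence the identities of the sparse polynomials `SPoly` hold for all smooth
data; that the programs in the namespace `Symbolic` compute the formulas is `eval_formula_eq`.

**The formulas over dimension three.** There are 48 sunflower micro-graphs. The same expansion proves
that 13 formulas are zero (`φ_vanishing`), and that twice each of the 15 formulas in neither of the two
lists is a non-trivial integer combination of the basic ones (`two_smul_φ_dependent`). The 20 basic
formulas are linearly independent because a 20 by 20 matrix of their values, on seven structures whose
`ϱ` and `a¹` are sums of exponentials, is an integer matrix that is invertible modulo five
(`linearIndependent_basis`).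

**The parents.** A 4D micro-graph determines its 3D parent: identify the copies of the two Casimirs
(`collapse`, `eq_collapse`). So the seventeen collapses of the occurring micro-graphs form the least
admissible set. If isomorphisms are allowed, then a micro-graph may descend from other sunflower
micro-graphs, but for one representative of each of the seventeen parents there is little choice: up to
two replacements that keep the seventeen parents apart (`merge`), the parent of each isomorphic
micro-graph is the collapse of the representative (`merge_eq_collapse`). Hence at least seventeen
parents are needed.
-/

namespace NambuMicro

/-! ### Iterated directional derivatives -/

/-- The derivative of `f` in the direction of the constant vector field `v`. -/
noncomputable def dd {d : ℕ} (v : Fin d → ℝ) (f : (Fin d → ℝ) → ℝ) : (Fin d → ℝ) → ℝ :=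
  fun x => fderiv ℝ f x v

/-- The iterated derivative in the directions of a list of constant vector fields. -/
noncomputable def dds {d : ℕ} (V : List (Fin d → ℝ)) (f : (Fin d → ℝ) → ℝ) : (Fin d → ℝ) → ℝ :=
  V.foldr dd f

section Derivatives

variable {d : ℕ} {f g : (Fin d → ℝ) → ℝ}

theorem pd_eq_dd (i : Fin d) (f : (Fin d → ℝ) → ℝ) : pd i f = dd (Pi.single i 1) f := rfl

theorem pds_eq_dds (L : List (Fin d)) (f : (Fin d → ℝ) → ℝ) :
    pds L f = dds (L.map fun i => Pi.single i 1) f := by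
  induction L with
  | nil => rfl
  | cons i L ih => exact congrArg (dd (Pi.single i 1)) ih

@[simp] theorem pds_nil (f : (Fin d → ℝ) → ℝ) : pds [] f = f := rfl

@[simp] theorem pds_cons (i : Fin d) (L : List (Fin d)) (f : (Fin d → ℝ) → ℝ) :
    pds (i :: L) f = pd i (pds L f) := rfl

@[simp] theorem dds_nil (f : (Fin d → ℝ) → ℝ) : dds [] f = f := rfl

@[simp] theorem dds_cons (v : Fin d → ℝ) (V : List (Fin d → ℝ)) (f : (Fin d → ℝ) → ℝ) :
    dds (v :: V) f = dd v (dds V f) := rfl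

theorem smooth_dd (hf : ContDiff ℝ ∞ f) (v : Fin d → ℝ) : ContDiff ℝ ∞ (dd v f) :=
  (hf.fderiv_right (m := ∞) (by simp)).clm_apply contDiff_const

theorem smooth_pd (hf : ContDiff ℝ ∞ f) (i : Fin d) : ContDiff ℝ ∞ (pd i f) := smooth_dd hf _

theorem smooth_dds (hf : ContDiff ℝ ∞ f) (V : List (Fin d → ℝ)) : ContDiff ℝ ∞ (dds V f) := by
  induction V with
  | nil => exact hf
  | cons v V ih => exact smooth_dd ih v

theorem smooth_pds (hf : ContDiff ℝ ∞ f) (L : List (Fin d)) : ContDiff ℝ ∞ (pds L f) := by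
  rw [pds_eq_dds]; exact smooth_dds hf _

theorem smooth_diffAt (hf : ContDiff ℝ ∞ f) (x : Fin d → ℝ) : DifferentiableAt ℝ f x :=
  (hf.differentiable (by simp)).differentiableAt

theorem smooth_coord (i : Fin d) : ContDiff ℝ ∞ (fun x : Fin d → ℝ => x i) :=
  contDiff_apply ℝ ℝ i

theorem dd_add (hf : ContDiff ℝ ∞ f) (hg : ContDiff ℝ ∞ g) (v : Fin d → ℝ) :
    dd v (fun x => f x + g x) = fun x => dd v f x + dd v g x := by
  funext x
  have := fderiv_add (smooth_diffAt hf x) (smooth_diffAt hg x)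
  simp only [dd]
  change fderiv ℝ (f + g) x v = _
  rw [this]; rfl

theorem dd_mul (hf : ContDiff ℝ ∞ f) (hg : ContDiff ℝ ∞ g) (v : Fin d → ℝ) :
    dd v (fun x => f x * g x) = fun x => dd v f x * g x + f x * dd v g x := by
  funext x
  have := fderiv_mul (smooth_diffAt hf x) (smooth_diffAt hg x)
  simp only [dd]
  change fderiv ℝ (f * g) x v = _
  rw [this]
  simp [mul_comm]
  ring

theorem dd_const (c : ℝ) (v : Fin d → ℝ) : dd v (fun _ => c) = fun _ => 0 := by
  funext x; simp [dd]

theorem dd_const_mul (hf : ContDiff ℝ ∞ f) (c : ℝ) (v : Fin d → ℝ) :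
    dd v (fun x => c * f x) = fun x => c * dd v f x := by
  rw [dd_mul contDiff_const hf, dd_const]; simp

theorem dd_sum {ι : Type*} (s : Finset ι) {f : ι → (Fin d → ℝ) → ℝ}
    (hf : ∀ i, ContDiff ℝ ∞ (f i)) (v : Fin d → ℝ) :
    dd v (fun x => ∑ i ∈ s, f i x) = fun x => ∑ i ∈ s, dd v (f i) x := by
  classical
  induction s using Finset.induction_on with
  | empty => simpa using dd_const (d := d) 0 v
  | insert a s ha ih =>
    simp only [Finset.sum_insert ha]
    rw [dd_add (hf a) (ContDiff.sum fun i _ => hf i), ih]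

theorem dd_comm (hf : ContDiff ℝ ∞ f) (u v : Fin d → ℝ) : dd u (dd v f) = dd v (dd u f) := by
  funext x
  have key : ∀ u v : Fin d → ℝ, dd u (dd v f) x = fderiv ℝ (fderiv ℝ f) x u v := fun u v => by
    have h1 : DifferentiableAt ℝ (fderiv ℝ f) x :=
      ((hf.fderiv_right (m := ∞) (by simp)).differentiable (by simp)).differentiableAt
    have := fderiv_clm_apply h1 (differentiableAt_const (c := v))
    change fderiv ℝ (fun y => fderiv ℝ f y v) x u = _
    rw [this]; simp
  rw [key, key]
  refine (hf.contDiffAt.isSymmSndFDerivAt (n := ∞) ?_) u v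
  rw [minSmoothness_of_isRCLikeNormedField]
  exact WithTop.coe_le_coe.2 (le_top : (2 : ℕ∞) ≤ ⊤)

theorem dd_vec_add (u v : Fin d → ℝ) (f : (Fin d → ℝ) → ℝ) :
    dd (u + v) f = fun x => dd u f x + dd v f x := by
  funext x; simp [dd]

theorem dd_vec_smul (c : ℝ) (v : Fin d → ℝ) (f : (Fin d → ℝ) → ℝ) :
    dd (c • v) f = fun x => c * dd v f x := by
  funext x; simp [dd]

theorem dd_vec_sum {ι : Type*} (s : Finset ι) (c : ι → ℝ) (v : ι → Fin d → ℝ)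
    (f : (Fin d → ℝ) → ℝ) :
    dd (∑ i ∈ s, c i • v i) f = fun x => ∑ i ∈ s, c i * dd (v i) f x := by
  funext x; simp [dd]

theorem pds_perm (hf : ContDiff ℝ ∞ f) {L M : List (Fin d)} (h : L.Perm M) : pds L f = pds M f := by
  induction h with
  | nil => rfl
  | cons i _ ih => simp [ih]
  | swap i j L => exact dd_comm (smooth_pds hf L) _ _
  | trans _ _ ih₁ ih₂ => exact ih₁.trans ih₂

theorem pds_pd (hf : ContDiff ℝ ∞ f) (L : List (Fin d)) (i : Fin d) :
    pds L (pd i f) = pds (i :: L) f := by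
  induction L with
  | nil => rfl
  | cons j L ih => rw [pds_cons, ih, pds_cons, pds_cons, pds_cons]
                   exact dd_comm (smooth_pds hf L) _ _

theorem pds_add (hf : ContDiff ℝ ∞ f) (hg : ContDiff ℝ ∞ g) (L : List (Fin d)) :
    pds L (fun x => f x + g x) = fun x => pds L f x + pds L g x := by
  induction L with
  | nil => rfl
  | cons i L ih => rw [pds_cons, ih]; exact dd_add (smooth_pds hf L) (smooth_pds hg L) _

theorem pds_const_mul (hf : ContDiff ℝ ∞ f) (c : ℝ) (L : List (Fin d)) :
    pds L (fun x => c * f x) = fun x => c * pds L f x := by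
  induction L with
  | nil => rfl
  | cons i L ih => rw [pds_cons, ih]; exact dd_const_mul (smooth_pds hf L) _ _

theorem pds_zero (L : List (Fin d)) : pds L (fun _ => 0) = fun _ => 0 := by
  induction L with
  | nil => rfl
  | cons i L ih => rw [pds_cons, ih]; exact dd_const 0 _

theorem pds_sum {ι : Type*} (s : Finset ι) {f : ι → (Fin d → ℝ) → ℝ}
    (hf : ∀ i, ContDiff ℝ ∞ (f i)) (L : List (Fin d)) :
    pds L (fun x => ∑ i ∈ s, f i x) = fun x => ∑ i ∈ s, pds L (f i) x := by
  induction L with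
  | nil => rfl
  | cons i L ih => rw [pds_cons, ih]; exact dd_sum s (fun i => smooth_pds (hf i) L) _

theorem pd_coord (i j : Fin d) : pd i (fun x : Fin d → ℝ => x j) = fun _ => if i = j then 1 else 0 := by
  funext x
  have : HasFDerivAt (fun x : Fin d → ℝ => x j) (ContinuousLinearMap.proj (R := ℝ) j) x :=
    (ContinuousLinearMap.proj (R := ℝ) (φ := fun _ : Fin d => ℝ) j).hasFDerivAt
  simp only [pd, this.fderiv, ContinuousLinearMap.proj_apply, Pi.single_apply, eq_comm]

end Derivatives

/-! ### Families that are polynomial in a parameter -/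

/-- The families `t ↦ f t` of functions that are generated under sums and products by the constant
families of smooth functions and by the family of the constant functions `t`. -/
inductive PolyFamily {d : ℕ} : (ℝ → (Fin d → ℝ) → ℝ) → Prop
  | base {f : (Fin d → ℝ) → ℝ} (hf : ContDiff ℝ ∞ f) : PolyFamily fun _ => f
  | param : PolyFamily fun t _ => t
  | add {f g : ℝ → (Fin d → ℝ) → ℝ} :
      PolyFamily f → PolyFamily g → PolyFamily fun t x => f t x + g t x
  | mul {f g : ℝ → (Fin d → ℝ) → ℝ} :
      PolyFamily f → PolyFamily g → PolyFamily fun t x => f t x * g t x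

namespace PolyFamily

variable {d : ℕ} {f g : ℝ → (Fin d → ℝ) → ℝ}

theorem smooth (h : PolyFamily f) (t : ℝ) : ContDiff ℝ ∞ (f t) := by
  induction h with
  | base hf => exact hf
  | param => exact contDiff_const
  | add _ _ h₁ h₂ => exact h₁.add h₂
  | mul _ _ h₁ h₂ => exact h₁.mul h₂

theorem continuous_param (h : PolyFamily f) (x : Fin d → ℝ) : Continuous fun t => f t x := by
  induction h with
  | base hf => exact continuous_const
  | param => exact continuous_id
  | add _ _ h₁ h₂ => exact h₁.add h₂
  | mul _ _ h₁ h₂ => exact h₁.mul h₂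

theorem const (c : ℝ) : PolyFamily fun _ (_ : Fin d → ℝ) => c := base contDiff_const

theorem pd (h : PolyFamily f) (i : Fin d) : PolyFamily fun t => pd i (f t) := by
  induction h with
  | base hf => exact base (smooth_pd hf i)
  | param => simpa only [pd_eq_dd, dd_const] using const 0
  | add h₁ h₂ ih₁ ih₂ =>
    have := ih₁.add ih₂
    simp only [pd_eq_dd] at this ⊢
    simpa only [dd_add (h₁.smooth _) (h₂.smooth _)] using this
  | mul h₁ h₂ ih₁ ih₂ =>
    have := (ih₁.mul h₂).add (h₁.mul ih₂)
    simp only [pd_eq_dd] at this ⊢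
    simpa only [dd_mul (h₁.smooth _) (h₂.smooth _)] using this

theorem pds (h : PolyFamily f) (L : List (Fin d)) : PolyFamily fun t => pds L (f t) := by
  induction L with
  | nil => exact h
  | cons i L ih => exact ih.pd i

theorem neg (h : PolyFamily f) : PolyFamily fun t x => -f t x := by
  simpa using (const (-1)).mul h

theorem sub (hf : PolyFamily f) (hg : PolyFamily g) : PolyFamily fun t x => f t x - g t x := by
  simpa only [sub_eq_add_neg] using hf.add hg.neg

theorem sum {ι : Type*} (s : Finset ι) {f : ι → ℝ → (Fin d → ℝ) → ℝ} (h : ∀ i, PolyFamily (f i)) :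
    PolyFamily fun t x => ∑ i ∈ s, f i t x := by
  classical
  induction s using Finset.induction_on with
  | empty => simpa using const 0
  | insert a s ha ih => simpa only [Finset.sum_insert ha] using (h a).add ih

theorem prod {ι : Type*} (s : Finset ι) {f : ι → ℝ → (Fin d → ℝ) → ℝ} (h : ∀ i, PolyFamily (f i)) :
    PolyFamily fun t x => ∏ i ∈ s, f i t x := by
  classical
  induction s using Finset.induction_on with
  | empty => simpa using const 1
  | insert a s ha ih => simpa only [Finset.prod_insert ha] using (h a).mul ih

end PolyFamily

/-! ### Linear changes of coordinates -/

section LinearChange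

variable {d : ℕ}

theorem smooth_comp_mulVec {f : (Fin d → ℝ) → ℝ} (hf : ContDiff ℝ ∞ f)
    (A : Matrix (Fin d) (Fin d) ℝ) : ContDiff ℝ ∞ fun y => f (A.mulVec y) :=
  hf.comp (A.mulVecLin.toContinuousLinearMap.contDiff)

theorem dd_comp_mulVec {f : (Fin d → ℝ) → ℝ} (hf : ContDiff ℝ ∞ f)
    (A : Matrix (Fin d) (Fin d) ℝ) (v : Fin d → ℝ) :
    dd v (fun y => f (A.mulVec y)) = fun y => dd (A.mulVec v) f (A.mulVec y) := by
  funext y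
  have h1 : HasFDerivAt (fun y => A.mulVec y) (A.mulVecLin.toContinuousLinearMap) y :=
    A.mulVecLin.toContinuousLinearMap.hasFDerivAt
  have h2 := (smooth_diffAt hf (A.mulVec y)).hasFDerivAt.comp y h1
  simp only [dd]
  change fderiv ℝ (f ∘ fun y => A.mulVec y) y v = _
  rw [h2.fderiv]; rfl

theorem pds_comp_mulVec {f : (Fin d → ℝ) → ℝ} (hf : ContDiff ℝ ∞ f)
    (A : Matrix (Fin d) (Fin d) ℝ) (L : List (Fin d)) :
    pds L (fun y => f (A.mulVec y)) =
      fun y => dds (L.map fun i => A.mulVec (Pi.single i 1)) f (A.mulVec y) := by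
  induction L with
  | nil => rfl
  | cons i L ih =>
    rw [pds_cons, ih, pd_eq_dd]
    exact dd_comp_mulVec (smooth_dds hf _) A _

theorem mulVec_single_eq_sum (A : Matrix (Fin d) (Fin d) ℝ) (i : Fin d) :
    A.mulVec (Pi.single i 1) = ∑ m, A m i • (Pi.single m 1 : Fin d → ℝ) := by
  ext j; simp [Finset.sum_apply, Pi.single_apply]

theorem dd_mulVec_single (A : Matrix (Fin d) (Fin d) ℝ) (i : Fin d) (f : (Fin d → ℝ) → ℝ) :
    dd (A.mulVec (Pi.single i 1)) f = fun x => ∑ m, A m i * pd m f x := by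
  rw [mulVec_single_eq_sum, dd_vec_sum]; rfl

/-- An alternating sum over the vectors of a frame depends on the frame only through its
determinant. -/
theorem sum_sign_frame (T : MultilinearMap ℝ (fun _ : Fin d => Fin d → ℝ) ℝ)
    (A : Matrix (Fin d) (Fin d) ℝ) :
    ∑ σ : Equiv.Perm (Fin d), ((Equiv.Perm.sign σ : ℤ) : ℝ) *
        T (fun e => A.mulVec (Pi.single (σ e) 1)) =
      A.det * ∑ σ : Equiv.Perm (Fin d), ((Equiv.Perm.sign σ : ℤ) : ℝ) *
        T (fun e => Pi.single (σ e) 1) := by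
  have h : ∀ v : Fin d → Fin d → ℝ, MultilinearMap.alternatization T v =
      ∑ σ : Equiv.Perm (Fin d), ((Equiv.Perm.sign σ : ℤ) : ℝ) * T (fun e => v (σ e)) := fun v => by
    rw [MultilinearMap.alternatization_apply]
    refine Finset.sum_congr rfl fun σ _ => ?_
    simp [Units.smul_def, MultilinearMap.domDomCongr_apply]
  rw [← h fun i => A.mulVec (Pi.single i 1), ← h fun i => Pi.single i 1]
  have h1 := AlternatingMap.eq_smul_basis_det (Pi.basisFun ℝ (Fin d))
    (MultilinearMap.alternatization T)
  have h2 : (Pi.basisFun ℝ (Fin d)).det (fun i => A.mulVec (Pi.single i 1)) = A.det := by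
    have := (Pi.basisFun ℝ (Fin d)).det_comp (Matrix.toLin' A) (Pi.basisFun ℝ (Fin d))
    rw [Module.Basis.det_self, mul_one, LinearMap.det_toLin'] at this
    rw [← this]; congr 1; funext i; simp
  conv_lhs => rw [h1]
  rw [AlternatingMap.smul_apply, h2, smul_eq_mul, mul_comm]
  congr 2
  funext i; simp

theorem sum_fin_three {α : Type*} [Fintype α] (f : (Fin 3 → α) → ℝ) :
    ∑ σ, f σ = ∑ a, ∑ b, ∑ c, f ![a, b, c] := by
  rw [← (Fin.consEquiv fun _ : Fin 3 => α).sum_comp, Fintype.sum_prod_type]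
  refine Finset.sum_congr rfl fun a _ => ?_
  rw [← (Fin.consEquiv fun _ : Fin 2 => α).sum_comp, Fintype.sum_prod_type]
  refine Finset.sum_congr rfl fun b _ => ?_
  rw [← (Fin.consEquiv fun _ : Fin 1 => α).sum_comp, Fintype.sum_prod_type]
  refine Finset.sum_congr rfl fun c _ => ?_
  rw [Fintype.sum_unique]
  congr 1

/-- The multilinear form in the vectors of one source, the vectors of the other sources being
fixed. -/
def sliceMap (M : MultilinearMap ℝ (fun _ : Fin 3 × Fin d => Fin d → ℝ) ℝ) (s : Fin 3)
    (V : Fin 3 × Fin d → Fin d → ℝ) : MultilinearMap ℝ (fun _ : Fin d => Fin d → ℝ) ℝ :=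
  MultilinearMap.mk' (fun W => M fun q => if q.1 = s then W q.2 else V q)
    (by
      intro W e x y
      have h : ∀ x, (fun q : Fin 3 × Fin d => if q.1 = s then Function.update W e x q.2 else V q) =
          Function.update (fun q => if q.1 = s then W q.2 else V q) (s, e) x := fun x => by
        funext ⟨a, b⟩
        by_cases ha : a = s <;> by_cases hb : b = e <;> simp [ha, hb]
      simp only [h, M.map_update_add])
    (by
      intro W e c x
      have h : ∀ x, (fun q : Fin 3 × Fin d => if q.1 = s then Function.update W e x q.2 else V q) =
          Function.update (fun q => if q.1 = s then W q.2 else V q) (s, e) x := fun x => by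
        funext ⟨a, b⟩
        by_cases ha : a = s <;> by_cases hb : b = e <;> simp [ha, hb]
      simp only [h, M.map_update_smul])

/-- The formula of a micro-graph contains three Levi-Civita symbols, hence the third power of the
determinant. -/
theorem sum_sign_three_frames (M : MultilinearMap ℝ (fun _ : Fin 3 × Fin d => Fin d → ℝ) ℝ)
    (A : Matrix (Fin d) (Fin d) ℝ) :
    ∑ σ : Fin 3 → Equiv.Perm (Fin d), (∏ s, ((Equiv.Perm.sign (σ s) : ℤ) : ℝ)) *
        M (fun q => A.mulVec (Pi.single (σ q.1 q.2) 1)) =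
      A.det ^ 3 * ∑ σ : Fin 3 → Equiv.Perm (Fin d), (∏ s, ((Equiv.Perm.sign (σ s) : ℤ) : ℝ)) *
        M (fun q => Pi.single (σ q.1 q.2) 1) := by
  let g : (Fin d → Fin d → ℝ) → (Fin d → Fin d → ℝ) → (Fin d → Fin d → ℝ) → ℝ := fun x y z =>
    ∑ a : Equiv.Perm (Fin d), ∑ b : Equiv.Perm (Fin d), ∑ c : Equiv.Perm (Fin d),
      ((Equiv.Perm.sign a : ℤ) : ℝ) * ((Equiv.Perm.sign b : ℤ) : ℝ) * ((Equiv.Perm.sign c : ℤ) : ℝ) *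
      M fun q => (![fun e => x (a e), fun e => y (b e), fun e => z (c e)] : Fin 3 → _) q.1 q.2
  have hg : ∀ x : Fin d → Fin d → ℝ,
      ∑ σ : Fin 3 → Equiv.Perm (Fin d), (∏ s, ((Equiv.Perm.sign (σ s) : ℤ) : ℝ)) *
        M (fun q => x (σ q.1 q.2)) = g x x x := fun x => by
    rw [sum_fin_three]
    refine Finset.sum_congr rfl fun a _ => Finset.sum_congr rfl fun b _ =>
      Finset.sum_congr rfl fun c _ => ?_
    rw [Fin.prod_univ_three]
    congr 2
    funext ⟨s, e⟩
    fin_cases s <;> rfl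
  have h2 : ∀ x y,
      g x y (fun i => A.mulVec (Pi.single i 1)) = A.det * g x y (fun i => Pi.single i 1) := fun x y => by
    simp only [g, Finset.mul_sum]
    refine Finset.sum_congr rfl fun a _ => Finset.sum_congr rfl fun b _ => ?_
    have := sum_sign_frame (sliceMap M 2 fun q =>
      (![fun e => x (a e), fun e => y (b e), fun _ => 0] : Fin 3 → _) q.1 q.2) A
    have e1 : ∀ W : Fin d → Fin d → ℝ, (sliceMap M 2 fun q =>
      (![fun e => x (a e), fun e => y (b e), fun _ => 0] : Fin 3 → _) q.1 q.2) W =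
        M fun q => (![fun e => x (a e), fun e => y (b e), W] : Fin 3 → _) q.1 q.2 := fun W => by
      change M _ = M _
      congr 1; funext ⟨s, e⟩; fin_cases s <;> rfl
    simp only [e1] at this
    replace this := congrArg
      (fun r => ((Equiv.Perm.sign a : ℤ) : ℝ) * ((Equiv.Perm.sign b : ℤ) : ℝ) * r) this
    simp only [Finset.mul_sum] at this
    exact (Finset.sum_congr rfl fun _ _ => by ring).trans
      (this.trans (Finset.sum_congr rfl fun _ _ => by ring))
  have h1 : ∀ x z,
      g x (fun i => A.mulVec (Pi.single i 1)) z = A.det * g x (fun i => Pi.single i 1) z := fun x z => by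
    simp only [g, Finset.mul_sum]
    refine Finset.sum_congr rfl fun a _ => ?_
    rw [Finset.sum_comm]; conv_rhs => rw [Finset.sum_comm]
    refine Finset.sum_congr rfl fun c _ => ?_
    have := sum_sign_frame (sliceMap M 1 fun q =>
      (![fun e => x (a e), fun _ => 0, fun e => z (c e)] : Fin 3 → _) q.1 q.2) A
    have e1 : ∀ W : Fin d → Fin d → ℝ, (sliceMap M 1 fun q =>
      (![fun e => x (a e), fun _ => 0, fun e => z (c e)] : Fin 3 → _) q.1 q.2) W =
        M fun q => (![fun e => x (a e), W, fun e => z (c e)] : Fin 3 → _) q.1 q.2 := fun W => by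
      change M _ = M _
      congr 1; funext ⟨s, e⟩; fin_cases s <;> rfl
    simp only [e1] at this
    replace this := congrArg
      (fun r => ((Equiv.Perm.sign a : ℤ) : ℝ) * ((Equiv.Perm.sign c : ℤ) : ℝ) * r) this
    simp only [Finset.mul_sum] at this
    exact (Finset.sum_congr rfl fun _ _ => by ring).trans
      (this.trans (Finset.sum_congr rfl fun _ _ => by ring))
  have h0 : ∀ y z,
      g (fun i => A.mulVec (Pi.single i 1)) y z = A.det * g (fun i => Pi.single i 1) y z := fun y z => by
    simp only [g, Finset.mul_sum]
    rw [Finset.sum_comm]; conv_rhs => rw [Finset.sum_comm]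
    refine Finset.sum_congr rfl fun b _ => ?_
    rw [Finset.sum_comm]; conv_rhs => rw [Finset.sum_comm]
    refine Finset.sum_congr rfl fun c _ => ?_
    have := sum_sign_frame (sliceMap M 0 fun q =>
      (![fun _ => 0, fun e => y (b e), fun e => z (c e)] : Fin 3 → _) q.1 q.2) A
    have e1 : ∀ W : Fin d → Fin d → ℝ, (sliceMap M 0 fun q =>
      (![fun _ => 0, fun e => y (b e), fun e => z (c e)] : Fin 3 → _) q.1 q.2) W =
        M fun q => (![W, fun e => y (b e), fun e => z (c e)] : Fin 3 → _) q.1 q.2 := fun W => by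
      change M _ = M _
      congr 1; funext ⟨s, e⟩; fin_cases s <;> rfl
    simp only [e1] at this
    replace this := congrArg
      (fun r => ((Equiv.Perm.sign b : ℤ) : ℝ) * ((Equiv.Perm.sign c : ℤ) : ℝ) * r) this
    simp only [Finset.mul_sum] at this
    exact (Finset.sum_congr rfl fun _ _ => by ring).trans
      (this.trans (Finset.sum_congr rfl fun _ _ => by ring))
  clear_value g
  have key : g (fun i => A.mulVec (Pi.single i 1)) (fun i => A.mulVec (Pi.single i 1))
      (fun i => A.mulVec (Pi.single i 1)) =
      A.det ^ 3 * g (fun i => Pi.single i 1) (fun i => Pi.single i 1) (fun i => Pi.single i 1) := by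
    rw [h0, h1, h2]; ring
  exact (hg _).trans (key.trans (congrArg _ (hg _).symm))

end LinearChange

/-! ### Equivariance of the formulas of micro-graphs -/

/-- The Nambu data in the linear coordinates `y` with `x = A y`. -/
noncomputable def NambuData.comp {n : ℕ} (N : NambuData n)
    (A : Matrix (Fin (n + 2)) (Fin (n + 2)) ℝ) : NambuData n where
  rho := fun y => N.rho (A.mulVec y)
  cas := fun l y => N.cas l (A.mulVec y)
  rho_smooth := smooth_comp_mulVec N.rho_smooth A
  cas_smooth := fun l => smooth_comp_mulVec (N.cas_smooth l) A

/-- The content of a vertex; the sink carries the coordinate function `x_m`, so that the derivative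
along its incoming edge selects the component `∂/∂x_m`. -/
noncomputable def content {n : ℕ} (N : NambuData n) (m : Fin (n + 2)) (v : Vertex n) :
    (Fin (n + 2) → ℝ) → ℝ :=
  if h₀ : v.val = 0 then fun x => x m
  else if h : v.val < 4 then N.rho
  else N.cas ⟨(v.val - 4) / 3, by have := v.isLt; omega⟩

/-- The edges that go to `v`, as pairs of a source and the position of the edge. -/
def edgesTo {n : ℕ} (G : MicroGraph n) (v : Vertex n) : List (Fin 3 × Fin (n + 2)) :=
  (List.finRange 3 ×ˢ List.finRange (n + 2)).filter fun q => G q.1 q.2 = v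

theorem incoming_eq_map {n : ℕ} (G : MicroGraph n) (σ : Fin 3 → Equiv.Perm (Fin (n + 2)))
    (v : Vertex n) : incoming G σ v = (edgesTo G v).map fun q => σ q.1 q.2 := rfl

theorem nodup_edgesTo {n : ℕ} (G : MicroGraph n) (v : Vertex n) : (edgesTo G v).Nodup :=
  ((List.nodup_finRange 3).product (List.nodup_finRange (n + 2))).filter _

theorem mem_edgesTo {n : ℕ} {G : MicroGraph n} {v : Vertex n} {q : Fin 3 × Fin (n + 2)} :
    q ∈ edgesTo G v ↔ G q.1 q.2 = v := by
  rw [edgesTo, List.mem_filter]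
  simp only [decide_eq_true_eq, and_iff_right_iff_imp]
  intro _
  exact List.mem_product.2 ⟨List.mem_finRange _, List.mem_finRange _⟩

section Content

variable {n : ℕ} (N : NambuData n) (m : Fin (n + 2))

theorem content_zero : content N m 0 = fun x => x m := by simp [content]

theorem content_source (s : Fin 3) : content N m (source n s) = N.rho := by
  have : (s : ℕ) + 1 < 4 := by omega
  simp [content, source]

theorem content_casimir (l : Fin n) (s : Fin 3) : content N m (casimir l s) = N.cas l := by
  have h1 : ¬ (3 * ((l : ℕ) + 1) + s + 1 < 4) := by omega
  have h2 : (3 * ((l : ℕ) + 1) + s - 3) / 3 = l := by omega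
  simp [content, casimir, h1, h2]

theorem content_succ (m' : Fin (n + 2)) (v : Fin (3 * n + 3)) :
    content N m v.succ = content N m' v.succ := by simp [content]

theorem smooth_content (v : Vertex n) : ContDiff ℝ ∞ (content N m v) := by
  unfold content
  split_ifs
  · exact smooth_coord m
  · exact N.rho_smooth
  · exact N.cas_smooth _

theorem prod_vertices (g : Vertex n → ℝ) :
    ∏ v, g v = g 0 * (∏ s, g (source n s)) * ∏ l, ∏ s, g (casimir l s) := by
  let e : Unit ⊕ (Fin 3 ⊕ (Fin n × Fin 3)) → Vertex n :=
    Sum.elim (fun _ => 0) (Sum.elim (source n) fun p => casimir p.1 p.2)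
  have he : Function.Bijective e := by
    rw [Fintype.bijective_iff_injective_and_card]
    refine ⟨?_, by simp; omega⟩
    rintro (a | a | a) (b | b | b) h <;>
      simp only [e, Sum.elim_inl, Sum.elim_inr, source, casimir, Fin.ext_iff, Fin.val_zero,
        Sum.inl.injEq, Sum.inr.injEq, Prod.ext_iff, reduceCtorEq] at h ⊢ <;> omega
  rw [← he.prod_comp, Fintype.prod_sum_type, Fintype.prod_sum_type, Fintype.prod_prod_type]
  simp [e, mul_assoc]

end Content

theorem φ_eq_sum {n : ℕ} {G : MicroGraph n} (hG : (edgesTo G 0).length = 1) (N : NambuData n)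
    (m : Fin (n + 2)) (x : Fin (n + 2) → ℝ) :
    φ G N m x = ∑ σ : Fin 3 → Equiv.Perm (Fin (n + 2)),
      (∏ s, ((Equiv.Perm.sign (σ s) : ℤ) : ℝ)) * ∏ v, pds (incoming G σ v) (content N m v) x := by
  unfold φ
  refine Finset.sum_congr rfl fun σ _ => ?_
  rw [prod_vertices]
  obtain ⟨q, hq⟩ := List.length_eq_one_iff.1 hG
  have : (if incoming G σ 0 = [m] then (1 : ℝ) else 0) = pds (incoming G σ 0) (content N m 0) x := by
    rw [content_zero, incoming_eq_map, hq]
    simp [pd_coord]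
  simp only [this, content_source, content_casimir]
  ring

section FrameForm

variable {d : ℕ} {Q : Type*} [DecidableEq Q] {f : (Fin d → ℝ) → ℝ}

theorem dds_map_update_of_notMem {l : List Q} {q : Q} (h : q ∉ l) (V : Q → Fin d → ℝ)
    (u : Fin d → ℝ) : dds (l.map (Function.update V q u)) f = dds (l.map V) f := by
  congr 1
  refine List.map_congr_left fun a ha => Function.update_of_ne ?_ _ _
  rintro rfl; exact h ha

theorem dds_map_update_add (hf : ContDiff ℝ ∞ f) {l : List Q} (hl : l.Nodup) {q : Q} (h : q ∈ l)
    (V : Q → Fin d → ℝ) (u w : Fin d → ℝ) :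
    dds (l.map (Function.update V q (u + w))) f = fun x =>
      dds (l.map (Function.update V q u)) f x + dds (l.map (Function.update V q w)) f x := by
  induction l with
  | nil => simp at h
  | cons a l ih =>
    rw [List.nodup_cons] at hl
    rcases List.mem_cons.1 h with rfl | h
    · simp only [List.map_cons, dds_cons, Function.update_self, dds_map_update_of_notMem hl.1]
      exact dd_vec_add _ _ _
    · have ha : a ≠ q := by rintro rfl; exact hl.1 h
      simp only [List.map_cons, dds_cons, Function.update_of_ne ha, ih hl.2 h]
      exact dd_add (smooth_dds hf _) (smooth_dds hf _) _

theorem dds_map_update_smul (hf : ContDiff ℝ ∞ f) {l : List Q} (hl : l.Nodup) {q : Q} (h : q ∈ l)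
    (V : Q → Fin d → ℝ) (c : ℝ) (u : Fin d → ℝ) :
    dds (l.map (Function.update V q (c • u))) f = fun x =>
      c * dds (l.map (Function.update V q u)) f x := by
  induction l with
  | nil => simp at h
  | cons a l ih =>
    rw [List.nodup_cons] at hl
    rcases List.mem_cons.1 h with rfl | h
    · simp only [List.map_cons, dds_cons, Function.update_self, dds_map_update_of_notMem hl.1]
      exact dd_vec_smul _ _ _
    · have ha : a ≠ q := by rintro rfl; exact hl.1 h
      simp only [List.map_cons, dds_cons, Function.update_of_ne ha, ih hl.2 h]
      exact dd_const_mul (smooth_dds hf _) _ _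

end FrameForm

/-- The product of the contents of the vertices, differentiated along vectors that are attached to
the edges, as a multilinear form in these vectors. -/
noncomputable def edgeForm {n : ℕ} (G : MicroGraph n) {f : Vertex n → (Fin (n + 2) → ℝ) → ℝ}
    (hf : ∀ v, ContDiff ℝ ∞ (f v)) (z : Fin (n + 2) → ℝ) :
    MultilinearMap ℝ (fun _ : Fin 3 × Fin (n + 2) => Fin (n + 2) → ℝ) ℝ :=
  MultilinearMap.mk' (fun V => ∏ v, dds ((edgesTo G v).map V) (f v) z)
    (by
      intro V q x y
      rw [Finset.prod_eq_mul_prod_sdiff_singleton_of_mem (Finset.mem_univ (G q.1 q.2)),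
        Finset.prod_eq_mul_prod_sdiff_singleton_of_mem (Finset.mem_univ (G q.1 q.2)),
        Finset.prod_eq_mul_prod_sdiff_singleton_of_mem (Finset.mem_univ (G q.1 q.2)),
        dds_map_update_add (hf _) (nodup_edgesTo G _) (mem_edgesTo.2 rfl), add_mul]
      have h : ∀ u, ∏ v ∈ Finset.univ \ {G q.1 q.2},
          dds ((edgesTo G v).map (Function.update V q u)) (f v) z =
          ∏ v ∈ Finset.univ \ {G q.1 q.2}, dds ((edgesTo G v).map V) (f v) z := fun u =>
        Finset.prod_congr rfl fun v hv => by
          rw [dds_map_update_of_notMem]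
          intro h; rw [mem_edgesTo] at h; simp [h] at hv
      simp only [h])
    (by
      intro V q c x
      rw [Finset.prod_eq_mul_prod_sdiff_singleton_of_mem (Finset.mem_univ (G q.1 q.2)),
        Finset.prod_eq_mul_prod_sdiff_singleton_of_mem (Finset.mem_univ (G q.1 q.2)),
        dds_map_update_smul (hf _) (nodup_edgesTo G _) (mem_edgesTo.2 rfl), smul_eq_mul, mul_assoc]
      have h : ∀ u, ∏ v ∈ Finset.univ \ {G q.1 q.2},
          dds ((edgesTo G v).map (Function.update V q u)) (f v) z =
          ∏ v ∈ Finset.univ \ {G q.1 q.2}, dds ((edgesTo G v).map V) (f v) z := fun u =>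
        Finset.prod_congr rfl fun v hv => by
          rw [dds_map_update_of_notMem]
          intro h; rw [mem_edgesTo] at h; simp [h] at hv
      simp only [h])

theorem edgeForm_apply {n : ℕ} (G : MicroGraph n) {f : Vertex n → (Fin (n + 2) → ℝ) → ℝ}
    (hf : ∀ v, ContDiff ℝ ∞ (f v)) (z : Fin (n + 2) → ℝ) (V : Fin 3 × Fin (n + 2) → Fin (n + 2) → ℝ) :
    edgeForm G hf z V = ∏ v, dds ((edgesTo G v).map V) (f v) z := rfl

/-- A formula whose value in linear coordinates is the transform of a vector field of weight three,
and is smooth. -/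
structure IsCovariant {n : ℕ} (X : Formula n) : Prop where
  smooth : ∀ N m, ContDiff ℝ ∞ (X N m)
  comp : ∀ (N : NambuData n) (A B : Matrix (Fin (n + 2)) (Fin (n + 2)) ℝ), B * A = 1 → ∀ m y,
    X (N.comp A) m y = A.det ^ 3 * ∑ j, B m j * X N j (A.mulVec y)

theorem IsCovariant.φ {n : ℕ} {G : MicroGraph n} (hG : (edgesTo G 0).length = 1) :
    IsCovariant (φ G) where
  smooth := fun N m => by
    have : NambuMicro.φ G N m = fun x => NambuMicro.φ G N m x := rfl
    simp only [φ_eq_sum hG] at this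
    rw [this]
    exact ContDiff.sum fun σ _ => contDiff_const.mul
      (contDiff_prod fun v _ => smooth_pds (smooth_content N m v) _)
  comp := fun N A B hBA m y => by
    let f : Vertex n → (Fin (n + 2) → ℝ) → ℝ :=
      Fin.cons (fun z => ∑ j, B m j * z j) fun v => content N m v.succ
    have hf : ∀ v, ContDiff ℝ ∞ (f v) := by
      refine Fin.cases ?_ fun v => smooth_content N m v.succ
      change ContDiff ℝ ∞ fun z : Fin (n + 2) → ℝ => ∑ j, B m j * z j
      exact ContDiff.sum fun j _ => contDiff_const.mul (smooth_coord j)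
    have hfA : ∀ v, content (N.comp A) m v = fun y => f v (A.mulVec y) := by
      refine Fin.cases ?_ fun v => ?_
      · rw [content_zero]; funext y
        have h : (B * A).mulVec y m = y m := by rw [hBA, Matrix.one_mulVec]
        rw [← Matrix.mulVec_mulVec] at h
        exact h.symm
      · simp only [f, Fin.cons_succ, content, Fin.val_succ]
        split_ifs <;> first | rfl | contradiction
    rw [φ_eq_sum hG]
    have h1 := sum_sign_three_frames (edgeForm G hf (A.mulVec y)) A
    simp only [edgeForm_apply] at h1
    calc _ = _ := Finset.sum_congr rfl fun σ _ => by
          congr 1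
          refine Finset.prod_congr rfl fun v _ => ?_
          rw [hfA, pds_comp_mulVec (hf v), incoming_eq_map, List.map_map]; rfl
      _ = _ := h1
      _ = _ := by
        congr 1
        simp only [φ_eq_sum hG, Finset.mul_sum]
        rw [Finset.sum_comm]
        refine Finset.sum_congr rfl fun σ _ => ?_
        obtain ⟨q, hq⟩ := List.length_eq_one_iff.1 hG
        have h2 : ∀ (V : Fin 3 × Fin (n + 2) → Fin (n + 2)) (f : Vertex n → (Fin (n + 2) → ℝ) → ℝ) v,
            dds ((edgesTo G v).map fun q => Pi.single (V q) 1) (f v) (A.mulVec y) =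
              pds ((edgesTo G v).map V) (f v) (A.mulVec y) := fun V f v => by
          rw [pds_eq_dds, List.map_map]; rfl
        simp only [h2 (fun q => σ q.1 q.2) f, ← incoming_eq_map]
        simp only [Fin.prod_univ_succ (n := 3 * n + 3)]
        have h3 : pds (incoming G σ 0) (f 0) (A.mulVec y) =
            ∑ j, B m j * pds (incoming G σ 0) (content N j 0) (A.mulVec y) := by
          simp only [incoming_eq_map, hq, List.map_cons, List.map_nil, content_zero]
          change pds _ (fun z => ∑ j, B m j * z j) _ = _
          rw [pds_sum _ fun j => contDiff_const.mul (smooth_coord j)]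
          refine Finset.sum_congr rfl fun j _ => ?_
          rw [pds_const_mul (smooth_coord j)]
        rw [h3, Finset.sum_mul, Finset.mul_sum]
        refine Finset.sum_congr rfl fun j _ => ?_
        have h4 : ∀ v : Fin (3 * n + 3), f v.succ = content N j v.succ := fun v => content_succ N m j v
        simp only [h4]
        ring

namespace IsCovariant

variable {n : ℕ} {X Y : Formula n}

theorem add (hX : IsCovariant X) (hY : IsCovariant Y) : IsCovariant (X + Y) where
  smooth := fun N m => (hX.smooth N m).add (hY.smooth N m)
  comp := fun N A B h m y => by
    simp only [Pi.add_apply, hX.comp N A B h, hY.comp N A B h, mul_add, Finset.sum_add_distrib]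

theorem smul (hX : IsCovariant X) (c : ℝ) : IsCovariant (c • X) where
  smooth := fun N m => contDiff_const.mul (hX.smooth N m)
  comp := fun N A B h m y => by
    simp only [Pi.smul_apply, smul_eq_mul, hX.comp N A B h, Finset.mul_sum]
    exact Finset.sum_congr rfl fun _ _ => by ring

theorem permute (hX : IsCovariant X) (π : Equiv.Perm (Fin n)) :
    IsCovariant fun N => X (N.permute π) where
  smooth := fun _ m => hX.smooth _ m
  comp := fun N A B h m y => hX.comp (N.permute π) A B h m y

theorem zero : IsCovariant (0 : Formula n) where
  smooth := fun _ _ => contDiff_const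
  comp := fun N A B h m y => by simp

theorem list_sum {L : List (Formula n)} (h : ∀ X ∈ L, IsCovariant X) : IsCovariant L.sum := by
  induction L with
  | nil => exact zero
  | cons X L ih =>
    rw [List.sum_cons]
    exact (h X (by simp)).add (ih fun Y hY => h Y (by simp [hY]))

end IsCovariant

/-! ### Equivariance of the tetrahedral flow and of the Schouten bracket -/

section Bivector

variable {n : ℕ} (N : NambuData n)

theorem bivector_apply (i j : Fin (n + 2)) (x : Fin (n + 2) → ℝ) :
    N.bivector i j x = N.rho x *
      (Matrix.of (Matrix.vecCons (Pi.single i 1) (Matrix.vecCons (Pi.single j 1)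
        fun l c => pd c (N.cas l) x))).det := by
  unfold NambuData.bivector NambuData.bracket
  congr 2
  ext r c
  refine Fin.cases ?_ (fun r => Fin.cases ?_ (fun r => ?_) r) r
  · simp [pd_coord, Pi.single_apply]
  · simp [pd_coord, Pi.single_apply]
  · simp

theorem smooth_bivector (i j : Fin (n + 2)) : ContDiff ℝ ∞ (N.bivector i j) := by
  have : N.bivector i j = fun x => N.bivector i j x := rfl
  simp only [bivector_apply, Matrix.det_apply'] at this
  rw [this]
  refine N.rho_smooth.mul (ContDiff.sum fun σ _ => contDiff_const.mul (contDiff_prod fun r _ => ?_))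
  simp only [Matrix.of_apply]
  generalize (σ r) = c
  refine Fin.cases ?_ (fun c => Fin.cases ?_ (fun c => ?_) c) c
  · simpa using contDiff_const
  · simpa using contDiff_const
  · simpa using smooth_pd (N.cas_smooth c) r

theorem bivector_swap (i j : Fin (n + 2)) (x : Fin (n + 2) → ℝ) :
    N.bivector i j x = -N.bivector j i x := by
  rw [bivector_apply, bivector_apply, ← mul_neg]
  congr 1
  have := Matrix.det_permute (Equiv.swap (0 : Fin (n + 2)) 1)
    (Matrix.of (Matrix.vecCons (Pi.single j 1) (Matrix.vecCons (Pi.single i 1)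
        fun l c => pd c (N.cas l) x)))
  rw [Equiv.Perm.sign_swap (by simp)] at this
  simp only [Units.val_neg, Units.val_one, Int.cast_neg, Int.cast_one, neg_mul, one_mul] at this
  rw [← this]
  congr 1
  ext r c
  refine Fin.cases ?_ (fun r => Fin.cases ?_ (fun r => ?_) r) r
  · simp
  · simp
  · rw [Matrix.submatrix_apply, Equiv.swap_apply_of_ne_of_ne (Fin.succ_ne_zero _)
      (by rw [← Fin.succ_zero_eq_one]; exact fun h => Fin.succ_ne_zero _ (Fin.succ_injective _ h))]
    simp

theorem det_vecCons_vecCons_sum {k : ℕ} (u w : Fin (k + 2) → ℝ) (R : Fin k → Fin (k + 2) → ℝ) :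
    (Matrix.of (Matrix.vecCons u (Matrix.vecCons w R))).det =
      ∑ a, ∑ b, u a * w b *
        (Matrix.of (Matrix.vecCons (Pi.single a 1) (Matrix.vecCons (Pi.single b 1) R))).det := by
  have hu : ∀ u : Fin (k + 2) → ℝ, u = ∑ a, u a • (Pi.single a 1 : Fin (k + 2) → ℝ) := fun u => by
    ext i; simp [Finset.sum_apply, Pi.single_apply]
  let D := (Matrix.detRowAlternating (R := ℝ) (n := Fin (k + 2))).toMultilinearMap
  have h : ∀ u w : Fin (k + 2) → ℝ, (Matrix.of (Matrix.vecCons u (Matrix.vecCons w R))).det =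
      D.toLinearMap (Matrix.vecCons 0 (Matrix.vecCons w R)) 0 u := fun u w => by
    rw [MultilinearMap.toLinearMap_apply]
    exact congrArg D (by ext r c; refine Fin.cases ?_ (fun r => ?_) r <;> simp)
  have h' : ∀ u w : Fin (k + 2) → ℝ, (Matrix.of (Matrix.vecCons u (Matrix.vecCons w R))).det =
      D.toLinearMap (Matrix.vecCons u (Matrix.vecCons 0 R)) 1 w := fun u w => by
    rw [MultilinearMap.toLinearMap_apply]
    refine congrArg D ?_
    ext r c
    refine Fin.cases ?_ (fun r => Fin.cases ?_ (fun r => ?_) r) r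
    · simp
    · simp [Function.update]
    · rw [Function.update_of_ne]
      · simp
      · rw [← Fin.succ_zero_eq_one]
        exact fun h => Fin.succ_ne_zero _ (Fin.succ_injective _ h)
  conv_lhs => rw [hu u, h, map_sum]
  refine Finset.sum_congr rfl fun a _ => ?_
  rw [map_smul, ← h]
  conv_lhs => rw [hu w, h', map_sum]
  rw [Finset.smul_sum]
  refine Finset.sum_congr rfl fun b _ => ?_
  rw [map_smul, ← h', smul_eq_mul, smul_eq_mul, mul_assoc]

theorem bivector_comp {A B : Matrix (Fin (n + 2)) (Fin (n + 2)) ℝ} (hBA : B * A = 1)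
    (i j : Fin (n + 2)) (y : Fin (n + 2) → ℝ) :
    (N.comp A).bivector i j y =
      A.det * ∑ a, ∑ b, B i a * B j b * N.bivector a b (A.mulVec y) := by
  have h1 : ∀ i c, (Pi.single i 1 : Fin (n + 2) → ℝ) c = ∑ m, B i m * A m c := fun i c => by
    rw [← Matrix.mul_apply, hBA, Matrix.one_apply, Pi.single_apply]
    simp only [eq_comm]
  have h2 : (Matrix.of (Matrix.vecCons (Pi.single i 1) (Matrix.vecCons (Pi.single j 1)
        fun l c => pd c ((N.comp A).cas l) y))) =
      (Matrix.of (Matrix.vecCons (B i) (Matrix.vecCons (B j)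
        fun l c => pd c (N.cas l) (A.mulVec y)))) * A := by
    ext r c
    rw [Matrix.mul_apply]
    refine Fin.cases ?_ (fun r => Fin.cases ?_ (fun r => ?_) r) r
    · simpa using h1 i c
    · simpa using h1 j c
    · have := congrFun (dd_comp_mulVec (N.cas_smooth r) A (Pi.single c 1)) y
      rw [dd_mulVec_single] at this
      simp only [Matrix.of_apply, Matrix.cons_val_succ]
      refine this.trans (Finset.sum_congr rfl fun m _ => mul_comm _ _)
  rw [bivector_apply, h2, Matrix.det_mul, det_vecCons_vecCons_sum]
  simp only [bivector_apply]
  change N.rho (A.mulVec y) * _ = _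
  rw [← mul_assoc, mul_comm, Finset.mul_sum]
  congr 1
  refine Finset.sum_congr rfl fun a _ => ?_
  rw [Finset.mul_sum]
  exact Finset.sum_congr rfl fun b _ => by ring

end Bivector

section Contraction

variable {d : ℕ}

theorem bilinear_expand {H : (Fin d → ℝ) → (Fin d → ℝ) → ℝ}
    (h₁ : ∀ w, IsLinearMap ℝ fun u => H u w) (h₂ : ∀ u, IsLinearMap ℝ (H u)) (u w : Fin d → ℝ) :
    H u w = ∑ m, ∑ a, u m * w a * H (Pi.single m 1) (Pi.single a 1) := by
  have hu : ∀ u : Fin d → ℝ, u = ∑ a, u a • (Pi.single a 1 : Fin d → ℝ) := fun u => by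
    ext i; simp [Finset.sum_apply, Pi.single_apply]
  have s1 := map_sum (h₁ w).mk' (fun a => u a • (Pi.single a 1 : Fin d → ℝ)) Finset.univ
  rw [← hu] at s1
  change H u w = _ at s1
  rw [s1]
  refine Finset.sum_congr rfl fun m _ => ?_
  rw [map_smul]
  change u m • H _ w = _
  have s2 := map_sum (h₂ (Pi.single m 1)).mk' (fun a => w a • (Pi.single a 1 : Fin d → ℝ))
    Finset.univ
  rw [← hu] at s2
  change H _ w = _ at s2
  rw [s2, Finset.smul_sum]
  refine Finset.sum_congr rfl fun a _ => ?_
  rw [map_smul]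
  change u m • w a • H _ _ = _
  simp [mul_assoc]

/-- The contraction of two indices does not depend on the frame. -/
theorem contract_frame {A B : Matrix (Fin d) (Fin d) ℝ} (hAB : A * B = 1)
    (H : (Fin d → ℝ) → (Fin d → ℝ) → ℝ) (h₁ : ∀ w, IsLinearMap ℝ fun u => H u w)
    (h₂ : ∀ u, IsLinearMap ℝ (H u)) :
    ∑ k, H (A.mulVec (Pi.single k 1)) (B k) = ∑ k, H (Pi.single k 1) (Pi.single k 1) := by
  have e2 : ∀ k, H (A.mulVec (Pi.single k 1)) (B k) =
      ∑ m, ∑ a, A m k * B k a * H (Pi.single m 1) (Pi.single a 1) := fun k => by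
    rw [bilinear_expand h₁ h₂]; simp
  simp only [e2]
  rw [Finset.sum_comm]
  refine Finset.sum_congr rfl fun m _ => ?_
  rw [Finset.sum_comm]
  simp only [← Finset.sum_mul, ← Matrix.mul_apply, hAB, Matrix.one_apply]
  simp

theorem isLin_sum {ι : Type*} {s : Finset ι} {f : ι → (Fin d → ℝ) → ℝ}
    (h : ∀ i, IsLinearMap ℝ (f i)) : IsLinearMap ℝ fun u => ∑ i ∈ s, f i u where
  map_add := fun u w => by simp only [(h _).map_add, Finset.sum_add_distrib]
  map_smul := fun c u => by simp only [(h _).map_smul, Finset.smul_sum]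

theorem isLin_mul {f : (Fin d → ℝ) → ℝ} (h : IsLinearMap ℝ f) (c : ℝ) :
    IsLinearMap ℝ fun u => f u * c where
  map_add := fun u w => by rw [h.map_add, add_mul]
  map_smul := fun a u => by simp only [h.map_smul, smul_eq_mul, mul_assoc]

theorem isLin_const_mul {f : (Fin d → ℝ) → ℝ} (h : IsLinearMap ℝ f) (c : ℝ) :
    IsLinearMap ℝ fun u => c * f u := by
  simpa only [mul_comm] using isLin_mul h c

theorem isLin_eval (a : Fin d) : IsLinearMap ℝ fun u : Fin d → ℝ => u a where
  map_add := fun _ _ => rfl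
  map_smul := fun _ _ => rfl

theorem isLin_dd (f : (Fin d → ℝ) → ℝ) (x : Fin d → ℝ) : IsLinearMap ℝ fun u => dd u f x where
  map_add := fun u w => by simp only [dd_vec_add]
  map_smul := fun c u => by simp only [dd_vec_smul, smul_eq_mul]

end Contraction

/-- The value of the iterated derivative of a bi-vector on two covectors. -/
noncomputable def bivForm {d : ℕ} (P : BivectorField d) (x : Fin d → ℝ) (V : List (Fin d → ℝ))
    (u w : Fin d → ℝ) : ℝ :=
  ∑ a, ∑ b, u a * w b * dds V (P a b) x

section BivForm

variable {d : ℕ} {P : BivectorField d} (hP : ∀ i j, ContDiff ℝ ∞ (P i j)) (x : Fin d → ℝ)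

theorem bivForm_left (V : List (Fin d → ℝ)) (w : Fin d → ℝ) :
    IsLinearMap ℝ fun u => bivForm P x V u w :=
  isLin_sum fun _ => isLin_sum fun _ => isLin_mul (isLin_mul (isLin_eval _) _) _

theorem bivForm_right (V : List (Fin d → ℝ)) (u : Fin d → ℝ) :
    IsLinearMap ℝ fun w => bivForm P x V u w :=
  isLin_sum fun _ => isLin_sum fun _ => isLin_mul (isLin_const_mul (isLin_eval _) _) _

theorem bivForm_first (V : List (Fin d → ℝ)) (u w : Fin d → ℝ) :
    IsLinearMap ℝ fun v => bivForm P x (v :: V) u w :=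
  isLin_sum fun _ => isLin_sum fun _ => isLin_const_mul (isLin_dd _ _) _

include hP

theorem bivForm_second (v' : Fin d → ℝ) (V : List (Fin d → ℝ)) (u w : Fin d → ℝ) :
    IsLinearMap ℝ fun v => bivForm P x (v' :: v :: V) u w := by
  have : (fun v => bivForm P x (v' :: v :: V) u w) = fun v => bivForm P x (v :: v' :: V) u w := by
    funext v
    refine Finset.sum_congr rfl fun a _ => Finset.sum_congr rfl fun b _ => ?_
    simp only [dds_cons, dd_comm (smooth_dds (hP a b) V) v' v]
  rw [this]
  exact bivForm_first x _ u w

theorem bivForm_third (v₁ v₂ : Fin d → ℝ) (V : List (Fin d → ℝ)) (u w : Fin d → ℝ) :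
    IsLinearMap ℝ fun v => bivForm P x (v₁ :: v₂ :: v :: V) u w := by
  have : (fun v => bivForm P x (v₁ :: v₂ :: v :: V) u w) =
      fun v => bivForm P x (v₁ :: v :: v₂ :: V) u w := by
    funext v
    refine Finset.sum_congr rfl fun a _ => Finset.sum_congr rfl fun b _ => ?_
    simp only [dds_cons, dd_comm (smooth_dds (hP a b) V) v₂ v]
  rw [this]
  exact bivForm_second hP x _ _ u w

omit hP

theorem bivForm_single (V : List (Fin d → ℝ)) (i j : Fin d) :
    bivForm P x V (Pi.single i 1) (Pi.single j 1) = dds V (P i j) x := by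
  simp [bivForm, Pi.single_apply]

end BivForm

section Equivariance

variable {n : ℕ} (N : NambuData n) {A B : Matrix (Fin (n + 2)) (Fin (n + 2)) ℝ}

theorem pds_bivector_comp (hBA : B * A = 1) (L : List (Fin (n + 2))) (i j : Fin (n + 2))
    (y : Fin (n + 2) → ℝ) :
    pds L ((N.comp A).bivector i j) y = A.det * bivForm N.bivector (A.mulVec y)
      (L.map fun k => A.mulVec (Pi.single k 1)) (B i) (B j) := by
  have h1 : (N.comp A).bivector i j = fun y => A.det * ∑ q : Fin (n + 2) × Fin (n + 2),
      B i q.1 * B j q.2 * N.bivector q.1 q.2 (A.mulVec y) := by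
    funext y
    rw [bivector_comp N hBA, Fintype.sum_prod_type]
  have h2 : ∀ a b, ContDiff ℝ ∞ fun y => N.bivector a b (A.mulVec y) := fun a b =>
    smooth_comp_mulVec (smooth_bivector N a b) A
  have h3 : ∀ q : Fin (n + 2) × Fin (n + 2), ContDiff ℝ ∞ fun y =>
      B i q.1 * B j q.2 * N.bivector q.1 q.2 (A.mulVec y) := fun q => contDiff_const.mul (h2 _ _)
  rw [h1, pds_const_mul (ContDiff.sum fun q _ => h3 q), pds_sum _ h3]
  dsimp only
  rw [Fintype.sum_prod_type]
  refine congrArg _ (Finset.sum_congr rfl fun a _ => Finset.sum_congr rfl fun b _ => ?_)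
  rw [pds_const_mul (h2 a b), pds_comp_mulVec (smooth_bivector N a b)]

end Equivariance

section Frames

variable {d : ℕ}

theorem isLin_add {f g : (Fin d → ℝ) → ℝ} (hf : IsLinearMap ℝ f) (hg : IsLinearMap ℝ g) :
    IsLinearMap ℝ fun u => f u + g u where
  map_add := fun u w => by rw [hf.map_add, hg.map_add]; ring
  map_smul := fun c u => by simp only [hf.map_smul, hg.map_smul, smul_add]

theorem isLin_sub {f g : (Fin d → ℝ) → ℝ} (hf : IsLinearMap ℝ f) (hg : IsLinearMap ℝ g) :
    IsLinearMap ℝ fun u => f u - g u where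
  map_add := fun u w => by rw [hf.map_add, hg.map_add]; ring
  map_smul := fun c u => by simp only [hf.map_smul, hg.map_smul, smul_sub]

/-- A function of a list of vectors and of two covectors that is linear in the covectors and in the
first three vectors. -/
structure IsTensorial (b : List (Fin d → ℝ) → (Fin d → ℝ) → (Fin d → ℝ) → ℝ) : Prop where
  left : ∀ V w, IsLinearMap ℝ fun u => b V u w
  right : ∀ V u, IsLinearMap ℝ fun w => b V u w
  first : ∀ V u w, IsLinearMap ℝ fun v => b (v :: V) u w
  second : ∀ v₁ V u w, IsLinearMap ℝ fun v => b (v₁ :: v :: V) u w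
  third : ∀ v₁ v₂ V u w, IsLinearMap ℝ fun v => b (v₁ :: v₂ :: v :: V) u w

theorem isTensorial_bivForm {P : BivectorField d} (hP : ∀ i j, ContDiff ℝ ∞ (P i j))
    (x : Fin d → ℝ) : IsTensorial (bivForm P x) where
  left := bivForm_left x
  right := bivForm_right x
  first := bivForm_first x
  second := bivForm_second hP x
  third := bivForm_third hP x

variable {b : List (Fin d → ℝ) → (Fin d → ℝ) → (Fin d → ℝ) → ℝ} {a c e : Fin d → Fin d → ℝ}

theorem contract_tetra₁ (hc : ∀ H : (Fin d → ℝ) → (Fin d → ℝ) → ℝ,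
      (∀ w, IsLinearMap ℝ fun u => H u w) → (∀ u, IsLinearMap ℝ (H u)) →
      ∑ k, H (a k) (c k) = ∑ k, H (e k) (e k))
    (hb : IsTensorial b) (u w : Fin d → ℝ) :
    ∑ k, ∑ l, ∑ m, ∑ k', ∑ l', ∑ m',
      b [a k, a l, a m] u w *
      b [a l'] (c k) (c k') *
      b [a m'] (c l) (c l') *
      b [a k'] (c m) (c m') =
    ∑ k, ∑ l, ∑ m, ∑ k', ∑ l', ∑ m',
      b [e k, e l, e m] u w *
      b [e l'] (e k) (e k') *
      b [e m'] (e l) (e l') *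
      b [e k'] (e m) (e m') := by
  refine (hc (fun p q => ∑ l, ∑ m, ∑ k', ∑ l', ∑ m',
      b [p, a l, a m] u w *
      b [a l'] q (c k') *
      b [a m'] (c l) (c l') *
      b [a k'] (c m) (c m')) ?_ ?_).trans
      (Finset.sum_congr rfl fun k _ => ?_)
  pick_goal 3
  refine (hc (fun p q => ∑ m, ∑ k', ∑ l', ∑ m',
      b [e k, p, a m] u w *
      b [a l'] (e k) (c k') *
      b [a m'] q (c l') *
      b [a k'] (c m) (c m')) ?_ ?_).trans
      (Finset.sum_congr rfl fun l _ => ?_)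
  pick_goal 3
  refine (hc (fun p q => ∑ k', ∑ l', ∑ m',
      b [e k, e l, p] u w *
      b [a l'] (e k) (c k') *
      b [a m'] (e l) (c l') *
      b [a k'] q (c m')) ?_ ?_).trans
      (Finset.sum_congr rfl fun m _ => ?_)
  pick_goal 3
  refine (hc (fun p q => ∑ l', ∑ m',
      b [e k, e l, e m] u w *
      b [a l'] (e k) q *
      b [a m'] (e l) (c l') *
      b [p] (e m) (c m')) ?_ ?_).trans
      (Finset.sum_congr rfl fun k' _ => ?_)
  pick_goal 3
  refine (hc (fun p q => ∑ m',
      b [e k, e l, e m] u w *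
      b [p] (e k) (e k') *
      b [a m'] (e l) q *
      b [e k'] (e m) (c m')) ?_ ?_).trans
      (Finset.sum_congr rfl fun l' _ => ?_)
  pick_goal 3
  refine hc (fun p q =>
      b [e k, e l, e m] u w *
      b [e l'] (e k) (e k') *
      b [p] (e l) (e l') *
      b [e k'] (e m) q) ?_ ?_
  all_goals
    intro _
    repeat' first
      | exact hb.left _ _
      | exact hb.right _ _
      | exact hb.first _ _ _
      | exact hb.second _ _ _ _
      | exact hb.third _ _ _ _ _
      | refine isLin_sum fun _ => ?_
      | refine isLin_mul ?_ _
      | refine isLin_const_mul ?_ _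

theorem contract_tetra₂ (hc : ∀ H : (Fin d → ℝ) → (Fin d → ℝ) → ℝ,
      (∀ w, IsLinearMap ℝ fun u => H u w) → (∀ u, IsLinearMap ℝ (H u)) →
      ∑ k, H (a k) (c k) = ∑ k, H (e k) (e k))
    (hb : IsTensorial b) (u w : Fin d → ℝ) :
    ∑ j, ∑ k, ∑ l, ∑ k', ∑ l', ∑ m',
      b [a k, a l] u (c j) *
      b [a k', a l'] (c k) w *
      b [a m'] (c k') (c l) *
      b [a j] (c m') (c l') =
    ∑ j, ∑ k, ∑ l, ∑ k', ∑ l', ∑ m',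
      b [e k, e l] u (e j) *
      b [e k', e l'] (e k) w *
      b [e m'] (e k') (e l) *
      b [e j] (e m') (e l') := by
  refine (hc (fun p q => ∑ k, ∑ l, ∑ k', ∑ l', ∑ m',
      b [a k, a l] u q *
      b [a k', a l'] (c k) w *
      b [a m'] (c k') (c l) *
      b [p] (c m') (c l')) ?_ ?_).trans
      (Finset.sum_congr rfl fun j _ => ?_)
  pick_goal 3
  refine (hc (fun p q => ∑ l, ∑ k', ∑ l', ∑ m',
      b [p, a l] u (e j) *
      b [a k', a l'] q w *
      b [a m'] (c k') (c l) *
      b [e j] (c m') (c l')) ?_ ?_).trans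
      (Finset.sum_congr rfl fun k _ => ?_)
  pick_goal 3
  refine (hc (fun p q => ∑ k', ∑ l', ∑ m',
      b [e k, p] u (e j) *
      b [a k', a l'] (e k) w *
      b [a m'] (c k') q *
      b [e j] (c m') (c l')) ?_ ?_).trans
      (Finset.sum_congr rfl fun l _ => ?_)
  pick_goal 3
  refine (hc (fun p q => ∑ l', ∑ m',
      b [e k, e l] u (e j) *
      b [p, a l'] (e k) w *
      b [a m'] q (e l) *
      b [e j] (c m') (c l')) ?_ ?_).trans
      (Finset.sum_congr rfl fun k' _ => ?_)
  pick_goal 3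
  refine (hc (fun p q => ∑ m',
      b [e k, e l] u (e j) *
      b [e k', p] (e k) w *
      b [a m'] (e k') (e l) *
      b [e j] (c m') q) ?_ ?_).trans
      (Finset.sum_congr rfl fun l' _ => ?_)
  pick_goal 3
  refine hc (fun p q =>
      b [e k, e l] u (e j) *
      b [e k', e l'] (e k) w *
      b [p] (e k') (e l) *
      b [e j] q (e l')) ?_ ?_
  all_goals
    intro _
    repeat' first
      | exact hb.left _ _
      | exact hb.right _ _
      | exact hb.first _ _ _
      | exact hb.second _ _ _ _
      | exact hb.third _ _ _ _ _
      | refine isLin_sum fun _ => ?_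
      | refine isLin_mul ?_ _
      | refine isLin_const_mul ?_ _

theorem isLin_tetra₁ (hb : IsTensorial b) (H : (Fin d → ℝ) → (Fin d → ℝ) → ℝ)
    (hH : H = fun u w => ∑ k, ∑ l, ∑ m, ∑ k', ∑ l', ∑ m',
      b [e k, e l, e m] u w * b [e l'] (e k) (e k') * b [e m'] (e l) (e l') *
      b [e k'] (e m) (e m')) :
    (∀ w, IsLinearMap ℝ fun u => H u w) ∧ ∀ u, IsLinearMap ℝ (H u) := by
  subst hH
  constructor <;> intro _ <;>
  repeat' first
      | exact hb.left _ _
      | exact hb.right _ _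
      | refine isLin_sum fun _ => ?_
      | refine isLin_mul ?_ _

theorem isLin_tetra₂ (hb : IsTensorial b) (H : (Fin d → ℝ) → (Fin d → ℝ) → ℝ)
    (hH : H = fun u w => ∑ j, ∑ k, ∑ l, ∑ k', ∑ l', ∑ m',
      b [e k, e l] u (e j) * b [e k', e l'] (e k) w * b [e m'] (e k') (e l) *
      b [e j] (e m') (e l')) :
    (∀ w, IsLinearMap ℝ fun u => H u w) ∧ ∀ u, IsLinearMap ℝ (H u) := by
  subst hH
  constructor <;> intro _ <;>
  repeat' first
      | exact hb.left _ _
      | exact hb.right _ _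
      | refine isLin_sum fun _ => ?_
      | refine isLin_mul ?_ _
      | refine isLin_const_mul ?_ _

end Frames

section Equivariance

variable {n : ℕ} (N : NambuData n) {A B : Matrix (Fin (n + 2)) (Fin (n + 2)) ℝ}

theorem tetra₁_comp (hBA : B * A = 1) (i j : Fin (n + 2)) (y : Fin (n + 2) → ℝ) :
    tetra₁ (N.comp A).bivector i j y =
      A.det ^ 4 * ∑ a, ∑ b, B i a * B j b * tetra₁ N.bivector a b (A.mulVec y) := by
  have hb := isTensorial_bivForm (smooth_bivector N) (A.mulVec y)
  have hl := isLin_tetra₁ hb (e := fun k => Pi.single k 1) _ rfl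
  have h0 : ∀ a b, tetra₁ N.bivector a b (A.mulVec y) = ∑ k, ∑ l, ∑ m, ∑ k', ∑ l', ∑ m',
      bivForm N.bivector (A.mulVec y) [Pi.single k 1, Pi.single l 1, Pi.single m 1] (Pi.single a 1) (Pi.single b 1) *
      bivForm N.bivector (A.mulVec y) [Pi.single l' 1] (Pi.single k 1) (Pi.single k' 1) *
      bivForm N.bivector (A.mulVec y) [Pi.single m' 1] (Pi.single l 1) (Pi.single l' 1) *
      bivForm N.bivector (A.mulVec y) [Pi.single k' 1] (Pi.single m 1) (Pi.single m' 1) := fun a b => by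
    simp only [bivForm_single]
    rfl
  simp only [h0]
  rw [← bilinear_expand hl.1 hl.2]
  rw [← contract_tetra₁ (a := fun k => A.mulVec (Pi.single k 1)) (c := B)
    (contract_frame (mul_eq_one_comm.1 hBA)) hb]
  simp only [Finset.mul_sum]
  unfold tetra₁
  refine Finset.sum_congr rfl fun _ _ => Finset.sum_congr rfl fun _ _ =>
    Finset.sum_congr rfl fun _ _ => Finset.sum_congr rfl fun _ _ =>
    Finset.sum_congr rfl fun _ _ => Finset.sum_congr rfl fun _ _ => ?_
  have h1 : ∀ k i j, pd k ((N.comp A).bivector i j) y = _ := fun k i j =>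
    pds_bivector_comp N hBA [k] i j y
  simp only [pds_bivector_comp N hBA, h1, List.map_cons, List.map_nil]
  ring

theorem tetra₂_comp (hBA : B * A = 1) (i j : Fin (n + 2)) (y : Fin (n + 2) → ℝ) :
    tetra₂ (N.comp A).bivector i j y =
      A.det ^ 4 * ∑ a, ∑ b, B i a * B j b * tetra₂ N.bivector a b (A.mulVec y) := by
  have hb := isTensorial_bivForm (smooth_bivector N) (A.mulVec y)
  have hl := isLin_tetra₂ hb (e := fun k => Pi.single k 1) _ rfl
  have h0 : ∀ a b, tetra₂ N.bivector a b (A.mulVec y) = ∑ j, ∑ k, ∑ l, ∑ k', ∑ l', ∑ m',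
      bivForm N.bivector (A.mulVec y) [Pi.single k 1, Pi.single l 1] (Pi.single a 1) (Pi.single j 1) *
      bivForm N.bivector (A.mulVec y) [Pi.single k' 1, Pi.single l' 1] (Pi.single k 1) (Pi.single b 1) *
      bivForm N.bivector (A.mulVec y) [Pi.single m' 1] (Pi.single k' 1) (Pi.single l 1) *
      bivForm N.bivector (A.mulVec y) [Pi.single j 1] (Pi.single m' 1) (Pi.single l' 1) := fun a b => by
    simp only [bivForm_single]
    rfl
  simp only [h0]
  rw [← bilinear_expand hl.1 hl.2]
  rw [← contract_tetra₂ (a := fun k => A.mulVec (Pi.single k 1)) (c := B)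
    (contract_frame (mul_eq_one_comm.1 hBA)) hb]
  simp only [Finset.mul_sum]
  unfold tetra₂
  refine Finset.sum_congr rfl fun _ _ => Finset.sum_congr rfl fun _ _ =>
    Finset.sum_congr rfl fun _ _ => Finset.sum_congr rfl fun _ _ =>
    Finset.sum_congr rfl fun _ _ => Finset.sum_congr rfl fun _ _ => ?_
  have h1 : ∀ k i j, pd k ((N.comp A).bivector i j) y = _ := fun k i j =>
    pds_bivector_comp N hBA [k] i j y
  simp only [pds_bivector_comp N hBA, h1, List.map_cons, List.map_nil]
  ring

theorem tetraFlow_comp (hBA : B * A = 1) (i j : Fin (n + 2)) (y : Fin (n + 2) → ℝ) :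
    tetraFlow (N.comp A).bivector i j y =
      A.det ^ 4 * ∑ a, ∑ b, B i a * B j b * tetraFlow N.bivector a b (A.mulVec y) := by
  have h : ∑ a, ∑ b, B i a * B j b * tetra₂ N.bivector b a (A.mulVec y) =
      ∑ a, ∑ b, B j a * B i b * tetra₂ N.bivector a b (A.mulVec y) := by
    rw [Finset.sum_comm]
    exact Finset.sum_congr rfl fun a _ => Finset.sum_congr rfl fun b _ => by ring
  simp only [tetraFlow, tetra₁_comp N hBA, tetra₂_comp N hBA, mul_add, mul_sub, mul_div_assoc,
    Finset.sum_add_distrib, sub_div, Finset.sum_sub_distrib]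
  rw [← Finset.sum_congr rfl fun a _ => Finset.sum_congr rfl fun b _ => rfl]
  have h2 : ∑ a, ∑ b, B i a * B j b * (6 * (tetra₂ N.bivector b a (A.mulVec y) / 2)) =
      3 * ∑ a, ∑ b, B j a * B i b * tetra₂ N.bivector a b (A.mulVec y) := by
    rw [← h]
    simp only [Finset.mul_sum]
    exact Finset.sum_congr rfl fun a _ => Finset.sum_congr rfl fun b _ => by ring
  have h3 : ∑ a, ∑ b, B i a * B j b * (6 * (tetra₂ N.bivector a b (A.mulVec y) / 2)) =
      3 * ∑ a, ∑ b, B i a * B j b * tetra₂ N.bivector a b (A.mulVec y) := by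
    simp only [Finset.mul_sum]
    exact Finset.sum_congr rfl fun a _ => Finset.sum_congr rfl fun b _ => by ring
  rw [h2, h3]
  ring

theorem schouten_comp {X : Formula n} (hX : IsCovariant X) (hBA : B * A = 1) (i j : Fin (n + 2))
    (y : Fin (n + 2) → ℝ) :
    schouten (N.comp A).bivector (X (N.comp A)) i j y =
      A.det ^ 4 * ∑ a, ∑ b, B i a * B j b * schouten N.bivector (X N) a b (A.mulVec y) := by
  have hAB := mul_eq_one_comm.1 hBA
  set x := A.mulVec y with hx
  have hXc : ∀ m, X (N.comp A) m = fun y => A.det ^ 3 * ∑ j, B m j * X N j (A.mulVec y) := fun m =>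
    funext fun y => hX.comp N A B hBA m y
  have hs : ∀ (m j), ContDiff ℝ ∞ fun y => B m j * X N j (A.mulVec y) := fun m j =>
    contDiff_const.mul (smooth_comp_mulVec (hX.smooth N j) A)
  have hdX : ∀ k m, pd k (X (N.comp A) m) y =
      A.det ^ 3 * ∑ j, B m j * dd (A.mulVec (Pi.single k 1)) (X N j) x := fun k m => by
    rw [hXc, pd_eq_dd, dd_const_mul (ContDiff.sum fun j _ => hs m j), dd_sum _ (hs m)]
    refine congrArg _ (Finset.sum_congr rfl fun j _ => ?_)
    rw [dd_const_mul (smooth_comp_mulVec (hX.smooth N j) A), dd_comp_mulVec (hX.smooth N j)]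
  have hP : ∀ i j, (N.comp A).bivector i j y = A.det * bivForm N.bivector x [] (B i) (B j) :=
    fun i j => pds_bivector_comp N hBA [] i j y
  have hdP : ∀ k i j, pd k ((N.comp A).bivector i j) y =
      A.det * bivForm N.bivector x [A.mulVec (Pi.single k 1)] (B i) (B j) :=
    fun k i j => pds_bivector_comp N hBA [k] i j y
  have hb := isTensorial_bivForm (smooth_bivector N) x
  let H : (Fin (n + 2) → ℝ) → (Fin (n + 2) → ℝ) → (Fin (n + 2) → ℝ) → (Fin (n + 2) → ℝ) → ℝ :=
    fun u w p q => bivForm N.bivector x [] q w * ∑ a, u a * dd p (X N a) x +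
      bivForm N.bivector x [] u q * ∑ a, w a * dd p (X N a) x -
      (∑ a, q a * X N a x) * bivForm N.bivector x [p] u w
  have key : ∑ k, H (B i) (B j) (A.mulVec (Pi.single k 1)) (B k) =
      ∑ k, H (B i) (B j) (Pi.single k 1) (Pi.single k 1) := by
    refine contract_frame hAB (H (B i) (B j)) ?_ ?_
    · intro _
      repeat' first
        | exact hb.left _ _
        | exact hb.right _ _
        | exact hb.first _ _ _
        | exact isLin_dd _ _
        | exact isLin_eval _
        | refine isLin_sub ?_ ?_
        | refine isLin_add ?_ ?_
        | refine isLin_sum fun _ => ?_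
        | refine isLin_mul ?_ _
        | refine isLin_const_mul ?_ _
    · intro _
      repeat' first
        | exact hb.left _ _
        | exact hb.right _ _
        | exact hb.first _ _ _
        | exact isLin_dd _ _
        | exact isLin_eval _
        | refine isLin_sub ?_ ?_
        | refine isLin_add ?_ ?_
        | refine isLin_sum fun _ => ?_
        | refine isLin_mul ?_ _
  have key2 : ∑ k, H (B i) (B j) (Pi.single k 1) (Pi.single k 1) =
      ∑ a, ∑ b, B i a * B j b * schouten N.bivector (X N) a b x := by
    refine (bilinear_expand (H := fun u w => ∑ k, H u w (Pi.single k 1) (Pi.single k 1))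
      ?_ ?_ (B i) (B j)).trans ?_
    · intro _
      repeat' first
        | exact hb.left _ _
        | exact hb.right _ _
        | exact hb.first _ _ _
        | exact isLin_dd _ _
        | exact isLin_eval _
        | refine isLin_sub ?_ ?_
        | refine isLin_add ?_ ?_
        | refine isLin_sum fun _ => ?_
        | refine isLin_mul ?_ _
        | refine isLin_const_mul ?_ _
    · intro _
      repeat' first
        | exact hb.left _ _
        | exact hb.right _ _
        | exact hb.first _ _ _
        | exact isLin_dd _ _
        | exact isLin_eval _
        | refine isLin_sub ?_ ?_
        | refine isLin_add ?_ ?_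
        | refine isLin_sum fun _ => ?_
        | refine isLin_mul ?_ _
        | refine isLin_const_mul ?_ _
    · refine Finset.sum_congr rfl fun a _ => Finset.sum_congr rfl fun b _ => ?_
      congr 1
      unfold schouten
      refine Finset.sum_congr rfl fun k _ => ?_
      simp only [H, bivForm_single, Pi.single_apply, dds_nil, dds_cons]
      simp [pd_eq_dd]
  rw [← key2, ← key]
  unfold schouten
  rw [Finset.mul_sum]
  refine Finset.sum_congr rfl fun k _ => ?_
  rw [hdX, hdX, hdP, hP, hP, hX.comp N A B hBA]
  simp only [H]
  ring

end Equivariance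

/-! ### Reduction to a normal frame -/

/-- The failure of `X` to trivialise the tetrahedral flow. -/
noncomputable def defect {n : ℕ} (X : Formula n) (N : NambuData n) : BivectorField (n + 2) :=
  fun i j x => tetraFlow N.bivector i j x - schouten N.bivector (X N) i j x

theorem defect_comp {n : ℕ} {X : Formula n} (hX : IsCovariant X) (N : NambuData n)
    {A B : Matrix (Fin (n + 2)) (Fin (n + 2)) ℝ} (hBA : B * A = 1) (i j : Fin (n + 2))
    (y : Fin (n + 2) → ℝ) :
    defect X (N.comp A) i j y =
      A.det ^ 4 * ∑ a, ∑ b, B i a * B j b * defect X N a b (A.mulVec y) := by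
  simp only [defect, tetraFlow_comp N hBA, schouten_comp N hX hBA, mul_sub,
    Finset.sum_sub_distrib]

theorem bivector_swap_pd {n : ℕ} (N : NambuData n) (i j k : Fin (n + 2)) (x : Fin (n + 2) → ℝ) :
    pd k (N.bivector i j) x = -pd k (N.bivector j i) x := by
  have : N.bivector i j = fun x => -1 * N.bivector j i x := by
    funext x; rw [bivector_swap]; ring
  rw [this, pd_eq_dd, dd_const_mul (smooth_bivector N j i)]
  simp [pd_eq_dd]

theorem pds_bivector_swap {n : ℕ} (N : NambuData n) (i j : Fin (n + 2)) (L : List (Fin (n + 2)))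
    (x : Fin (n + 2) → ℝ) : pds L (N.bivector i j) x = -pds L (N.bivector j i) x := by
  have : N.bivector i j = fun x => -1 * N.bivector j i x := by
    funext x; rw [bivector_swap]; ring
  rw [this, pds_const_mul (smooth_bivector N j i)]
  simp

theorem defect_swap {n : ℕ} (X : Formula n) (N : NambuData n) (i j : Fin (n + 2))
    (x : Fin (n + 2) → ℝ) : defect X N i j x = -defect X N j i x := by
  have h1 : tetra₁ N.bivector i j x = -tetra₁ N.bivector j i x := by
    simp only [tetra₁, ← Finset.sum_neg_distrib]
    refine Finset.sum_congr rfl fun _ _ => Finset.sum_congr rfl fun _ _ =>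
      Finset.sum_congr rfl fun _ _ => Finset.sum_congr rfl fun _ _ =>
      Finset.sum_congr rfl fun _ _ => Finset.sum_congr rfl fun _ _ => ?_
    rw [pds_bivector_swap N i j]
    ring
  have h2 : schouten N.bivector (X N) i j x = -schouten N.bivector (X N) j i x := by
    simp only [schouten, ← Finset.sum_neg_distrib]
    refine Finset.sum_congr rfl fun k _ => ?_
    rw [bivector_swap N k j, bivector_swap N i k, bivector_swap_pd N i j]
    ring
  rw [defect, defect, h2]
  simp only [tetraFlow]
  rw [h1]
  ring

/-- A family of Nambu-Poisson structures that depends polynomially on a parameter. -/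
structure IsPolyFamily {n : ℕ} (F : ℝ → NambuData n) : Prop where
  rho : PolyFamily fun t => (F t).rho
  cas : ∀ l, PolyFamily fun t => (F t).cas l

/-- The formula `X` preserves polynomial dependence on a parameter. -/
def PreservesPolyFamilies {n : ℕ} (X : Formula n) : Prop :=
  ∀ F : ℝ → NambuData n, IsPolyFamily F → ∀ m, PolyFamily fun t => X (F t) m

theorem IsPolyFamily.bivector {n : ℕ} {F : ℝ → NambuData n} (hF : IsPolyFamily F)
    (i j : Fin (n + 2)) : PolyFamily fun t => (F t).bivector i j := by
  have h : (fun t => (F t).bivector i j) = fun t x => (F t).bivector i j x := rfl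
  simp only [bivector_apply, Matrix.det_apply'] at h
  rw [h]
  refine hF.rho.mul (PolyFamily.sum _ fun σ => (PolyFamily.const _).mul (PolyFamily.prod _ fun r => ?_))
  simp only [Matrix.of_apply]
  generalize (σ r) = c
  refine Fin.cases ?_ (fun c => Fin.cases ?_ (fun c => ?_) c) c
  · simpa using PolyFamily.const _
  · simpa using PolyFamily.const _
  · simpa using (hF.cas c).pd r

theorem IsPolyFamily.defect {n : ℕ} {F : ℝ → NambuData n} (hF : IsPolyFamily F) {X : Formula n}
    (hX : PreservesPolyFamilies X) (i j : Fin (n + 2)) :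
    PolyFamily fun t => defect X (F t) i j := by
  have h : (fun t => NambuMicro.defect X (F t) i j) = fun t x => NambuMicro.defect X (F t) i j x := rfl
  have hP := hF.bivector
  have hXF := hX F hF
  rw [h]
  unfold NambuMicro.defect tetraFlow tetra₁ tetra₂ schouten
  simp only [div_eq_mul_inv]
  repeat' first
    | exact PolyFamily.const _
    | exact hP _ _
    | exact hXF _
    | exact (hP _ _).pds _
    | exact (hP _ _).pd _
    | exact (hXF _).pd _
    | refine PolyFamily.sub ?_ ?_
    | refine PolyFamily.add ?_ ?_
    | refine PolyFamily.sum _ fun _ => ?_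
    | refine PolyFamily.mul ?_ ?_

/-- `X` trivialises the tetrahedral flow of `N` at the point `p`. -/
def SolvesAt {n : ℕ} (X : Formula n) (N : NambuData n) (p : Fin (n + 2) → ℝ) : Prop :=
  ∀ i j, defect X N i j p = 0

theorem isTrivialising_of_solvesAt {n : ℕ} {X : Formula n} (h : ∀ N p, SolvesAt X N p) :
    IsTrivialising X := fun N => by
  funext i j x
  exact sub_eq_zero.1 (h N x i j)

theorem SolvesAt.of_comp {n : ℕ} {X : Formula n} (hX : IsCovariant X) {N : NambuData n}
    {A B : Matrix (Fin (n + 2)) (Fin (n + 2)) ℝ} (hBA : B * A = 1) {p : Fin (n + 2) → ℝ}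
    (h : SolvesAt X (N.comp A) (B.mulVec p)) : SolvesAt X N p := by
  have hAB := mul_eq_one_comm.1 hBA
  have hp : A.mulVec (B.mulVec p) = p := by rw [Matrix.mulVec_mulVec, hAB, Matrix.one_mulVec]
  have hN : N = (N.comp A).comp B := by
    have : ∀ f : (Fin (n + 2) → ℝ) → ℝ, (fun y => f (A.mulVec (B.mulVec y))) = f := fun f => by
      funext y; rw [Matrix.mulVec_mulVec, hAB, Matrix.one_mulVec]
    cases N
    simp only [NambuData.comp, NambuData.mk.injEq, this, true_and]
    exact funext fun l => (this _).symm
  intro i j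
  rw [hN, defect_comp hX _ hAB]
  simp [h _ _]

/-- It is enough to solve for a generic value of the parameter of a polynomial family. -/
theorem SolvesAt.of_generic {n : ℕ} {X : Formula n} (hX : PreservesPolyFamilies X)
    {F : ℝ → NambuData n} (hF : IsPolyFamily F) {p : Fin (n + 2) → ℝ} {q : Polynomial ℝ}
    (hq : q ≠ 0) (h : ∀ t, q.eval t ≠ 0 → SolvesAt X (F t) p) : SolvesAt X (F 0) p := by
  intro i j
  have hc := ((hF.defect hX i j).continuous_param p)
  have hd : Dense {t : ℝ | q.eval t ≠ 0} := by
    have : {t : ℝ | q.eval t ≠ 0} = (q.roots.toFinset : Set ℝ)ᶜ := by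
      ext t; simp [hq]
    rw [this]
    exact (Finset.countable_toSet _).dense_compl ℝ
  have := hc.ext_on hd (continuous_const (y := (0 : ℝ))) (fun t ht => h t ht i j)
  exact congrFun this 0

theorem PreservesPolyFamilies.φ {n : ℕ} {G : MicroGraph n} (hG : (edgesTo G 0).length = 1) :
    PreservesPolyFamilies (φ G) := fun F hF m => by
  have h : (fun t => NambuMicro.φ G (F t) m) = fun t x => NambuMicro.φ G (F t) m x := rfl
  simp only [φ_eq_sum hG] at h
  rw [h]
  refine PolyFamily.sum _ fun σ => (PolyFamily.const _).mul (PolyFamily.prod _ fun v => ?_)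
  refine PolyFamily.pds ?_ _
  unfold content
  split_ifs
  · exact PolyFamily.base (smooth_coord m)
  · exact hF.rho
  · exact hF.cas _

namespace PreservesPolyFamilies

variable {n : ℕ} {X Y : Formula n}

theorem add (hX : PreservesPolyFamilies X) (hY : PreservesPolyFamilies Y) :
    PreservesPolyFamilies (X + Y) := fun F hF m => (hX F hF m).add (hY F hF m)

theorem smul (hX : PreservesPolyFamilies X) (c : ℝ) : PreservesPolyFamilies (c • X) :=
  fun F hF m => (PolyFamily.const c).mul (hX F hF m)

theorem permute (hX : PreservesPolyFamilies X) (π : Equiv.Perm (Fin n)) :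
    PreservesPolyFamilies fun N => X (N.permute π) :=
  fun F hF m => hX (fun t => (F t).permute π) ⟨hF.rho, fun l => hF.cas (π l)⟩ m

theorem zero : PreservesPolyFamilies (0 : Formula n) := fun _ _ _ => PolyFamily.const 0

theorem list_sum {l : List (Formula n)} (h : ∀ X ∈ l, PreservesPolyFamilies X) :
    PreservesPolyFamilies l.sum := by
  induction l with
  | nil => exact zero
  | cons X l ih =>
    rw [List.sum_cons]
    exact (h X (by simp)).add (ih fun Y hY => h Y (by simp [hY]))

end PreservesPolyFamilies

/-- At the point `p` the differentials of the Casimirs are `dx₂` and `dx₃`, and the Hessian of `a¹`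
has no entries outside the diagonal except that in the block of the indices `2, 3`. -/
structure IsNormalAt (N : NambuData 2) (p : Fin 4 → ℝ) : Prop where
  grad : ∀ l k, pd k (N.cas l) p = if k = l.natAdd 2 then 1 else 0
  hess : ∀ i j : Fin 4, i < j → i < 2 → pds [i, j] (N.cas 0) p = 0

section Reduction

variable {X : Formula 2} (hX : IsCovariant X) (hX' : PreservesPolyFamilies X)

set_option maxHeartbeats 800000 in
include hX in
/-- By the symmetry that interchanges the first two coordinates, and as the defect is skew, four of
its components are enough. -/
theorem solvesAt_of_isNormalAt (h : ∀ N p, IsNormalAt N p → defect X N 0 1 p = 0 ∧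
    defect X N 0 2 p = 0 ∧ defect X N 0 3 p = 0 ∧ defect X N 2 3 p = 0) (N : NambuData 2)
    (p : Fin 4 → ℝ) (hN : IsNormalAt N p) : SolvesAt X N p := by
  obtain ⟨h01, h02, h03, h23⟩ := h N p hN
  let A : Matrix (Fin 4) (Fin 4) ℝ := !![0, 1, 0, 0; 1, 0, 0, 0; 0, 0, 1, 0; 0, 0, 0, 1]
  have hA : A * A = 1 := by
    ext i j; fin_cases i <;> fin_cases j <;> simp [A, Matrix.mul_apply, Fin.sum_univ_four]
  have hp : A.mulVec (A.mulVec p) = p := by rw [Matrix.mulVec_mulVec, hA, Matrix.one_mulVec]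
  have hAe : ∀ k : Fin 4, A.mulVec (Pi.single k 1) = Pi.single (Equiv.swap 0 1 k) 1 := fun k => by
    ext i
    fin_cases k <;> fin_cases i <;> simp [A, Equiv.swap_apply_def]
  have hpds : ∀ (L : List (Fin 4)) (l : Fin 2), pds L ((N.comp A).cas l) (A.mulVec p) =
      pds (L.map (Equiv.swap 0 1)) (N.cas l) p := fun L l => by
    have := congrFun (pds_comp_mulVec (N.cas_smooth l) A L) (A.mulVec p)
    rw [hp] at this
    refine this.trans ?_
    rw [pds_eq_dds, List.map_map]
    simp only [hAe, Function.comp_def]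
  have hN' : IsNormalAt (N.comp A) (A.mulVec p) := by
    constructor
    · intro l k
      have := hpds [k] l
      simp only [List.map_cons, List.map_nil, pds_cons, pds_nil] at this
      rw [this, hN.grad]
      fin_cases l <;> fin_cases k <;> simp [Equiv.swap_apply_def, Fin.ext_iff]
    · intro i j hij hi
      rw [hpds]
      have hs : pds [1, 0] (N.cas 0) p = pds [0, 1] (N.cas 0) p :=
        congrFun (pds_perm (N.cas_smooth 0) (List.Perm.swap _ _ _)) p
      have h' := hN.hess
      fin_cases i <;> fin_cases j <;> simp [Fin.lt_def, Equiv.swap_apply_def] at hij hi ⊢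
      · exact hs.trans (h' 0 1 (by decide) (by decide))
      · exact h' 1 2 (by decide) (by decide)
      · exact h' 1 3 (by decide) (by decide)
      · exact h' 0 2 (by decide) (by decide)
      · exact h' 0 3 (by decide) (by decide)
  obtain ⟨-, k02, k03, -⟩ := h _ _ hN'
  have hdet : A.det ≠ 0 := fun h0 => by
    have := congrArg Matrix.det hA
    simp [h0] at this
  have key : ∀ i j, defect X (N.comp A) i j (A.mulVec p) = A.det ^ 4 *
      defect X N (Equiv.swap 0 1 i) (Equiv.swap 0 1 j) p := fun i j => by
    rw [defect_comp hX N hA, hp]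
    congr 1
    fin_cases i <;> fin_cases j <;> simp [A, Fin.sum_univ_four, Equiv.swap_apply_def]
  have h12 : defect X N 1 2 p = 0 := by
    have := key 0 2
    rw [k02] at this
    simpa [hdet, Equiv.swap_apply_def] using this
  have h13 : defect X N 1 3 p = 0 := by
    have := key 0 3
    rw [k03] at this
    simpa [hdet, Equiv.swap_apply_def] using this
  have hs : ∀ i j, defect X N i j p = 0 → defect X N j i p = 0 := fun i j h0 => by
    rw [defect_swap, h0, neg_zero]
  have hd : ∀ i, defect X N i i p = 0 := fun i => by
    have := defect_swap X N i i p
    linarith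
  intro i j
  fin_cases i <;> fin_cases j
  exacts [hd 0, h01, h02, h03, hs 0 1 h01, hd 1, h12, h13, hs 0 2 h02, hs 1 2 h12, hd 2, h23,
    hs 0 3 h03, hs 1 3 h13, hs 2 3 h23, hd 3]

include hX in
/-- A shear makes the Hessian of `a¹` normal if its block of the indices `0, 1` is regular. -/
theorem solvesAt_of_hess (h : ∀ N p, IsNormalAt N p → SolvesAt X N p) (N : NambuData 2)
    (p : Fin 4 → ℝ) (hg : ∀ l k, pd k (N.cas l) p = if k = l.natAdd 2 then 1 else 0)
    (h0 : pds [0, 0] (N.cas 0) p ≠ 0)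
    (h1 : pds [0, 0] (N.cas 0) p * pds [1, 1] (N.cas 0) p - pds [0, 1] (N.cas 0) p ^ 2 ≠ 0) :
    SolvesAt X N p := by
  set H : Fin 4 → Fin 4 → ℝ := fun i j => pds [i, j] (N.cas 0) p with hH
  have hs : ∀ i j, H i j = H j i := fun i j =>
    congrFun (pds_perm (N.cas_smooth 0) (List.Perm.swap _ _ _)) p
  have h0' : H 0 0 ≠ 0 := h0
  have h1' : H 0 0 * H 1 1 - H 0 1 ^ 2 ≠ 0 := h1
  -- the frame `e₀, e₁ - u e₀, e₂ - v e₀ - w e₁, e₃ - v' e₀ - w' e₁`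
  obtain ⟨u, hu⟩ : ∃ u, H 0 1 - u * H 0 0 = 0 := ⟨H 0 1 / H 0 0, by field_simp; ring⟩
  have hsolve : ∀ j, ∃ v w, H 0 j - v * H 0 0 - w * H 0 1 = 0 ∧ H 1 j - v * H 0 1 - w * H 1 1 = 0 :=
    fun j => by
      obtain ⟨D, hD⟩ : ∃ D, D = H 0 0 * H 1 1 - H 0 1 ^ 2 := ⟨_, rfl⟩
      have hDD : D * D⁻¹ = 1 := mul_inv_cancel₀ (hD ▸ h1')
      refine ⟨(H 0 j * H 1 1 - H 1 j * H 0 1) * D⁻¹, (H 1 j * H 0 0 - H 0 j * H 0 1) * D⁻¹, ?_, ?_⟩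
      · linear_combination -(H 0 j) * hDD + H 0 j * D⁻¹ * hD
      · linear_combination -(H 1 j) * hDD + H 1 j * D⁻¹ * hD
  obtain ⟨v, w, hv1, hv2⟩ := hsolve 2
  obtain ⟨v', w', hv1', hv2'⟩ := hsolve 3
  let A : Matrix (Fin 4) (Fin 4) ℝ := !![1, -u, -v, -v'; 0, 1, -w, -w'; 0, 0, 1, 0; 0, 0, 0, 1]
  have hdet : IsUnit A.det := by
    have : A.BlockTriangular id := by
      intro i j hij
      fin_cases i <;> fin_cases j <;> simp [A] at hij ⊢
    rw [Matrix.det_of_isUpperTriangular this]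
    simp [A, Fin.prod_univ_four]
  have hAB : A * A⁻¹ = 1 := Matrix.mul_nonsing_inv A hdet
  have hBA : A⁻¹ * A = 1 := Matrix.nonsing_inv_mul A hdet
  refine SolvesAt.of_comp hX hBA (h _ _ ?_)
  have hp : A.mulVec (A⁻¹.mulVec p) = p := by rw [Matrix.mulVec_mulVec, hAB, Matrix.one_mulVec]
  have hpds : ∀ (L : List (Fin 4)) (l : Fin 2), pds L ((N.comp A).cas l) (A⁻¹.mulVec p) =
      dds (L.map fun k => A.mulVec (Pi.single k 1)) (N.cas l) p := fun L l => by
    have := congrFun (pds_comp_mulVec (N.cas_smooth l) A L) (A⁻¹.mulVec p)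
    rwa [hp] at this
  constructor
  · intro l k
    have := hpds [k] l
    simp only [List.map_cons, List.map_nil, dds_cons, dds_nil, dd_mulVec_single, hg] at this
    refine this.trans ?_
    fin_cases l <;> fin_cases k <;> simp [A, Fin.sum_univ_four, Fin.ext_iff]
  · intro i j hij hi
    have e : pds [i, j] ((N.comp A).cas 0) (A⁻¹.mulVec p) = ∑ m, ∑ m', A m i * A m' j * H m m' := by
      rw [hpds]
      simp only [List.map_cons, List.map_nil, dds_cons, dds_nil, dd_mulVec_single]
      refine Finset.sum_congr rfl fun m _ => ?_
      rw [pd_eq_dd, dd_sum _ fun m' => contDiff_const.mul (smooth_pd (N.cas_smooth 0) m'),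
        Finset.mul_sum]
      refine Finset.sum_congr rfl fun m' _ => ?_
      rw [dd_const_mul (smooth_pd (N.cas_smooth 0) m')]
      rw [← mul_assoc]; rfl
    rw [e]
    fin_cases i <;> fin_cases j <;> simp [Fin.lt_def] at hij hi <;>
      simp [A, Fin.sum_univ_four] <;> try simp only [hs 1 0]
    · linear_combination hu
    · linear_combination hv1
    · linear_combination hv1'
    · linear_combination hv2 - u * hv1
    · linear_combination hv2' - u * hv1'

include hX hX' in
/-- Almost every multiple of `(x₀² + x₁²) / 2`, centred at `p`, makes the block of the indices `0, 1`
of the Hessian of `a¹` regular when it is added to `a¹`. -/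
theorem solvesAt_of_grad (h : ∀ N p, IsNormalAt N p → SolvesAt X N p) (N : NambuData 2)
    (p : Fin 4 → ℝ) (hg : ∀ l k, pd k (N.cas l) p = if k = l.natAdd 2 then 1 else 0) :
    SolvesAt X N p := by
  let s : (Fin 4 → ℝ) → ℝ := fun x => (x 0 + -p 0) * (x 0 + -p 0) + (x 1 + -p 1) * (x 1 + -p 1)
  have hc : ∀ i, ContDiff ℝ ∞ fun x : Fin 4 → ℝ => x i + -p i := fun i =>
    (smooth_coord i).add contDiff_const
  have hs : ContDiff ℝ ∞ s := ((hc 0).mul (hc 0)).add ((hc 1).mul (hc 1))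
  let F : ℝ → NambuData 2 := fun t =>
    { rho := N.rho
      cas := fun l x => N.cas l x + (if l = 0 then t else 0) * s x
      rho_smooth := N.rho_smooth
      cas_smooth := fun l => (N.cas_smooth l).add (contDiff_const.mul hs) }
  have hF : IsPolyFamily F := by
    refine ⟨PolyFamily.base N.rho_smooth, fun l => (PolyFamily.base (N.cas_smooth l)).add
      (PolyFamily.mul ?_ (PolyFamily.base hs))⟩
    split_ifs
    · exact PolyFamily.param
    · exact PolyFamily.const 0
  have hF0 : F 0 = N := by
    cases N
    simp [F]
  have hpdc : ∀ k i, pd k (fun x : Fin 4 → ℝ => x i + -p i) = fun _ => if k = i then 1 else 0 :=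
    fun k i => by
      rw [pd_eq_dd, dd_add (smooth_coord i) contDiff_const, dd_const, ← pd_eq_dd, pd_coord]
      simp
  have hpds : ∀ k, pd k s = fun x => (if k = 0 then 2 else 0) * (x 0 + -p 0) +
      (if k = 1 then 2 else 0) * (x 1 + -p 1) := fun k => by
    rw [pd_eq_dd, dd_add ((hc 0).mul (hc 0)) ((hc 1).mul (hc 1)), dd_mul (hc 0) (hc 0),
      dd_mul (hc 1) (hc 1)]
    simp only [← pd_eq_dd, hpdc]
    funext x
    split_ifs <;> ring
  have hpds2 : ∀ j k, pd j (pd k s) p = (if k = 0 then 2 else 0) * (if j = 0 then 1 else 0) +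
      (if k = 1 then 2 else 0) * (if j = 1 then 1 else 0) := fun j k => by
    rw [hpds, pd_eq_dd, dd_add (contDiff_const.mul (hc 0)) (contDiff_const.mul (hc 1)),
      dd_const_mul (hc 0), dd_const_mul (hc 1)]
    simp only [← pd_eq_dd, hpdc]
  have hF1 : ∀ t L l, pds L ((F t).cas l) p =
      pds L (N.cas l) p + (if l = 0 then t else 0) * pds L s p := fun t L l => by
    have : (F t).cas l = fun x => N.cas l x + (if l = 0 then t else 0) * s x := rfl
    rw [this, pds_add (N.cas_smooth l) (contDiff_const.mul hs), pds_const_mul hs]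
  set a := pds [0, 0] (N.cas 0) p with ha
  set b := pds [0, 1] (N.cas 0) p with hb
  set c := pds [1, 1] (N.cas 0) p with hc'
  let q : Polynomial ℝ := (Polynomial.C 2 * Polynomial.X + Polynomial.C a) *
    ((Polynomial.C 2 * Polynomial.X + Polynomial.C a) *
      (Polynomial.C 2 * Polynomial.X + Polynomial.C c) - Polynomial.C (b ^ 2))
  have hqe : ∀ t, q.eval t = (2 * t + a) * ((2 * t + a) * (2 * t + c) - b ^ 2) := fun t => by
    simp [q]
  have hq : q ≠ 0 := by
    intro h0
    have h1 := hqe (1 + |a| + |c| + b ^ 2)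
    rw [h0, Polynomial.eval_zero] at h1
    have ha' := neg_abs_le a
    have hc'' := neg_abs_le c
    have k1 : 1 + b ^ 2 ≤ 2 * (1 + |a| + |c| + b ^ 2) + a := by
      have := abs_nonneg a; have := abs_nonneg c; nlinarith [sq_nonneg b]
    have k2 : 1 + b ^ 2 ≤ 2 * (1 + |a| + |c| + b ^ 2) + c := by
      have := abs_nonneg a; have := abs_nonneg c; nlinarith [sq_nonneg b]
    have k3 := mul_le_mul k1 k2 (by positivity) (le_trans (by positivity) k1)
    rcases mul_eq_zero.1 h1.symm with h2 | h2
    · nlinarith [sq_nonneg b]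
    · nlinarith [sq_nonneg b]
  rw [← hF0]
  refine SolvesAt.of_generic hX' hF hq fun t ht => ?_
  rw [hqe] at ht
  have e0 : pds [0, 0] ((F t).cas 0) p = 2 * t + a := by
    rw [hF1, pds_cons, pds_cons, pds_nil]
    simp only [pds_cons, pds_nil, hpds2]
    simp [ha]; ring
  have e1 : pds [1, 1] ((F t).cas 0) p = 2 * t + c := by
    rw [hF1]
    simp only [pds_cons, pds_nil, hpds2]
    simp [hc']; ring
  have e2 : pds [0, 1] ((F t).cas 0) p = b := by
    rw [hF1]
    simp only [pds_cons, pds_nil, hpds2]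
    simp [hb]
  refine solvesAt_of_hess hX h (F t) p (fun l k => ?_) ?_ ?_
  · have := hF1 t [k] l
    simp only [pds_cons, pds_nil, hpds] at this
    rw [this, hg]
    simp
  · rw [e0]; exact left_ne_zero_of_mul ht
  · rw [e0, e1, e2]; exact right_ne_zero_of_mul ht

include hX hX' in
/-- The vector field trivialises the flow if four components of the defect vanish in normal
frames. -/
theorem isTrivialising_of_isNormalAt (h : ∀ N p, IsNormalAt N p → defect X N 0 1 p = 0 ∧
    defect X N 0 2 p = 0 ∧ defect X N 0 3 p = 0 ∧ defect X N 2 3 p = 0) : IsTrivialising X := by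
  refine isTrivialising_of_solvesAt fun N p => ?_
  let D : Matrix (Fin 4) (Fin 4) ℝ := Matrix.of
    ![fun _ => 0, fun _ => 0, fun k => pd k (N.cas 0) p, fun k => pd k (N.cas 1) p]
  let F : ℝ → NambuData 2 := fun t =>
    { rho := N.rho
      cas := fun l x => N.cas l x + t * x (l.natAdd 2)
      rho_smooth := N.rho_smooth
      cas_smooth := fun l => (N.cas_smooth l).add (contDiff_const.mul (smooth_coord _)) }
  have hF : IsPolyFamily F := ⟨PolyFamily.base N.rho_smooth, fun l =>
    (PolyFamily.base (N.cas_smooth l)).add (PolyFamily.param.mul (PolyFamily.base (smooth_coord _)))⟩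
  have hF0 : F 0 = N := by
    cases N
    simp [F]
  rw [← hF0]
  refine SolvesAt.of_generic hX' hF (Matrix.charpoly_monic (-D)).ne_zero fun t ht => ?_
  rw [Matrix.eval_charpoly] at ht
  set C := Matrix.scalar (Fin 4) t - -D with hC
  have hCA : C * C⁻¹ = 1 := Matrix.mul_nonsing_inv C (isUnit_iff_ne_zero.2 ht)
  have hAC := mul_eq_one_comm.1 hCA
  refine SolvesAt.of_comp (A := C⁻¹) hX hCA
    (solvesAt_of_grad hX hX' (fun N p => solvesAt_of_isNormalAt hX h N p) _ _ fun l k => ?_)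
  have := congrFun (pds_comp_mulVec ((F t).cas_smooth l) C⁻¹ [k]) (C.mulVec p)
  rw [Matrix.mulVec_mulVec, hAC, Matrix.one_mulVec] at this
  simp only [List.map_cons, List.map_nil, dds_cons, dds_nil, dd_mulVec_single] at this
  refine this.trans ?_
  have hrow : ∀ m, pd m ((F t).cas l) p = C (l.natAdd 2) m := fun m => by
    change pd m (fun x => N.cas l x + t * x (l.natAdd 2)) p = _
    rw [pd_eq_dd, dd_add (N.cas_smooth l) (contDiff_const.mul (smooth_coord _)),
      dd_const_mul (smooth_coord _), ← pd_eq_dd, ← pd_eq_dd, pd_coord]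
    fin_cases l <;> fin_cases m <;> simp [hC, D, add_comm]
  have h1 := congrFun (congrFun hCA (l.natAdd 2)) k
  rw [Matrix.mul_apply] at h1
  simp only [hrow, mul_comm (C⁻¹ _ _)]
  refine h1.trans ?_
  rw [Matrix.one_apply]
  simp only [eq_comm]

end Reduction

/-! ### Sparse polynomials for kernel computation -/

/-- Sparse polynomials with integer coefficients. A monomial is encoded by a natural number, its
factorisation: the variables are prime numbers (the code `0` stands for zero). The monomials are
sorted by their codes.

All operations are defined by recursors, without pattern matching, because the kernel evaluates such
terms fast. -/
inductive SPoly
  | nil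
  | cons (c : ℤ) (m : ℕ) (t : SPoly)

namespace SPoly

/-- The value of a polynomial, if `e` assigns values to the variables. -/
noncomputable def eval (e : ℕ →*₀ ℝ) : SPoly → ℝ
  | nil => 0
  | cons c m t => c * e m + eval e t

/-- Adds a term to a polynomial, unless its coefficient is zero. -/
noncomputable def consNZ (c : ℤ) (m : ℕ) (t : SPoly) : SPoly :=
  Int.rec (fun n => Nat.rec t (fun k _ => cons (Int.ofNat (Nat.succ k)) m t) n)
    (fun n => Nat.rec (cons (Int.negSucc 0) m t)
      (fun k _ => cons (Int.negSucc (Nat.succ k)) m t) n) c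

/-- The sum, by merging the sorted lists of terms. -/
noncomputable def add (p : SPoly) : SPoly → SPoly :=
  SPoly.rec (fun q => q) (fun c m t ih q =>
    SPoly.rec (cons c m t) (fun c' m' t' ih' =>
      Bool.rec (Bool.rec (cons c' m' ih') (consNZ (Int.add c c') m (ih t')) (Nat.beq m m'))
        (cons c m (ih (cons c' m' t'))) (Nat.blt m m')) q) p

/-- The product with one term. -/
noncomputable def scale (c : ℤ) (m : ℕ) (p : SPoly) : SPoly :=
  SPoly.rec nil (fun c' m' _ ih => cons (Int.mul c c') (Nat.mul m m') ih) p

/-- The product, by distributing over the terms of the first factor. -/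
noncomputable def mul (p q : SPoly) : SPoly :=
  SPoly.rec nil (fun c m _ ih => add (scale c m q) ih) p

/-- Whether a polynomial has no terms. -/
noncomputable def isNil (p : SPoly) : Bool := SPoly.rec true (fun _ _ _ _ => false) p

/-- A polynomial with one term. -/
noncomputable def mono (c : ℤ) (m : ℕ) : SPoly :=
  Nat.rec nil (fun k _ => cons c (Nat.succ k) nil) m

/-- The sum over four indices. -/
noncomputable def sum4 (f : ℕ → SPoly) : SPoly := add (add (f 0) (f 1)) (add (f 2) (f 3))

/-- Adds the members of a list in pairs. -/
noncomputable def pairUp (l : List SPoly) : List SPoly :=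
  (List.rec (fun pend => pend) (fun x _ ih pend =>
    List.rec (ih [x]) (fun y _ _ => List.cons (add y x) (ih [])) pend) l :
      List SPoly → List SPoly) []

/-- The sum of a list, from the right. -/
noncomputable def headSum (l : List SPoly) : SPoly := List.rec nil (fun x _ ih => add x ih) l

/-- The sum of a list, by `n` rounds of addition in pairs and a final addition of what is left. The
value does not depend on `n`; about as many rounds as the binary logarithm of the length are fast. -/
noncomputable def treeSum (n : ℕ) : List SPoly → SPoly := Nat.rec headSum (fun _ ih l => ih (pairUp l)) n

theorem eval_consNZ (e : ℕ →*₀ ℝ) (c : ℤ) (m : ℕ) (t : SPoly) :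
    eval e (consNZ c m t) = c * e m + eval e t := by
  rcases c with (_ | n) | (_ | n)
  · change eval e t = _
    simp
  all_goals rfl

theorem eval_add (e : ℕ →*₀ ℝ) (p q : SPoly) : eval e (add p q) = eval e p + eval e q := by
  induction p generalizing q with
  | nil => change eval e q = 0 + eval e q; rw [zero_add]
  | cons c m t ih =>
    induction q with
    | nil => change eval e (cons c m t) = _ + 0; rw [add_zero]
    | cons c' m' t' ih' =>
      have h : add (cons c m t) (cons c' m' t') =
          Bool.rec (Bool.rec (cons c' m' (add (cons c m t) t'))
            (consNZ (Int.add c c') m (add t t')) (Nat.beq m m'))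
            (cons c m (add t (cons c' m' t'))) (Nat.blt m m') := rfl
      rw [h]
      cases Nat.blt m m' with
      | true =>
        change c * e m + eval e (add t (cons c' m' t')) = c * e m + eval e t + _
        rw [ih, add_assoc]
      | false =>
        cases hb : Nat.beq m m' with
        | true =>
          change eval e (consNZ (c + c') m (add t t')) = c * e m + eval e t + (c' * e m' + eval e t')
          rw [eval_consNZ, ih, ← Nat.eq_of_beq_eq_true hb]
          push_cast
          ring
        | false =>
          change c' * e m' + eval e (add (cons c m t) t') = _ + (c' * e m' + eval e t')
          rw [ih']
          ring

theorem eval_scale (e : ℕ →*₀ ℝ) (c : ℤ) (m : ℕ) (p : SPoly) :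
    eval e (scale c m p) = c * e m * eval e p := by
  induction p with
  | nil => change (0 : ℝ) = _ * 0; ring
  | cons c' m' t ih =>
    change ((c * c' : ℤ) : ℝ) * e (m * m') + eval e (scale c m t) = c * e m * (c' * e m' + eval e t)
    rw [ih, map_mul]
    push_cast
    ring

theorem eval_mul (e : ℕ →*₀ ℝ) (p q : SPoly) : eval e (mul p q) = eval e p * eval e q := by
  induction p with
  | nil => change (0 : ℝ) = 0 * _; ring
  | cons c m t ih =>
    change eval e (add (scale c m q) (mul t q)) = (c * e m + eval e t) * eval e q
    rw [eval_add, eval_scale, ih]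
    ring

theorem eval_mono (e : ℕ →*₀ ℝ) (c : ℤ) (m : ℕ) : eval e (mono c m) = c * e m := by
  cases m with
  | zero => change (0 : ℝ) = _; simp
  | succ m => change _ + (0 : ℝ) = _; rw [add_zero]

theorem eval_of_isNil (e : ℕ →*₀ ℝ) {p : SPoly} (h : isNil p = true) : eval e p = 0 := by
  cases p with
  | nil => rfl
  | cons c m t => cases h

theorem eval_sum4 (e : ℕ →*₀ ℝ) (f : ℕ → SPoly) : eval e (sum4 f) = ∑ k : Fin 4, eval e (f k) := by
  rw [sum4, eval_add, eval_add, eval_add, Fin.sum_univ_four, add_assoc (_ + _)]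
  rfl

theorem sum_eval_pairUp (e : ℕ →*₀ ℝ) (l : List SPoly) :
    ((pairUp l).map (eval e)).sum = (l.map (eval e)).sum := by
  let P : List SPoly → List SPoly → List SPoly := fun l => List.rec (fun pend => pend)
    (fun x _ ih pend => List.rec (ih [x]) (fun y _ _ => List.cons (add y x) (ih [])) pend) l
  have key : ∀ l, ((P l []).map (eval e)).sum = (l.map (eval e)).sum ∧
      ∀ y, ((P l [y]).map (eval e)).sum = eval e y + (l.map (eval e)).sum := by
    intro l
    induction l with
    | nil => exact ⟨rfl, fun y => rfl⟩
    | cons x l ih =>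
      refine ⟨?_, fun y => ?_⟩
      · change ((P l [x]).map (eval e)).sum = _
        rw [ih.2]; rfl
      · change ((add y x :: P l []).map (eval e)).sum = _
        rw [List.map_cons, List.sum_cons, ih.1, eval_add, List.map_cons, List.sum_cons, add_assoc]
  exact (key l).1

theorem eval_headSum (e : ℕ →*₀ ℝ) (l : List SPoly) :
    eval e (headSum l) = (l.map (eval e)).sum := by
  induction l with
  | nil => rfl
  | cons x l ih =>
    change eval e (add x (headSum l)) = _
    rw [eval_add, ih, List.map_cons, List.sum_cons]

theorem eval_treeSum (e : ℕ →*₀ ℝ) (n : ℕ) (l : List SPoly) :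
    eval e (treeSum n l) = (l.map (eval e)).sum := by
  induction n generalizing l with
  | zero => exact eval_headSum e l
  | succ n ih =>
    change eval e (treeSum n (pairUp l)) = _
    rw [ih, sum_eval_pairUp]

end SPoly

/-! ### Symbolic evaluation of the formulas -/

namespace Symbolic

open SPoly

/-- The `n`-th entry of a list. -/
noncomputable def nth (l : List ℕ) : ℕ → ℕ :=
  List.rec (fun _ => 0) (fun x _ ih n => Nat.rec x (fun n _ => ih n) n) l

/-- The permutations of `0, …, d - 1` with their signs. -/
def signedPerms (d : ℕ) : List (ℤ × List ℕ) :=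
  (List.range d).permutations'.map fun l =>
    (if (l.flatMap fun a => l.map fun b => (a, b)).countP (fun q => q.1 < q.2 && l.idxOf q.2 < l.idxOf q.1) % 2 = 0
      then 1 else -1, l)

/-- The monomials of a derivative of `ϱ · ∂_c a¹ · ∂_d a²` by the Leibniz rule. -/
noncomputable def leibniz (J : ℕ → List ℕ → ℕ) (c : ℤ) (L : List ℕ) :
    List ℕ → List ℕ → List ℕ → SPoly :=
  List.rec (fun r a b => mono c (Nat.mul (J 0 r) (Nat.mul (J 1 a) (J 2 b))))
    (fun l _ ih r a b =>
      add (ih (List.cons l r) a b) (add (ih r (List.cons l a) b) (ih r a (List.cons l b)))) L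

/-- The derivative `∂_L Pⁱʲ` of the bi-vector of a Nambu-Poisson structure on `ℝ⁴`. -/
noncomputable def pjet (J : ℕ → List ℕ → ℕ) (T : List (ℤ × List ℕ)) (i j : ℕ) (L : List ℕ) : SPoly :=
  List.rec nil (fun q _ ih => Bool.rec ih (Bool.rec ih
    (add (leibniz J q.1 L [] [nth q.2 2] [nth q.2 3]) ih)
    (Nat.beq (nth q.2 1) j)) (Nat.beq (nth q.2 0) i)) T

section Tetra

variable (P : ℕ → ℕ → List ℕ → SPoly)

/-- The contraction `∑ ∂ₘ'Pᵏ'ˡ ∂ⱼPᵐ'ˡ'` over `m'` of two factors of `Γ₂`. -/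
noncomputable def wedge₂ (k' l l' j : ℕ) : SPoly :=
  sum4 fun m' => mul (P k' l [m']) (P m' l' [j])

/-- The contraction of the three factors of `Γ₁` other than `∂ₖ∂ₗ∂ₘPⁱʲ`. It contains the last two of
them as a `wedge₂`, up to the sign that comes from the skew-symmetry of `P`. -/
noncomputable def wedge₁ (k l m : ℕ) : SPoly :=
  sum4 fun k' => sum4 fun l' => mul (P k k' [l']) (scale (-1) 1 (wedge₂ P l l' m k'))

/-- The bi-vector `Γ₁(P)`. -/
noncomputable def tetra₁ (i j : ℕ) : SPoly :=
  sum4 fun k => sum4 fun l => sum4 fun m => mul (wedge₁ P k l m) (P i j [k, l, m])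

/-- The contraction of the three factors of `Γ₂` other than `∂ₖ'∂ₗ'Pᵏᵐ`. -/
noncomputable def star₂ (i k' l' k : ℕ) : SPoly :=
  sum4 fun j => sum4 fun l => mul (wedge₂ P k' l l' j) (P i j [k, l])

/-- The expression `Γ₂(P)`. -/
noncomputable def tetra₂ (i m : ℕ) : SPoly :=
  sum4 fun k => sum4 fun k' => sum4 fun l' => mul (P k m [k', l']) (star₂ P i k' l' k)

end Tetra

/-- A vertex of a micro-graph: the number of the function in it, and its incoming edges, as pairs of
a source and a position. -/
abbrev Node := ℕ × List (ℕ × ℕ)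

/-- The value of one of three lists. -/
noncomputable def sel3 {α : Type} (a b c : α) (s : ℕ) : α :=
  Nat.rec a (fun s _ => Nat.rec b (fun _ _ => c) s) s

/-- The value `k i`; the argument is brought into the form of a literal first, so that the values of
`k` are shared by the kernel. -/
noncomputable def canon {α : Type} (i : ℕ) (k : ℕ → α) : α :=
  Nat.rec (k 0) (fun i _ => Nat.rec (k 1) (fun i _ => Nat.rec (k 2) (fun i _ =>
    Nat.rec (k 3) (fun i _ => k (Nat.add i 4)) i) i) i) i

/-- Passes the list of the indices on the incoming edges of a vertex to `K`. -/
noncomputable def indices {α : Type} (a b c : List ℕ) (v : Node) : (List ℕ → α) → α :=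
  List.rec (fun K => K [])
    (fun q _ ih K => canon (nth (sel3 a b c q.1) q.2) fun x => ih fun L => K (List.cons x L)) v.2

/-- A monomial and the list of the monomials of its derivative. -/
abbrev Dual := ℕ × List ℕ

/-- The multiples of the members of a list of monomials by a monomial; the zero monomial gives no
terms. -/
noncomputable def smul (x : ℕ) (D : List ℕ) : List ℕ :=
  Nat.rec [] (fun y _ =>
    (List.rec [] (fun z _ ih => List.cons (Nat.mul (Nat.succ y) z) ih) D : List ℕ)) x

/-- Concatenation. -/
noncomputable def app (D E : List ℕ) : List ℕ := List.rec E (fun z _ ih => List.cons z ih) D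

/-- The list with one monomial, or the empty list for the zero monomial. -/
noncomputable def single (x : ℕ) : List ℕ := Nat.rec [] (fun y _ => [Nat.succ y]) x

/-- The product rule. -/
noncomputable def dmul (p q : Dual) : Dual :=
  Prod.rec (fun x D => Prod.rec (fun y E => (Nat.mul x y, app (smul x E) (smul y D))) q) p

/-- The product of the contents of the vertices in `V`, and its derivative along the only element of
`k` if `k` is not empty. -/
noncomputable def vprod (J : ℕ → List ℕ → ℕ) (k : List ℕ) (a b c : List ℕ) (V : List Node) : Dual :=
  List.rec (1, []) (fun v _ ih => canon v.1 fun f => indices a b c v fun L =>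
    dmul (J f L, List.rec [] (fun k _ _ => single (J f (List.cons k L))) k) ih) V

/-- Distinguishes whether a product and its derivative are zero. -/
noncomputable def nz {α : Type} (p : Dual) (a b : α) : α :=
  Prod.rec (fun x D => Nat.rec (List.rec a (fun _ _ _ => b) D) (fun _ _ => b) x) p

/-- The signed permutations with the values of `f`, where `f` is not zero. -/
noncomputable def keep (T : List (ℤ × List ℕ)) (f : List ℕ → Dual) : List (ℤ × List ℕ × Dual) :=
  List.rec [] (fun p _ ih => (fun r => nz r ih (List.cons (p.1, p.2, r) ih)) (f p.2)) T

/-- Accumulates the terms `f` over a list of signed permutations. -/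
noncomputable def loop (l : List (ℤ × List ℕ × Dual))
    (f : ℤ → List ℕ → Dual → List SPoly → List SPoly) (tl : List SPoly) : List SPoly :=
  List.rec tl (fun p _ ih => f p.1 p.2.1 p.2.2 ih) l

/-- Puts the monomials in `D`, with the coefficient `c`, in front of a list of polynomials. -/
noncomputable def out (c : ℤ) (D : List ℕ) (tl : List SPoly) : List SPoly :=
  List.rec tl (fun x _ ih => List.cons (cons c x nil) ih) D

/-- The monomials that are asked for: the product itself if `k` is empty, else its derivative. -/
noncomputable def pick (k : List ℕ) (r : Dual) : List ℕ := List.rec (single r.1) (fun _ _ _ => r.2) k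

/-- The terms for given permutations of the first two sources. -/
noncomputable def leaves₂ (J : ℕ → List ℕ → ℕ) (k : List ℕ) (V₂ : List Node) (a b : List ℕ) (c : ℤ)
    (m : Dual) (s₂ : ℤ) (c' : List ℕ) (m₂ : Dual) (tl : List SPoly) : List SPoly :=
  (fun m' => nz m' tl (out (Int.mul c s₂) (pick k (dmul m' (vprod J k a b c' V₂))) tl)) (dmul m m₂)

/-- The terms for a given permutation of the first source. -/
noncomputable def leaves₁ (J : ℕ → List ℕ → ℕ) (k : List ℕ) (A₂ : List (ℤ × List ℕ × Dual))
    (V₁ V₂ : List Node) (a : List ℕ) (c : ℤ) (m₀ : Dual) (s₁ : ℤ) (b : List ℕ) (m₁ : Dual)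
    (tl : List SPoly) : List SPoly :=
  (fun m => nz m tl (loop A₂ (leaves₂ J k V₂ a b (Int.mul c s₁) m) tl))
    (dmul (dmul m₀ m₁) (vprod J k a b [] V₁))

/-- The terms of a formula. The vertices `V₁` have incoming edges from the first two sources only.
A partial product is abandoned as soon as it is zero. -/
noncomputable def leaves (J : ℕ → List ℕ → ℕ) (k : List ℕ) (A₀ A₁ A₂ : List (ℤ × List ℕ × Dual))
    (V₁ V₂ : List Node) (c : ℤ) : List SPoly → List SPoly :=
  loop A₀ fun s₀ a m₀ => loop A₁ (leaves₁ J k A₂ V₁ V₂ a (Int.mul c s₀) m₀)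

/-- All incoming edges of a vertex start at the source `s`. -/
def only (s : ℕ) (v : Node) : Bool := v.2.all fun q => Nat.beq q.1 s

/-- All incoming edges of a vertex start at the first two sources. -/
def early (v : Node) : Bool := v.2.all fun q => Nat.blt q.1 2

/-- `c` times the `m`-th component of a formula, or its derivative along the only element of `k` if
`k` is not empty. -/
noncomputable def formula (J : ℕ → List ℕ → ℕ) (T : List (ℤ × List ℕ)) (k : List ℕ) (V : List Node)
    (m : ℕ) (c : ℤ) : SPoly :=
  treeSum 10 (leaves J k
    (keep T fun a => Bool.rec (0, []) (vprod J k a [] [] (V.filter (only 0))) (Nat.beq (nth a 0) m))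
    (keep T fun b => vprod J k [] b [] (V.filter fun v => !only 0 v && only 1 v))
    (keep T fun c' => vprod J k [] [] c' (V.filter fun v => !only 0 v && !only 1 v && only 2 v))
    (V.filter fun v => !only 0 v && !only 1 v && !only 2 v && early v)
    (V.filter fun v => !only 0 v && !only 1 v && !only 2 v && !early v) c [])

/-- The vertices of a micro-graph other than the sink. The function in the `s`-th copy of the `l`-th
Casimir has the number `π l + 1`. -/
def nodes {n : ℕ} (π : Equiv.Perm (Fin n)) (G : MicroGraph n) : List Node :=
  (List.finRange (3 * n + 3)).map fun v =>
    (if h : v.val < 3 then 0 else π ⟨(v.val - 3) / 3, by have := v.isLt; omega⟩ + 1,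
      (edgesTo G v.succ).map fun q => (q.1.val, q.2.val))

/-- The code of a list of indices, up to the order: the digit `l` in base five is the multiplicity of
`l`, which is at most four where this is used. -/
noncomputable def keyOf (L : List ℕ) : ℕ := List.rec 0 (fun l _ ih => Nat.add (Nat.pow 5 l) ih) L

/-- The multisets of at most `r` indices less than `d`, as lists. -/
def multisets (d : ℕ) : ℕ → List (List ℕ)
  | 0 => [[]]
  | r + 1 => [] :: (List.range d).flatMap fun a =>
      ((multisets (a + 1) r).map fun L => a :: L)

/-- The value that belongs to the key `k`, or zero. -/
noncomputable def lookup (k : ℕ) (t : List (ℕ × ℕ)) : ℕ :=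
  List.rec 0 (fun q _ ih => Bool.rec ih q.2 (Nat.beq q.1 k)) t

theorem canon_eq {α : Type} (i : ℕ) (k : ℕ → α) : canon i k = k i := by
  rcases i with _ | _ | _ | _ | i <;> rfl

theorem indices_eq {α : Type} (a b c : List ℕ) (v : Node) (K : List ℕ → α) :
    indices a b c v K = K (v.2.map fun q => nth (sel3 a b c q.1) q.2) := by
  obtain ⟨f, E⟩ := v
  induction E generalizing K with
  | nil => rfl
  | cons q E ih =>
    change canon (nth (sel3 a b c q.1) q.2) (fun x => indices a b c (f, E) fun L => K (x :: L)) = _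
    rw [canon_eq, ih]
    rfl

section Values

variable (e : ℕ →*₀ ℝ)

/-- A product and its derivative, as a dual number. -/
noncomputable def dval (r : Dual) : DualNumber ℝ :=
  TrivSqZeroExt.inl (e r.1) + TrivSqZeroExt.inr ((r.2.map e).sum)

@[simp] theorem fst_dval (r : Dual) : (dval e r).fst = e r.1 := by simp [dval]

@[simp] theorem snd_dval (r : Dual) : (dval e r).snd = (r.2.map e).sum := by simp [dval]

theorem sum_smul (x : ℕ) (D : List ℕ) : ((smul x D).map e).sum = e x * (D.map e).sum := by
  cases x with
  | zero => change (0 : ℝ) = _; simp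
  | succ y =>
    induction D with
    | nil => change (0 : ℝ) = _ * 0; simp
    | cons z D ih =>
      change e ((y + 1) * z) + ((smul (y + 1) D).map e).sum = _ * (e z + (D.map e).sum)
      rw [ih, map_mul, mul_add]

theorem app_eq (D E : List ℕ) : app D E = D ++ E := by
  induction D with
  | nil => rfl
  | cons z D ih => exact congrArg (List.cons z) ih

theorem sum_single (x : ℕ) : ((single x).map e).sum = e x := by
  cases x with
  | zero => change (0 : ℝ) = _; simp
  | succ y => change e (y + 1) + 0 = _; simp

theorem dval_dmul (p q : Dual) : dval e (dmul p q) = dval e p * dval e q := by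
  obtain ⟨x, D⟩ := p
  obtain ⟨y, E⟩ := q
  change dval e (x * y, app (smul x E) (smul y D)) = _
  ext
  · simp
  · simp [app_eq, sum_smul, mul_comm]

theorem dval_zero : dval e (0, []) = 0 := by
  ext <;> simp

theorem nz_cases {α : Type} (p : Dual) (a b : α) :
    (nz p a b = a ∧ dval e p = 0) ∨ nz p a b = b := by
  obtain ⟨_ | x, _ | ⟨z, D⟩⟩ := p
  · exact Or.inl ⟨rfl, dval_zero e⟩
  all_goals exact Or.inr rfl

/-- The value of the content of a vertex and its derivative. -/
noncomputable def nodeValue (J : ℕ → List ℕ → ℕ) (k a b c : List ℕ) (v : Node) : DualNumber ℝ :=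
  dval e (J v.1 (v.2.map fun q => nth (sel3 a b c q.1) q.2), List.rec []
    (fun k _ _ => single (J v.1 (List.cons k (v.2.map fun q => nth (sel3 a b c q.1) q.2)))) k)

theorem dval_vprod (J : ℕ → List ℕ → ℕ) (k a b c : List ℕ) (V : List Node) :
    dval e (vprod J k a b c V) = (V.map (nodeValue e J k a b c)).prod := by
  induction V with
  | nil =>
    change dval e (1, []) = 1
    ext <;> simp
  | cons v V ih =>
    change dval e (canon v.1 fun f => indices a b c v fun L => dmul (J f L, List.rec []
      (fun k _ _ => single (J f (List.cons k L))) k) (vprod J k a b c V)) = _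
    rw [canon_eq, indices_eq, dval_dmul, ih]
    rfl

theorem sum_keep (T : List (ℤ × List ℕ)) (f : List ℕ → Dual) (F : ℤ → List ℕ → DualNumber ℝ → ℝ)
    (hF : ∀ s l, F s l 0 = 0) :
    ((keep T f).map fun q => F q.1 q.2.1 (dval e q.2.2)).sum =
      (T.map fun q => F q.1 q.2 (dval e (f q.2))).sum := by
  induction T with
  | nil => rfl
  | cons q T ih =>
    have h : keep (q :: T) f = nz (f q.2) (keep T f) ((q.1, q.2, f q.2) :: keep T f) := rfl
    rw [h, List.map_cons, List.sum_cons, ← ih]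
    rcases nz_cases e (f q.2) (keep T f) ((q.1, q.2, f q.2) :: keep T f) with ⟨h1, h2⟩ | h1
    · rw [h1, h2, hF, zero_add]
    · rw [h1, List.map_cons, List.sum_cons]

/-- The sum of the values of a list of polynomials. -/
noncomputable def total (l : List SPoly) : ℝ := (l.map (eval e)).sum

theorem total_loop (l : List (ℤ × List ℕ × Dual))
    (f : ℤ → List ℕ → Dual → List SPoly → List SPoly) (g : ℤ → List ℕ → DualNumber ℝ → ℝ)
    (h : ∀ s a r tl, total e (f s a r tl) = g s a (dval e r) + total e tl) (tl : List SPoly) :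
    total e (loop l f tl) = (l.map fun q => g q.1 q.2.1 (dval e q.2.2)).sum + total e tl := by
  induction l with
  | nil => exact (zero_add _).symm
  | cons q l ih =>
    change total e (f q.1 q.2.1 q.2.2 (loop l f tl)) = _
    rw [h, ih, List.map_cons, List.sum_cons, add_assoc]

theorem total_out (c : ℤ) (D : List ℕ) (tl : List SPoly) :
    total e (out c D tl) = c * (D.map e).sum + total e tl := by
  induction D with
  | nil => change total e tl = c * 0 + _; simp
  | cons x D ih =>
    change (c * e x + 0) + total e (out c D tl) = c * (e x + (D.map e).sum) + total e tl
    rw [ih]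
    ring

/-- The part of a dual number that is asked for. -/
noncomputable def part (k : List ℕ) (z : DualNumber ℝ) : ℝ :=
  if k = [] then z.fst else z.snd

theorem part_zero (k : List ℕ) : part k 0 = 0 := by simp [part]

theorem sum_pick (k : List ℕ) (r : Dual) : ((pick k r).map e).sum = part k (dval e r) := by
  cases k with
  | nil => change ((single r.1).map e).sum = _; rw [sum_single]; simp [part]
  | cons k l => change (r.2.map e).sum = _; simp [part]

theorem total_leaves₂ (J : ℕ → List ℕ → ℕ) (k : List ℕ) (V₂ : List Node) (a b : List ℕ) (c : ℤ)
    (m : Dual) (s₂ : ℤ) (c' : List ℕ) (m₂ : Dual) (tl : List SPoly) :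
    total e (leaves₂ J k V₂ a b c m s₂ c' m₂ tl) = c * s₂ *
      part k (dval e m * dval e m₂ * dval e (vprod J k a b c' V₂)) + total e tl := by
  have h : leaves₂ J k V₂ a b c m s₂ c' m₂ tl = nz (dmul m m₂) tl (out (c * s₂)
      (pick k (dmul (dmul m m₂) (vprod J k a b c' V₂))) tl) := rfl
  rw [h, ← dval_dmul]
  rcases nz_cases e (dmul m m₂) tl (out (c * s₂) (pick k (dmul (dmul m m₂) (vprod J k a b c' V₂))) tl)
    with ⟨h1, h2⟩ | h1
  · rw [h1, h2, zero_mul, part_zero, mul_zero, zero_add]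
  · rw [h1, total_out, sum_pick, dval_dmul e (dmul m m₂)]
    push_cast
    rfl

/-- The value of the terms for given permutations of the first two sources. -/
noncomputable def sum₂ (k : List ℕ) (W₂ : List ℕ → DualNumber ℝ) (A₂ : List (ℤ × List ℕ × DualNumber ℝ))
    (c : ℝ) (z : DualNumber ℝ) : ℝ :=
  (A₂.map fun q => c * q.1 * part k (z * q.2.2 * W₂ q.2.1)).sum

/-- The value of the terms for a given permutation of the first source. -/
noncomputable def sum₁ (k : List ℕ) (W₁ : List ℕ → DualNumber ℝ) (W₂ : List ℕ → List ℕ → DualNumber ℝ)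
    (A₁ A₂ : List (ℤ × List ℕ × DualNumber ℝ)) (c : ℝ) (z : DualNumber ℝ) : ℝ :=
  (A₁.map fun q => sum₂ k (W₂ q.2.1) A₂ (c * q.1) (z * q.2.2 * W₁ q.2.1)).sum

/-- The value of all terms. -/
noncomputable def sum₀ (k : List ℕ) (W₁ : List ℕ → List ℕ → DualNumber ℝ)
    (W₂ : List ℕ → List ℕ → List ℕ → DualNumber ℝ) (A₀ A₁ A₂ : List (ℤ × List ℕ × DualNumber ℝ))
    (c : ℝ) : ℝ :=
  (A₀.map fun q => sum₁ k (W₁ q.2.1) (W₂ q.2.1) A₁ A₂ (c * q.1) q.2.2).sum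

/-- The list with the values of the monomials in the place of the monomials. -/
noncomputable def dvals (A : List (ℤ × List ℕ × Dual)) : List (ℤ × List ℕ × DualNumber ℝ) :=
  A.map fun q => (q.1, q.2.1, dval e q.2.2)

theorem total_leaves₁ (J : ℕ → List ℕ → ℕ) (k : List ℕ) (A₂ : List (ℤ × List ℕ × Dual))
    (V₁ V₂ : List Node) (a : List ℕ) (c : ℤ) (m₀ : Dual) (s₁ : ℤ) (b : List ℕ) (m₁ : Dual)
    (tl : List SPoly) :
    total e (leaves₁ J k A₂ V₁ V₂ a c m₀ s₁ b m₁ tl) =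
      sum₂ k (fun c' => dval e (vprod J k a b c' V₂)) (dvals e A₂) (c * s₁)
        (dval e m₀ * dval e m₁ * dval e (vprod J k a b [] V₁)) + total e tl := by
  have h : leaves₁ J k A₂ V₁ V₂ a c m₀ s₁ b m₁ tl = nz (dmul (dmul m₀ m₁) (vprod J k a b [] V₁)) tl
      (loop A₂ (leaves₂ J k V₂ a b (c * s₁) (dmul (dmul m₀ m₁) (vprod J k a b [] V₁))) tl) := rfl
  rw [h, ← dval_dmul, ← dval_dmul]
  generalize dmul (dmul m₀ m₁) (vprod J k a b [] V₁) = m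
  rcases nz_cases e m tl (loop A₂ (leaves₂ J k V₂ a b (c * s₁) m) tl) with ⟨h1, h2⟩ | h1
  · rw [h1, h2]
    simp [sum₂, part_zero]
  · rw [h1, total_loop e A₂ _ (fun s₂ c' r₂ => ((c * s₁ : ℤ) : ℝ) * s₂ *
      part k (dval e m * r₂ * dval e (vprod J k a b c' V₂)))
      (fun s₂ c' m₂ tl => total_leaves₂ e J k V₂ a b (c * s₁) m s₂ c' m₂ tl), sum₂, dvals, List.map_map]
    push_cast
    rfl

theorem total_leaves (J : ℕ → List ℕ → ℕ) (k : List ℕ) (A₀ A₁ A₂ : List (ℤ × List ℕ × Dual))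
    (V₁ V₂ : List Node) (c : ℤ) (tl : List SPoly) :
    total e (leaves J k A₀ A₁ A₂ V₁ V₂ c tl) =
      sum₀ k (fun a b => dval e (vprod J k a b [] V₁)) (fun a b c' => dval e (vprod J k a b c' V₂))
        (dvals e A₀) (dvals e A₁) (dvals e A₂) c + total e tl := by
  have h₁ : ∀ (s₀ : ℤ) a m₀ tl, total e (loop A₁ (leaves₁ J k A₂ V₁ V₂ a (Int.mul c s₀) m₀) tl) =
      sum₁ k (fun b => dval e (vprod J k a b [] V₁)) (fun b c' => dval e (vprod J k a b c' V₂))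
        (dvals e A₁) (dvals e A₂) (c * s₀) (dval e m₀) + total e tl := fun s₀ a m₀ tl => by
    have hc : Int.mul c s₀ = c * s₀ := rfl
    rw [hc, total_loop e A₁ _ (fun s₁ b r₁ => sum₂ k (fun c' => dval e (vprod J k a b c' V₂))
      (dvals e A₂) ((c * s₀ : ℤ) * s₁) (dval e m₀ * r₁ * dval e (vprod J k a b [] V₁)))
      (fun s₁ b m₁ tl => total_leaves₁ e J k A₂ V₁ V₂ a (c * s₀) m₀ s₁ b m₁ tl), sum₁,
      show dvals e A₁ = A₁.map fun q => (q.1, q.2.1, dval e q.2.2) from rfl, List.map_map]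
    push_cast
    rfl
  rw [leaves, total_loop e A₀ _ (fun s₀ a r₀ => sum₁ k (fun b => dval e (vprod J k a b [] V₁))
    (fun b c' => dval e (vprod J k a b c' V₂)) (dvals e A₁) (dvals e A₂) (c * s₀) r₀) h₁, sum₀,
    show dvals e A₀ = A₀.map fun q => (q.1, q.2.1, dval e q.2.2) from rfl, List.map_map]
  rfl

theorem sum_dvals_keep (T : List (ℤ × List ℕ)) (f : List ℕ → Dual)
    (F : ℤ × List ℕ × DualNumber ℝ → ℝ) (hF : ∀ s l, F (s, l, 0) = 0) :
    ((dvals e (keep T f)).map F).sum = ((T.map fun q => (q.1, q.2, dval e (f q.2))).map F).sum := by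
  rw [dvals, List.map_map, List.map_map]
  exact sum_keep e T f (fun s l r => F (s, l, r)) hF

theorem sum₀_keep (k : List ℕ) (W₁ : List ℕ → List ℕ → DualNumber ℝ)
    (W₂ : List ℕ → List ℕ → List ℕ → DualNumber ℝ) (T : List (ℤ × List ℕ)) (f₀ f₁ f₂ : List ℕ → Dual)
    (c : ℝ) :
    sum₀ k W₁ W₂ (dvals e (keep T f₀)) (dvals e (keep T f₁)) (dvals e (keep T f₂)) c =
      (T.map fun q₀ => (T.map fun q₁ => (T.map fun q₂ => c * q₀.1 * q₁.1 * q₂.1 *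
        part k (dval e (f₀ q₀.2) * dval e (f₁ q₁.2) * W₁ q₀.2 q₁.2 * dval e (f₂ q₂.2) *
          W₂ q₀.2 q₁.2 q₂.2)).sum).sum).sum := by
  have h2 : ∀ W c z, sum₂ k W (dvals e (keep T f₂)) c z =
      (T.map fun q => c * q.1 * part k (z * dval e (f₂ q.2) * W q.2)).sum := fun W c z => by
    rw [sum₂, sum_dvals_keep e T f₂ _ (fun s l => by simp [part_zero]), List.map_map]
    rfl
  have h2z : ∀ W c, sum₂ k W (dvals e (keep T f₂)) c 0 = 0 := fun W c => by
    simp [sum₂, part_zero]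
  have h1 : ∀ W W' c z, sum₁ k W W' (dvals e (keep T f₁)) (dvals e (keep T f₂)) c z =
      (T.map fun q => sum₂ k (W' q.2) (dvals e (keep T f₂)) (c * q.1)
        (z * dval e (f₁ q.2) * W q.2)).sum := fun W W' c z => by
    rw [sum₁, sum_dvals_keep e T f₁ _ (fun s l => by simp [h2z]), List.map_map]
    rfl
  have h1z : ∀ W W' c, sum₁ k W W' (dvals e (keep T f₁)) (dvals e (keep T f₂)) c 0 = 0 :=
    fun W W' c => by simp [sum₁, h2z]
  rw [sum₀, sum_dvals_keep e T f₀ _ (fun s l => h1z _ _ _), List.map_map]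
  simp only [Function.comp_def, h1, h2]

theorem nodeValue_congr {J : ℕ → List ℕ → ℕ} {k a b c a' b' c' : List ℕ} {v : Node}
    (h : ∀ q ∈ v.2, sel3 a b c q.1 = sel3 a' b' c' q.1) :
    nodeValue e J k a b c v = nodeValue e J k a' b' c' v := by
  have : (v.2.map fun q => nth (sel3 a b c q.1) q.2) =
      v.2.map fun q => nth (sel3 a' b' c' q.1) q.2 :=
    List.map_congr_left fun q hq => by rw [h q hq]
  rw [nodeValue, nodeValue, this]

theorem prod_filter_congr {V : List Node} {t : Node → Bool} {g h : Node → DualNumber ℝ}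
    (hgh : ∀ v, t v = true → g v = h v) : ((V.filter t).map g).prod = ((V.filter t).map h).prod :=
  congrArg List.prod (List.map_congr_left fun v hv => hgh v (List.mem_filter.1 hv).2)

theorem prod_split {V : List Node} (t₀ t₁ t₂ t₃ : Node → Bool) (g : Node → DualNumber ℝ) :
    ((V.filter t₀).map g).prod * ((V.filter fun v => !t₀ v && t₁ v).map g).prod *
      ((V.filter fun v => !t₀ v && !t₁ v && !t₂ v && t₃ v).map g).prod *
      ((V.filter fun v => !t₀ v && !t₁ v && t₂ v).map g).prod *
      ((V.filter fun v => !t₀ v && !t₁ v && !t₂ v && !t₃ v).map g).prod = (V.map g).prod := by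
  induction V with
  | nil => simp
  | cons v V ih =>
    rw [List.map_cons, List.prod_cons, ← ih]
    simp only [List.filter_cons]
    cases t₀ v <;> cases t₁ v <;> cases t₂ v <;> cases t₃ v <;> simp <;> ring

theorem eval_formula (J : ℕ → List ℕ → ℕ) (T : List (ℤ × List ℕ)) (k : List ℕ) (V : List Node)
    (m : ℕ) (c : ℤ) :
    eval e (formula J T k V m c) = (T.map fun q₀ => (T.map fun q₁ => (T.map fun q₂ =>
      (c : ℝ) * q₀.1 * q₁.1 * q₂.1 * if nth q₀.2 0 = m then
        part k ((V.map (nodeValue e J k q₀.2 q₁.2 q₂.2)).prod) else 0).sum).sum).sum := by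
  rw [formula, eval_treeSum]
  change total e _ = _
  rw [total_leaves]
  have hnil : total e [] = 0 := rfl
  rw [hnil, add_zero, sum₀_keep]
  refine congrArg List.sum (List.map_congr_left fun q₀ _ => ?_)
  refine congrArg List.sum (List.map_congr_left fun q₁ _ => ?_)
  refine congrArg List.sum (List.map_congr_left fun q₂ _ => ?_)
  congr 1
  by_cases h : nth q₀.2 0 = m
  · have hb : Nat.beq (nth q₀.2 0) m = true := by rw [h]; exact Nat.beq_refl m
    rw [if_pos h, hb]
    congr 1
    rw [← prod_split (only 0) (only 1) (only 2) early]
    simp only [dval_vprod]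
    congr 1; congr 1; congr 1; congr 1
    · refine prod_filter_congr fun v hv => nodeValue_congr e fun q hq => ?_
      have := Nat.eq_of_beq_eq_true (List.all_eq_true.1 hv q hq)
      rw [this]; rfl
    · refine prod_filter_congr fun v hv => nodeValue_congr e fun q hq => ?_
      simp only [Bool.and_eq_true] at hv
      have := Nat.eq_of_beq_eq_true (List.all_eq_true.1 hv.2 q hq)
      rw [this]; rfl
    · refine prod_filter_congr fun v hv => nodeValue_congr e fun q hq => ?_
      simp only [Bool.and_eq_true] at hv
      have := List.all_eq_true.1 hv.2 q hq
      have : q.1 < 2 := by simpa [Nat.blt] using this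
      obtain ⟨_ | _ | s, t⟩ := q
      · rfl
      · rfl
      · simp at this
    · refine prod_filter_congr fun v hv => nodeValue_congr e fun q hq => ?_
      simp only [Bool.and_eq_true] at hv
      have := Nat.eq_of_beq_eq_true (List.all_eq_true.1 hv.2 q hq)
      rw [this]; rfl
  · have hb : Nat.beq (nth q₀.2 0) m = false := by
      rw [Bool.eq_false_iff]
      exact fun h' => h (Nat.eq_of_beq_eq_true h')
    rw [if_neg h, hb]
    change part k (dval e (0, []) * _ * _ * _ * _) = 0
    rw [dval_zero]
    simp [part_zero]

end Values

/-- `J` encodes the partial derivatives of order at most `r` at the point `p`. -/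
structure IsJet {n : ℕ} (e : ℕ →*₀ ℝ) (J : ℕ → List ℕ → ℕ) (N : NambuData n) (p : Fin (n + 2) → ℝ)
    (r : ℕ) : Prop where
  rho : ∀ L : List (Fin (n + 2)), L.length ≤ r → e (J 0 (L.map Fin.val)) = pds L N.rho p
  cas : ∀ l, ∀ L : List (Fin (n + 2)), L.length ≤ r →
    e (J (l.val + 1) (L.map Fin.val)) = pds L (N.cas l) p

/-- A list of all permutations with their signs. -/
def IsSignedPerms (d : ℕ) (T : List (ℤ × List ℕ)) : Prop :=
  (Finset.univ : Finset (Equiv.Perm (Fin d))).val.map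
    (fun σ => ((Equiv.Perm.sign σ : ℤ), List.ofFn fun i => (σ i).val)) = (T : Multiset (ℤ × List ℕ))

theorem isSignedPerms_three : IsSignedPerms 3 (signedPerms 3) := by
  unfold IsSignedPerms
  decide +kernel

theorem isSignedPerms_four : IsSignedPerms 4 (signedPerms 4) := by
  unfold IsSignedPerms
  decide +kernel

theorem IsSignedPerms.sum {d : ℕ} {T : List (ℤ × List ℕ)} (hT : IsSignedPerms d T)
    (g : ℤ → List ℕ → ℝ) : (T.map fun q => g q.1 q.2).sum =
      ∑ σ : Equiv.Perm (Fin d), g (Equiv.Perm.sign σ : ℤ) (List.ofFn fun i => (σ i).val) := by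
  rw [Finset.sum, ← Multiset.sum_coe, ← Multiset.map_coe, ← hT, Multiset.map_map]
  rfl

theorem nth_ofFn {d : ℕ} (f : Fin d → ℕ) (i : Fin d) : nth (List.ofFn f) i.val = f i := by
  induction d with
  | zero => exact i.elim0
  | succ d ih =>
    rw [List.ofFn_succ]
    refine Fin.cases rfl (fun j => ?_) i
    exact ih (fun j => f j.succ) j

/-- The value of a function and its derivative along the first element of `k`. -/
noncomputable def dualAt {d : ℕ} (k : List (Fin d)) (p : Fin d → ℝ) (f : (Fin d → ℝ) → ℝ) :
    DualNumber ℝ :=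
  TrivSqZeroExt.inl (f p) + TrivSqZeroExt.inr (match k with | [] => 0 | k :: _ => pd k f p)

theorem dualAt_mul {d : ℕ} (k : List (Fin d)) (p : Fin d → ℝ) {f g : (Fin d → ℝ) → ℝ}
    (hf : ContDiff ℝ ∞ f) (hg : ContDiff ℝ ∞ g) :
    dualAt k p (fun x => f x * g x) = dualAt k p f * dualAt k p g := by
  ext
  · simp [dualAt]
  · cases k with
    | nil => simp [dualAt]
    | cons k l =>
      simp [dualAt, pd_eq_dd, dd_mul hf hg]
      ring

theorem dualAt_one {d : ℕ} (k : List (Fin d)) (p : Fin d → ℝ) : dualAt k p (fun _ => 1) = 1 := by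
  ext
  · simp [dualAt]
  · cases k with
    | nil => simp [dualAt]
    | cons k l => simp [dualAt, pd_eq_dd, dd_const]

theorem dualAt_list_prod {d : ℕ} (k : List (Fin d)) (p : Fin d → ℝ) {ι : Type*} (l : List ι)
    {f : ι → (Fin d → ℝ) → ℝ} (hf : ∀ i, ContDiff ℝ ∞ (f i)) :
    ContDiff ℝ ∞ (fun x => (l.map fun i => f i x).prod) ∧
    dualAt k p (fun x => (l.map fun i => f i x).prod) = (l.map fun i => dualAt k p (f i)).prod := by
  induction l with
  | nil => exact ⟨contDiff_const, dualAt_one k p⟩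
  | cons i l ih =>
    refine ⟨?_, ?_⟩
    · simpa using (hf i).mul ih.1
    · simp only [List.map_cons, List.prod_cons]
      rw [dualAt_mul k p (hf i) ih.1, ih.2]

section Formula

variable {n : ℕ} {e : ℕ →*₀ ℝ} {J : ℕ → List ℕ → ℕ} {N : NambuData n} {p : Fin (n + 2) → ℝ} {r : ℕ}

/-- The number of the function in a vertex. -/
def funIndex {n : ℕ} (π : Equiv.Perm (Fin n)) (v : Fin (3 * n + 3)) : ℕ :=
  if h : v.val < 3 then 0 else π ⟨(v.val - 3) / 3, by have := v.isLt; omega⟩ + 1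

theorem IsJet.content (hJ : IsJet e J N p r) (π : Equiv.Perm (Fin n)) (m : Fin (n + 2))
    (v : Fin (3 * n + 3)) (L : List (Fin (n + 2))) (hL : L.length ≤ r) :
    e (J (funIndex π v) (L.map Fin.val)) = pds L (content (N.permute π) m v.succ) p := by
  by_cases h : v.val < 3
  · have h1 : NambuMicro.content (N.permute π) m v.succ = N.rho := by
      have : (v.val + 1) < 4 := by omega
      simp [NambuMicro.content, this, NambuData.permute]
    rw [h1, funIndex, dif_pos h, hJ.rho L hL]
  · have h1 : NambuMicro.content (N.permute π) m v.succ =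
        N.cas (π ⟨(v.val - 3) / 3, by have := v.isLt; omega⟩) := by
      have h2 : ¬ (v.val + 1) < 4 := by omega
      simp [NambuMicro.content, h2, NambuData.permute]
    rw [h1, funIndex, dif_neg h, hJ.cas _ L hL]

theorem nodeValue_eq (hJ : IsJet e J N p r) (π : Equiv.Perm (Fin n)) (G : MicroGraph n)
    (m : Fin (n + 2)) (k : List (Fin (n + 2))) (σ : Fin 3 → Equiv.Perm (Fin (n + 2)))
    (v : Fin (3 * n + 3)) (hv : (edgesTo G v.succ).length + 1 ≤ r) :
    nodeValue e J (k.map Fin.val) (List.ofFn fun i => (σ 0 i).val) (List.ofFn fun i => (σ 1 i).val)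
      (List.ofFn fun i => (σ 2 i).val)
      (funIndex π v, (edgesTo G v.succ).map fun q => (q.1.val, q.2.val)) =
    dualAt k p (pds (incoming G σ v.succ) (content (N.permute π) m v.succ)) := by
  have hs : ∀ s : Fin 3, sel3 (List.ofFn fun i => (σ 0 i).val) (List.ofFn fun i => (σ 1 i).val)
      (List.ofFn fun i => (σ 2 i).val) s.val = List.ofFn fun i => (σ s i).val := fun s => by
    fin_cases s <;> rfl
  have hl : (((edgesTo G v.succ).map fun q => (q.1.val, q.2.val)).map fun q =>
      nth (sel3 (List.ofFn fun i => (σ 0 i).val) (List.ofFn fun i => (σ 1 i).val)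
        (List.ofFn fun i => (σ 2 i).val) q.1) q.2) = (incoming G σ v.succ).map Fin.val := by
    rw [incoming_eq_map, List.map_map, List.map_map]
    refine List.map_congr_left fun q _ => ?_
    change nth (sel3 _ _ _ q.1.val) q.2.val = (σ q.1 q.2).val
    rw [hs, nth_ofFn]
  have hlen : (incoming G σ v.succ).length + 1 ≤ r := by rwa [incoming_eq_map, List.length_map]
  rw [nodeValue, hl]
  ext
  · rw [fst_dval, hJ.content π m v _ (by omega)]
    simp [dualAt]
  · rw [snd_dval]
    cases k with
    | nil => simp [dualAt]
    | cons k l =>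
      change ((single (J (funIndex π v) (k.val :: (incoming G σ v.succ).map Fin.val))).map e).sum = _
      rw [sum_single]
      have := hJ.content π m v (k :: incoming G σ v.succ) (by simpa using hlen)
      rw [List.map_cons] at this
      rw [this]
      simp [dualAt]

/-- The component of a formula, or its derivative. -/
noncomputable def formulaValue (X : Formula n) (N : NambuData n) (k : List (Fin (n + 2)))
    (m : Fin (n + 2)) (p : Fin (n + 2) → ℝ) : ℝ :=
  match k with
  | [] => X N m p
  | k :: _ => pd k (X N m) p

theorem part_eq (k : List (Fin (n + 2))) (f : (Fin (n + 2) → ℝ) → ℝ) :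
    part (k.map Fin.val) (dualAt k p f) = match k with | [] => f p | k :: _ => pd k f p := by
  cases k <;> simp [part, dualAt]

theorem φ_eq_sum_of_sink {G : MicroGraph n} (hG : edgesTo G 0 = [(0, 0)]) (N : NambuData n)
    (m : Fin (n + 2)) : φ G N m = fun x => ∑ σ : Fin 3 → Equiv.Perm (Fin (n + 2)),
      ((∏ s, ((Equiv.Perm.sign (σ s) : ℤ) : ℝ)) * if σ 0 0 = m then 1 else 0) *
        ((List.finRange (3 * n + 3)).map fun v => pds (incoming G σ v.succ)
          (content N m v.succ) x).prod := by
  funext x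
  rw [φ_eq_sum (by rw [hG]; rfl)]
  refine Finset.sum_congr rfl fun σ _ => ?_
  rw [Fin.prod_univ_succ (n := 3 * n + 3), ← Fin.prod_univ_def, ← mul_assoc]
  congr 2
  rw [incoming_eq_map, hG, content_zero]
  exact congrFun (pd_coord (σ 0 0) m) x

/-- The program `formula` computes the components of the formula of a micro-graph and their
derivatives, if `J` encodes the partial derivatives of sufficiently high order. -/
theorem eval_formula_eq (hJ : IsJet e J N p r) {T : List (ℤ × List ℕ)}
    (hT : IsSignedPerms (n + 2) T) (π : Equiv.Perm (Fin n)) {G : MicroGraph n}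
    (hG : edgesTo G 0 = [(0, 0)]) (hr : ∀ v, (edgesTo G v).length + 1 ≤ r) (m : Fin (n + 2))
    (k : List (Fin (n + 2))) (c : ℤ) :
    eval e (formula J T (k.map Fin.val) (nodes π G) m.val c) =
      c * formulaValue (φ G) (N.permute π) k m p := by
  have hs : ∀ (σ : Fin 3 → Equiv.Perm (Fin (n + 2))) (v : Fin (3 * n + 3)), ContDiff ℝ ∞
      (pds (incoming G σ v.succ) (content (N.permute π) m v.succ)) := fun σ v =>
    smooth_pds (smooth_content _ _ _) _
  have h1 : formulaValue (φ G) (N.permute π) k m p = ∑ σ : Fin 3 → Equiv.Perm (Fin (n + 2)),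
      ((∏ s, ((Equiv.Perm.sign (σ s) : ℤ) : ℝ)) * if σ 0 0 = m then 1 else 0) *
        part (k.map Fin.val) (((List.finRange (3 * n + 3)).map fun v => dualAt k p
          (pds (incoming G σ v.succ) (content (N.permute π) m v.succ))).prod) := by
    have h2 := fun σ => dualAt_list_prod k p (List.finRange (3 * n + 3)) (hs σ)
    simp only [← (h2 _).2, part_eq]
    cases k with
    | nil => exact congrFun (φ_eq_sum_of_sink hG _ m) p
    | cons k l =>
      change pd k (φ G (N.permute π) m) p = _
      rw [φ_eq_sum_of_sink hG, pd_eq_dd, dd_sum _ fun σ => contDiff_const.mul (h2 σ).1]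
      refine Finset.sum_congr rfl fun σ _ => ?_
      rw [dd_const_mul (h2 σ).1]
      rfl
  rw [eval_formula, h1, sum_fin_three]
  rw [hT.sum fun s l => (T.map fun q₁ => (T.map fun q₂ => (c : ℝ) * s * q₁.1 * q₂.1 *
    if nth l 0 = m.val then part (k.map Fin.val)
      (((nodes π G).map (nodeValue e J (k.map Fin.val) l q₁.2 q₂.2)).prod) else 0).sum).sum,
    Finset.mul_sum]
  refine Finset.sum_congr rfl fun σ₀ _ => ?_
  rw [hT.sum fun s l => (T.map fun q₂ => (c : ℝ) * ((Equiv.Perm.sign σ₀ : ℤ) : ℝ) * s * q₂.1 *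
    if nth (List.ofFn fun i => (σ₀ i).val) 0 = m.val then part (k.map Fin.val)
      (((nodes π G).map (nodeValue e J (k.map Fin.val) (List.ofFn fun i => (σ₀ i).val) l q₂.2)).prod)
        else 0).sum, Finset.mul_sum]
  refine Finset.sum_congr rfl fun σ₁ _ => ?_
  rw [hT.sum fun s l => (c : ℝ) * ((Equiv.Perm.sign σ₀ : ℤ) : ℝ) * ((Equiv.Perm.sign σ₁ : ℤ) : ℝ) * s *
    if nth (List.ofFn fun i => (σ₀ i).val) 0 = m.val then part (k.map Fin.val)
      (((nodes π G).map (nodeValue e J (k.map Fin.val) (List.ofFn fun i => (σ₀ i).val)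
        (List.ofFn fun i => (σ₁ i).val) l)).prod) else 0, Finset.mul_sum]
  refine Finset.sum_congr rfl fun σ₂ _ => ?_
  have h3 : nth (List.ofFn fun i => (σ₀ i).val) 0 = (σ₀ 0).val :=
    nth_ofFn (fun i => (σ₀ i).val) 0
  rw [h3, nodes, List.map_map]
  have h4 := fun v => nodeValue_eq hJ π G m k ![σ₀, σ₁, σ₂] v (hr v.succ)
  simp only [Function.comp_def]
  simp only [← h4]
  rw [Fin.prod_univ_three]
  simp only [Fin.val_inj]
  change _ = (c : ℝ) * ((((Equiv.Perm.sign σ₀ : ℤ) : ℝ) * ((Equiv.Perm.sign σ₁ : ℤ) : ℝ) *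
    ((Equiv.Perm.sign σ₂ : ℤ) : ℝ) * if σ₀ 0 = m then 1 else 0) * _)
  split_ifs
  · rw [mul_one, mul_assoc, mul_assoc, mul_assoc, mul_assoc, mul_assoc]
    rfl
  · ring

end Formula

/-- The variables of the polynomials. -/
def primes : List ℕ :=
  [2, 3, 5, 7, 11, 13, 17, 19, 23, 29, 31, 37, 41, 43, 47, 53, 59, 61, 67, 71, 73, 79, 83, 89,
    97, 101, 103, 107, 109, 113, 127, 131, 137, 139, 149, 151, 157, 163, 167, 173, 179, 181, 191,
    193, 197, 199, 211, 223, 227, 229, 233, 239, 241, 251, 257, 263, 269, 271, 277, 281, 283, 293,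
    307, 311, 313, 317, 331, 337, 347, 349, 353, 359, 367, 373, 379, 383, 389, 397, 401, 409, 419,
    421, 431, 433, 439, 443, 449, 457, 461, 463, 467, 479, 487, 491, 499, 503, 509, 521, 523, 541,
    547, 557, 563, 569, 571, 577, 587, 593, 599, 601, 607, 613, 617, 619, 631, 641, 643, 647, 653,
    659, 661, 673, 677, 683, 691, 701, 709, 719, 727, 733, 739, 743, 751, 757, 761, 769, 773, 787,
    797, 809, 811, 821, 823, 827, 829, 839, 853, 857, 859, 863, 877, 881, 883, 887, 907, 911, 919,
    929, 937, 941, 947, 953, 967, 971, 977, 983, 991, 997, 1009, 1013, 1019, 1021, 1031, 1033,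
    1039, 1049, 1051, 1061, 1063, 1069, 1087, 1091, 1093, 1097, 1103, 1109, 1117, 1123, 1129,
    1151, 1153, 1163, 1171, 1181, 1187, 1193, 1201, 1213, 1217, 1223, 1229, 1231, 1237, 1249,
    1259, 1277, 1279, 1283, 1289, 1291]

/-- The codes of the partial derivatives of order at most four of `ϱ, a¹, a²` in a normal frame. There
are 70 multisets of at most four indices, so each of the three functions has a block of 70 primes. The
derivatives that are known to be zero or one come first in the tables. -/
noncomputable def jet₄ (f : ℕ) (L : List ℕ) : ℕ :=
  Nat.rec (lookup (keyOf L) (((multisets 4 4).map keyOf).zip primes))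
    (fun f' _ => Nat.rec
      (lookup (keyOf L) ([(1, 0), (5, 0), (25, 1), (125, 0), (6, 0), (26, 0), (30, 0), (126, 0),
        (130, 0)] ++ ((multisets 4 4).map keyOf).zip (primes.drop 70)))
      (fun _ _ => lookup (keyOf L) ([(1, 0), (5, 0), (25, 0), (125, 1)] ++
        ((multisets 4 4).map keyOf).zip (primes.drop 140))) f') f

/-- The derivative `∂_L Pⁱʲ` in a normal frame. -/
noncomputable def bivector₄ (i j : ℕ) (L : List ℕ) : SPoly := pjet jet₄ (signedPerms 4) i j L

/-- The micro-graphs of the skew pairs with their coefficients, multiplied by four to make them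
integers. -/
def terms₄ : List (ℤ × List Node) :=
  (knownTerms.map fun q => ((2 * q.1).num, nodes 1 q.2)) ++
    knownTerms.map fun q => (-(2 * q.1).num, nodes (Equiv.swap 0 1) q.2)

/-- Four times the `m`-th component of the known solution, or its derivative. -/
noncomputable def solution (k : List ℕ) (m : ℕ) : SPoly :=
  treeSum 8 (terms₄.map fun q => formula jet₄ (signedPerms 4) k q.2 m q.1)

/-- Four times the component `i, j` of `⟦P, X⟧`. -/
noncomputable def schouten₄ (i j : ℕ) : SPoly := sum4 fun k =>
  add (mul (bivector₄ k j []) (solution [k] i)) (add (mul (bivector₄ i k []) (solution [k] j))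
    (scale (-1) 1 (mul (bivector₄ i j [k]) (solution [] k))))

/-- Four times the component `i, j` of the defect of the known solution. -/
noncomputable def defect₄ (i j : ℕ) : SPoly :=
  add (add (scale 4 1 (tetra₁ bivector₄ i j)) (add (scale 12 1 (tetra₂ bivector₄ i j))
    (scale (-12) 1 (tetra₂ bivector₄ j i)))) (scale (-1) 1 (schouten₄ i j))

/-- The primes are free generators of the multiplicative monoid of the positive integers. -/
theorem exists_hom_of_primes (v : ℕ → ℝ) : ∃ e : ℕ →*₀ ℝ, ∀ q, q.Prime → e q = v q := by
  refine ⟨{ toFun := fun m => if m = 0 then 0 else m.factorization.prod fun q k => v q ^ k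
            map_zero' := if_pos rfl
            map_one' := by simp
            map_mul' := fun a b => ?_ }, fun q hq => ?_⟩
  · by_cases ha : a = 0
    · simp [ha]
    by_cases hb : b = 0
    · simp [hb]
    rw [if_neg (mul_ne_zero ha hb), if_neg ha, if_neg hb, Nat.factorization_mul ha hb,
      Finsupp.prod_add_index' (fun _ => pow_zero _) fun _ _ _ => pow_add _ _ _]
  · change (if q = 0 then (0 : ℝ) else q.factorization.prod fun q k => v q ^ k) = v q
    rw [if_neg hq.ne_zero, hq.factorization,
      Finsupp.prod_single_index (h := fun q k => v q ^ k) (pow_zero _), pow_one]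

/-- All words of length at most `r`. -/
def words (d : ℕ) : ℕ → List (List (Fin d))
  | 0 => [[]]
  | r + 1 => [] :: (List.finRange d).flatMap fun a => (words d r).map fun L => a :: L

theorem mem_words {d r : ℕ} {L : List (Fin d)} (h : L.length ≤ r) : L ∈ words d r := by
  induction r generalizing L with
  | zero => simp [List.length_eq_zero_iff.1 (Nat.le_zero.1 h), words]
  | succ r ih =>
    cases L with
    | nil => simp [words]
    | cons a L =>
      refine List.mem_cons_of_mem _ (List.mem_flatMap.2 ⟨a, List.mem_finRange a, ?_⟩)
      exact List.mem_map.2 ⟨L, ih (Nat.le_of_succ_le_succ h), rfl⟩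

/-- The function and the list of indices that belong to a variable. -/
def variable₄ (q : ℕ) : ℕ × List (Fin 4) :=
  (primes.idxOf q / 70, ((multisets 4 4).getD (primes.idxOf q % 70) []).map (Fin.ofNat 4))

/-- The code of a partial derivative is the corresponding variable. -/
def IsFree₄ (f : ℕ) (L : List (Fin 4)) (q : ℕ) : Prop :=
  q ∈ primes ∧ (variable₄ q).1 = f ∧ (variable₄ q).2.Perm L

instance (f : ℕ) (L : List (Fin 4)) (q : ℕ) : Decidable (IsFree₄ f L q) := by
  unfold IsFree₄; infer_instance

theorem prime_of_mem_primes : ∀ q ∈ primes, q.Prime := by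
  have h : ∀ q ∈ primes, 2 ≤ q ∧ q < 37 * 37 ∧ ∀ m ∈ List.range 37, 2 ≤ m → m < q → q % m ≠ 0 := by
    decide +kernel
  -- The largest member of the list is less than `37 ^ 2`, so trial division up to `36` is enough.
  intro q hq
  obtain ⟨h2, h3, h4⟩ := h q hq
  refine Nat.prime_def_le_sqrt.2 ⟨h2, fun m hm hm' hd => ?_⟩
  have h5 : m * m ≤ q := Nat.le_sqrt.1 hm'
  exact h4 m (List.mem_range.2 (by nlinarith)) hm (by nlinarith) (Nat.mod_eq_zero_of_dvd hd)

theorem jet₄_rho : ∀ L ∈ words 4 4, IsFree₄ 0 L (jet₄ 0 (L.map Fin.val)) := by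
  decide +kernel

theorem jet₄_cas₀ : ∀ L ∈ words 4 4, IsFree₄ 1 L (jet₄ 1 (L.map Fin.val)) ∨
    (jet₄ 1 (L.map Fin.val) = 0 ∧ (L = [0] ∨ L = [1] ∨ L = [3] ∨ L.Perm [0, 1] ∨ L.Perm [0, 2] ∨
      L.Perm [0, 3] ∨ L.Perm [1, 2] ∨ L.Perm [1, 3])) ∨
    (jet₄ 1 (L.map Fin.val) = 1 ∧ L = [2]) := by
  decide +kernel

theorem jet₄_cas₁ : ∀ L ∈ words 4 4, IsFree₄ 2 L (jet₄ 2 (L.map Fin.val)) ∨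
    (jet₄ 2 (L.map Fin.val) = 0 ∧ (L = [0] ∨ L = [1] ∨ L = [2])) ∨
    (jet₄ 2 (L.map Fin.val) = 1 ∧ L = [3]) := by
  decide +kernel

/-- All data in a normal frame are values of the variables in `jet₄`. -/
theorem exists_isJet₄ {N : NambuData 2} {p : Fin 4 → ℝ} (hN : IsNormalAt N p) :
    ∃ e : ℕ →*₀ ℝ, IsJet e jet₄ N p 4 := by
  obtain ⟨e, he⟩ := exists_hom_of_primes fun q => match (variable₄ q).1 with
    | 0 => pds (variable₄ q).2 N.rho p
    | 1 => pds (variable₄ q).2 (N.cas 0) p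
    | _ => pds (variable₄ q).2 (N.cas 1) p
  have hfree : ∀ {f : ℕ} {F : (Fin 4 → ℝ) → ℝ} {L : List (Fin 4)} {q : ℕ}, ContDiff ℝ ∞ F →
      (match f with | 0 => N.rho | 1 => N.cas 0 | _ => N.cas 1) = F → IsFree₄ f L q →
      e q = pds L F p := by
    rintro f F L q hF hf ⟨hq, h1, h2⟩
    rw [he q (prime_of_mem_primes q hq), h1, ← congrFun (pds_perm hF h2) p, ← hf]
    rcases f with _ | _ | f <;> rfl
  refine ⟨e, fun L hL => hfree N.rho_smooth rfl (jet₄_rho L (mem_words hL)), fun l L hL => ?_⟩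
  have hz : ∀ i j, i < j → i < 2 → L.Perm [i, j] → pds L (N.cas 0) p = 0 := fun i j hij hi h => by
    rw [pds_perm (N.cas_smooth 0) h]
    exact hN.hess i j hij hi
  have hg : ∀ l k, pds [k] (N.cas l) p = if k = l.natAdd 2 then 1 else 0 := hN.grad
  fin_cases l
  · change e (jet₄ 1 (L.map Fin.val)) = pds L (N.cas 0) p
    rcases jet₄_cas₀ L (mem_words hL) with h | ⟨h, h'⟩ | ⟨h, rfl⟩
    · exact hfree (N.cas_smooth 0) rfl h
    · rw [h, map_zero]
      rcases h' with rfl | rfl | rfl | h' | h' | h' | h' | h'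
      · exact (hg 0 0).symm
      · exact (hg 0 1).symm
      · exact (hg 0 3).symm
      · exact (hz 0 1 (by decide) (by decide) h').symm
      · exact (hz 0 2 (by decide) (by decide) h').symm
      · exact (hz 0 3 (by decide) (by decide) h').symm
      · exact (hz 1 2 (by decide) (by decide) h').symm
      · exact (hz 1 3 (by decide) (by decide) h').symm
    · rw [h, map_one]
      exact (hg 0 2).symm
  · change e (jet₄ 2 (L.map Fin.val)) = pds L (N.cas 1) p
    rcases jet₄_cas₁ L (mem_words hL) with h | ⟨h, h'⟩ | ⟨h, rfl⟩
    · exact hfree (N.cas_smooth 1) rfl h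
    · rw [h, map_zero]
      rcases h' with rfl | rfl | rfl
      · exact (hg 1 0).symm
      · exact (hg 1 1).symm
      · exact (hg 1 2).symm
    · rw [h, map_one]
      exact (hg 1 3).symm

section Bivector

variable {e : ℕ →*₀ ℝ} {J : ℕ → List ℕ → ℕ} {N : NambuData 2} {p : Fin 4 → ℝ}

theorem eval_leibniz (hJ : IsJet e J N p 4) (c : ℤ) (L r a b : List (Fin 4))
    (h₀ : L.length + r.length ≤ 4) (h₁ : L.length + a.length ≤ 4) (h₂ : L.length + b.length ≤ 4) :
    eval e (leibniz J c (L.map Fin.val) (r.map Fin.val) (a.map Fin.val) (b.map Fin.val)) =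
      c * pds L (fun x => pds r N.rho x * (pds a (N.cas 0) x * pds b (N.cas 1) x)) p := by
  induction L generalizing r a b with
  | nil =>
    change eval e (mono c (J 0 (r.map Fin.val) * (J 1 (a.map Fin.val) * J 2 (b.map Fin.val)))) = _
    rw [eval_mono, map_mul, map_mul, hJ.rho r (by simpa using h₀)]
    rw [show J 1 (a.map Fin.val) = J ((0 : Fin 2).val + 1) (a.map Fin.val) from rfl,
      show J 2 (b.map Fin.val) = J ((1 : Fin 2).val + 1) (b.map Fin.val) from rfl,
      hJ.cas 0 a (by simpa using h₁), hJ.cas 1 b (by simpa using h₂)]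
    rfl
  | cons i L ih =>
    have hr := smooth_pds N.rho_smooth r
    have ha := smooth_pds (N.cas_smooth 0) a
    have hb := smooth_pds (N.cas_smooth 1) b
    have hi : ∀ (l : List (Fin 4)) {F : (Fin 4 → ℝ) → ℝ}, ContDiff ℝ ∞ F → ContDiff ℝ ∞ (pds l F) :=
      fun l F hF => smooth_pds hF l
    simp only [List.length_cons] at h₀ h₁ h₂
    change eval e (add (leibniz J c (L.map Fin.val) ((i :: r).map Fin.val) (a.map Fin.val)
      (b.map Fin.val)) (add (leibniz J c (L.map Fin.val) (r.map Fin.val) ((i :: a).map Fin.val)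
      (b.map Fin.val)) (leibniz J c (L.map Fin.val) (r.map Fin.val) (a.map Fin.val)
      ((i :: b).map Fin.val)))) = _
    rw [eval_add, eval_add, ih _ _ _ (by simp; omega) (by omega) (by omega),
      ih _ _ _ (by omega) (by simp; omega) (by omega),
      ih _ _ _ (by omega) (by omega) (by simp; omega), ← pds_pd (hr.mul (ha.mul hb)), pd_eq_dd,
      dd_mul hr (ha.mul hb), dd_mul ha hb]
    have h1 : (fun x => dd (Pi.single i 1) (pds r N.rho) x * (pds a (N.cas 0) x * pds b (N.cas 1) x) +
        pds r N.rho x * (dd (Pi.single i 1) (pds a (N.cas 0)) x * pds b (N.cas 1) x +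
          pds a (N.cas 0) x * dd (Pi.single i 1) (pds b (N.cas 1)) x)) =
      fun x => pds (i :: r) N.rho x * (pds a (N.cas 0) x * pds b (N.cas 1) x) +
        (pds r N.rho x * (pds (i :: a) (N.cas 0) x * pds b (N.cas 1) x) +
        pds r N.rho x * (pds a (N.cas 0) x * pds (i :: b) (N.cas 1) x)) := by
      funext x
      rw [mul_add]
      rfl
    have hr' := smooth_pds N.rho_smooth (i :: r)
    have ha' := smooth_pds (N.cas_smooth 0) (i :: a)
    have hb' := smooth_pds (N.cas_smooth 1) (i :: b)
    rw [h1, pds_add (hr'.mul (ha.mul hb)) ((hr.mul (ha'.mul hb)).add (hr.mul (ha.mul hb'))),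
      pds_add (hr.mul (ha'.mul hb)) (hr.mul (ha.mul hb'))]
    ring

theorem bivector_eq_sum (N : NambuData 2) (i j : Fin 4) : N.bivector i j = fun x =>
    ∑ σ : Equiv.Perm (Fin 4), (if σ 0 = i then if σ 1 = j then ((Equiv.Perm.sign σ : ℤ) : ℝ)
      else 0 else 0) * (pds [] N.rho x * (pds [σ 2] (N.cas 0) x * pds [σ 3] (N.cas 1) x)) := by
  funext x
  rw [bivector_apply, ← Matrix.det_transpose, Matrix.det_apply', Finset.mul_sum]
  refine Finset.sum_congr rfl fun σ _ => ?_
  rw [Fin.prod_univ_four]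
  have h2 : Matrix.vecCons (Pi.single i 1 : Fin 4 → ℝ) (Matrix.vecCons (Pi.single j 1)
      fun l c => pd c (N.cas l) x) 2 (σ 2) = pd (σ 2) (N.cas 0) x := rfl
  have h3 : Matrix.vecCons (Pi.single i 1 : Fin 4 → ℝ) (Matrix.vecCons (Pi.single j 1)
      fun l c => pd c (N.cas l) x) 3 (σ 3) = pd (σ 3) (N.cas 1) x := rfl
  simp only [Matrix.transpose_apply, Matrix.of_apply, h2, h3, Matrix.cons_val_zero,
    Matrix.cons_val_one, Pi.single_apply, pds_nil, pds_cons]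
  split_ifs <;> ring

theorem eval_pjet (hJ : IsJet e J N p 4) {T : List (ℤ × List ℕ)} (hT : IsSignedPerms 4 T)
    (i j : Fin 4) (L : List (Fin 4)) (hL : L.length ≤ 3) :
    eval e (pjet J T i j (L.map Fin.val)) = pds L (N.bivector i j) p := by
  have h1 : eval e (pjet J T i j (L.map Fin.val)) = (T.map fun q => if nth q.2 0 = i then
      if nth q.2 1 = j then eval e (leibniz J q.1 (L.map Fin.val) [] [nth q.2 2] [nth q.2 3])
        else 0 else 0).sum := by
    clear hT
    induction T with
    | nil => rfl
    | cons q T ih =>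
      rw [List.map_cons, List.sum_cons, ← ih]
      have h : pjet J (q :: T) i j (L.map Fin.val) = Bool.rec (pjet J T i j (L.map Fin.val))
        (Bool.rec (pjet J T i j (L.map Fin.val)) (add (leibniz J q.1 (L.map Fin.val) [] [nth q.2 2]
          [nth q.2 3]) (pjet J T i j (L.map Fin.val))) (Nat.beq (nth q.2 1) j))
          (Nat.beq (nth q.2 0) i) := rfl
      rw [h]
      by_cases h0 : nth q.2 0 = i
      · rw [h0, Nat.beq_refl, if_pos rfl]
        by_cases h1 : nth q.2 1 = j
        · rw [h1, Nat.beq_refl, if_pos rfl]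
          exact eval_add _ _ _
        · have : Nat.beq (nth q.2 1) j = false := by
            rw [Bool.eq_false_iff]; exact fun h' => h1 (Nat.eq_of_beq_eq_true h')
          rw [this, if_neg h1, zero_add]
      · have : Nat.beq (nth q.2 0) i = false := by
          rw [Bool.eq_false_iff]; exact fun h' => h0 (Nat.eq_of_beq_eq_true h')
        rw [this, if_neg h0, zero_add]
  have hs : ∀ σ : Equiv.Perm (Fin 4), ContDiff ℝ ∞ fun x =>
      pds [] N.rho x * (pds [σ 2] (N.cas 0) x * pds [σ 3] (N.cas 1) x) := fun σ =>
    (smooth_pds N.rho_smooth _).mul ((smooth_pds (N.cas_smooth 0) _).mul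
      (smooth_pds (N.cas_smooth 1) _))
  rw [h1, hT.sum fun s l => if nth l 0 = i then if nth l 1 = j then
    eval e (leibniz J s (L.map Fin.val) [] [nth l 2] [nth l 3]) else 0 else 0, bivector_eq_sum,
    pds_sum _ fun σ => contDiff_const.mul (hs σ)]
  refine Finset.sum_congr rfl fun σ _ => ?_
  have hn : ∀ k : Fin 4, nth (List.ofFn fun i => (σ i).val) k.val = (σ k).val :=
    fun k => nth_ofFn (fun i => (σ i).val) k
  rw [pds_const_mul (hs σ)]
  have hl := eval_leibniz hJ (Equiv.Perm.sign σ : ℤ) L [] [σ 2] [σ 3] (by simp; omega)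
    (by simp; omega) (by simp; omega)
  have h0 := hn 0; have h1 := hn 1; have h2 := hn 2; have h3 := hn 3
  simp only [Fin.val_zero, Fin.val_one, Fin.val_two, show (3 : Fin 4).val = 3 from rfl] at h0 h1 h2 h3
  simp only [List.map_cons, List.map_nil] at hl
  rw [h0, h1, h2, h3, hl]
  simp only [Fin.val_inj]
  split_ifs <;> simp

end Bivector

theorem sum_comm₂ {ι M : Type*} [Fintype ι] [AddCommMonoid M] (f : ι → ι → ι → ι → M) :
    ∑ a, ∑ b, ∑ c, ∑ d, f a b c d = ∑ c, ∑ d, ∑ a, ∑ b, f a b c d := by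
  have : ∀ a, ∑ b, ∑ c, ∑ d, f a b c d = ∑ c, ∑ d, ∑ b, f a b c d := fun a => by
    rw [Finset.sum_comm]
    exact Finset.sum_congr rfl fun c _ => Finset.sum_comm
  simp only [this]
  rw [Finset.sum_comm]
  exact Finset.sum_congr rfl fun c _ => Finset.sum_comm

section Tetra

variable {e : ℕ →*₀ ℝ} {N : NambuData 2} {p : Fin 4 → ℝ} {P : ℕ → ℕ → List ℕ → SPoly}
  (hP : ∀ (i j : Fin 4) (L : List (Fin 4)), L.length ≤ 3 →
    eval e (P i j (L.map Fin.val)) = pds L (N.bivector i j) p)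

include hP

theorem eval_wedge₂ (k' l l' j : Fin 4) : eval e (wedge₂ P k' l l' j) =
    ∑ m', pd m' (N.bivector k' l) p * pd j (N.bivector m' l') p := by
  rw [wedge₂, eval_sum4]
  refine Finset.sum_congr rfl fun m' _ => ?_
  rw [eval_mul]
  exact congrArg₂ _ (hP k' l [m'] (by simp)) (hP m' l' [j] (by simp))

theorem eval_tetra₁ (i j : Fin 4) :
    eval e (tetra₁ P i j) = NambuMicro.tetra₁ N.bivector i j p := by
  rw [tetra₁, NambuMicro.tetra₁, eval_sum4]
  refine Finset.sum_congr rfl fun k _ => ?_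
  rw [eval_sum4]
  refine Finset.sum_congr rfl fun l _ => ?_
  rw [eval_sum4]
  refine Finset.sum_congr rfl fun m _ => ?_
  have h0 : eval e (P i j [k.val, l.val, m.val]) = _ := hP i j [k, l, m] (by simp)
  rw [eval_mul, h0, wedge₁, eval_sum4, Finset.sum_mul]
  refine Finset.sum_congr rfl fun k' _ => ?_
  rw [eval_sum4, Finset.sum_mul]
  refine Finset.sum_congr rfl fun l' _ => ?_
  have h1 : eval e (P k k' [l'.val]) = _ := hP k k' [l'] (by simp)
  rw [eval_mul, h1, eval_scale, eval_wedge₂ hP, Finset.mul_sum, Finset.mul_sum, Finset.sum_mul]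
  refine Finset.sum_congr rfl fun m' _ => ?_
  rw [bivector_swap_pd N m m']
  simp only [pds_cons, pds_nil]
  push_cast
  rw [map_one]
  ring

theorem eval_tetra₂ (i m : Fin 4) :
    eval e (tetra₂ P i m) = NambuMicro.tetra₂ N.bivector i m p := by
  rw [tetra₂, NambuMicro.tetra₂, eval_sum4, Finset.sum_comm]
  refine Finset.sum_congr rfl fun k _ => ?_
  rw [sum_comm₂, eval_sum4]
  refine Finset.sum_congr rfl fun k' _ => ?_
  rw [eval_sum4]
  refine Finset.sum_congr rfl fun l' _ => ?_
  have h0 : eval e (P k m [k'.val, l'.val]) = _ := hP k m [k', l'] (by simp)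
  rw [eval_mul, h0, star₂, eval_sum4, Finset.mul_sum]
  refine Finset.sum_congr rfl fun j _ => ?_
  rw [eval_sum4, Finset.mul_sum]
  refine Finset.sum_congr rfl fun l _ => ?_
  have h1 : eval e (P i j [k.val, l.val]) = _ := hP i j [k, l] (by simp)
  rw [eval_mul, h1, eval_wedge₂ hP, Finset.sum_mul, Finset.mul_sum]
  refine Finset.sum_congr rfl fun m' _ => ?_
  ring

end Tetra

/-! ### The known solution trivialises the tetrahedral flow -/

section Solution

theorem formulaValue_add {n : ℕ} {X Y : Formula n} (hX : IsCovariant X) (hY : IsCovariant Y)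
    (N : NambuData n) (k : List (Fin (n + 2))) (m : Fin (n + 2)) (p : Fin (n + 2) → ℝ) :
    formulaValue (X + Y) N k m p = formulaValue X N k m p + formulaValue Y N k m p := by
  cases k with
  | nil => rfl
  | cons k l => exact congrFun (dd_add (hX.smooth N m) (hY.smooth N m) _) p

theorem formulaValue_smul {n : ℕ} {X : Formula n} (hX : IsCovariant X) (c : ℝ)
    (N : NambuData n) (k : List (Fin (n + 2))) (m : Fin (n + 2)) (p : Fin (n + 2) → ℝ) :
    formulaValue (c • X) N k m p = c * formulaValue X N k m p := by
  cases k with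
  | nil => rfl
  | cons k l => exact congrFun (dd_const_mul (hX.smooth N m) c _) p

theorem formulaValue_zero {n : ℕ} (N : NambuData n) (k : List (Fin (n + 2))) (m : Fin (n + 2))
    (p : Fin (n + 2) → ℝ) : formulaValue (0 : Formula n) N k m p = 0 := by
  cases k with
  | nil => rfl
  | cons k l => exact congrFun (dd_const 0 _) p

/-- A skew pair as a linear combination of formulas. -/
theorem skewPair_eq (H : MicroGraph 2) : skewPair H = (1 / 2 : ℝ) •
    (φ H + (-1 : ℝ) • fun N => φ H (N.permute (Equiv.swap 0 1))) := by
  funext N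
  simp [skewPair, sub_eq_add_neg]

/-- The properties of the micro-graphs of the known solution that the computation needs: the first
edge of the first source is the only one that goes to the sink, and no vertex has more than three
incoming edges. -/
theorem knownTerms_edges : ∀ q ∈ knownTerms, edgesTo q.2 0 = [(0, 0)] ∧
    (∀ v, (edgesTo q.2 v).length + 1 ≤ 4) ∧ (((2 * q.1).num : ℚ)) = 2 * q.1 := by
  decide +kernel

theorem isCovariant_skewPair {H : MicroGraph 2} (hH : edgesTo H 0 = [(0, 0)]) :
    IsCovariant (skewPair H) := by
  have h : (edgesTo H 0).length = 1 := by rw [hH]; rfl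
  rw [skewPair_eq]
  exact ((IsCovariant.φ h).add (((IsCovariant.φ h).permute _).smul _)).smul _

theorem isCovariant_knownSolution : IsCovariant knownSolution :=
  IsCovariant.list_sum fun X hX => by
    obtain ⟨q, hq, rfl⟩ := List.mem_map.1 hX
    exact (isCovariant_skewPair (knownTerms_edges q hq).1).smul _

theorem preservesPolyFamilies_knownSolution : PreservesPolyFamilies knownSolution :=
  PreservesPolyFamilies.list_sum fun X hX => by
    obtain ⟨q, hq, rfl⟩ := List.mem_map.1 hX
    have h : (edgesTo q.2 0).length = 1 := by rw [(knownTerms_edges q hq).1]; rfl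
    rw [skewPair_eq]
    exact (((PreservesPolyFamilies.φ h).add
      (((PreservesPolyFamilies.φ h).permute _).smul _)).smul _).smul _

variable {e : ℕ →*₀ ℝ} {N : NambuData 2} {p : Fin 4 → ℝ} (hJ : IsJet e jet₄ N p 4)

include hJ

theorem eval_bivector₄ (i j : Fin 4) (L : List (Fin 4)) (hL : L.length ≤ 3) :
    eval e (bivector₄ i j (L.map Fin.val)) = pds L (N.bivector i j) p :=
  eval_pjet hJ isSignedPerms_four i j L hL

theorem eval_solution (k : List (Fin 4)) (m : Fin 4) :
    eval e (solution (k.map Fin.val) m) = 4 * formulaValue knownSolution N k m p := by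
  have key : ∀ l : List (ℚ × MicroGraph 2), (∀ q ∈ l, edgesTo q.2 0 = [(0, 0)] ∧
      (∀ v, (edgesTo q.2 v).length + 1 ≤ 4) ∧ (((2 * q.1).num : ℚ)) = 2 * q.1) →
      IsCovariant (l.map fun q => (q.1 : ℝ) • skewPair q.2).sum ∧
      (l.map fun q => eval e (formula jet₄ (signedPerms 4) (k.map Fin.val) (nodes 1 q.2) m
        (2 * q.1).num)).sum +
      (l.map fun q => eval e (formula jet₄ (signedPerms 4) (k.map Fin.val)
        (nodes (Equiv.swap 0 1) q.2) m (-(2 * q.1).num))).sum =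
      4 * formulaValue (l.map fun q => (q.1 : ℝ) • skewPair q.2).sum N k m p := by
    intro l hl
    induction l with
    | nil => exact ⟨IsCovariant.zero, by simp [formulaValue_zero]⟩
    | cons q l ih =>
      obtain ⟨ih0, ih1⟩ := ih fun q' hq' => hl q' (List.mem_cons_of_mem _ hq')
      obtain ⟨h1, h2, h3⟩ := hl q List.mem_cons_self
      have h : (edgesTo q.2 0).length = 1 := by rw [h1]; rfl
      have hc := isCovariant_skewPair h1
      have hφ := IsCovariant.φ h
      have hp := hφ.permute (Equiv.swap 0 1)
      simp only [List.map_cons, List.sum_cons]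
      refine ⟨(hc.smul _).add ih0, ?_⟩
      rw [formulaValue_add (hc.smul _) ih0, formulaValue_smul hc, skewPair_eq,
        formulaValue_smul (hφ.add (hp.smul _)), formulaValue_add hφ (hp.smul _),
        formulaValue_smul hp, eval_formula_eq hJ isSignedPerms_four 1 h1 h2,
        eval_formula_eq hJ isSignedPerms_four _ h1 h2, mul_add, ← ih1]
      have h4 : ((2 * q.1).num : ℝ) = 2 * (q.1 : ℝ) := by exact_mod_cast h3
      have h5 : N.permute 1 = N := rfl
      have h6 : formulaValue (fun N => φ q.2 (N.permute (Equiv.swap 0 1))) N k m p =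
          formulaValue (φ q.2) (N.permute (Equiv.swap 0 1)) k m p := by cases k <;> rfl
      push_cast
      rw [h4, h5, h6]
      ring
  rw [solution, eval_treeSum, List.map_map, terms₄, List.map_append, List.sum_append, List.map_map,
    List.map_map]
  exact (key knownTerms knownTerms_edges).2

theorem eval_schouten₄ (i j : Fin 4) :
    eval e (schouten₄ i j) = 4 * schouten N.bivector (knownSolution N) i j p := by
  rw [schouten₄, schouten, eval_sum4, Finset.mul_sum]
  refine Finset.sum_congr rfl fun k _ => ?_
  have h0 : ∀ i j : Fin 4, eval e (bivector₄ i j []) = N.bivector i j p := fun i j =>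
    eval_bivector₄ hJ i j [] (by simp)
  have h1 : eval e (bivector₄ i j [k.val]) = pd k (N.bivector i j) p :=
    eval_bivector₄ hJ i j [k] (by simp)
  have h2 : eval e (solution [] k) = 4 * knownSolution N k p := eval_solution hJ [] k
  have h3 : ∀ m : Fin 4, eval e (solution [k.val] m) = 4 * pd k (knownSolution N m) p := fun m =>
    eval_solution hJ [k] m
  rw [eval_add, eval_add, eval_mul, eval_mul, eval_scale, eval_mul, h0, h0, h1, h2, h3, h3, map_one]
  push_cast
  ring

theorem eval_defect₄ (i j : Fin 4) : eval e (defect₄ i j) = 4 * defect knownSolution N i j p := by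
  have hP := eval_bivector₄ hJ
  rw [defect₄, eval_add, eval_add, eval_add, eval_scale, eval_scale, eval_scale, eval_scale,
    eval_tetra₁ hP, eval_tetra₂ hP, eval_tetra₂ hP, eval_schouten₄ hJ, defect, tetraFlow, map_one]
  push_cast
  ring

end Solution

/-- All the terms of the polynomial cancel; this and the next three lemmas are the computational core
of the proof. -/
theorem defect₄_zero_one : isNil (defect₄ 0 1) = true := by decide +kernel

theorem defect₄_zero_two : isNil (defect₄ 0 2) = true := by decide +kernel

theorem defect₄_zero_three : isNil (defect₄ 0 3) = true := by decide +kernel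

theorem defect₄_two_three : isNil (defect₄ 2 3) = true := by decide +kernel

end Symbolic

theorem isTrivialising_knownSolution : IsTrivialising knownSolution := by
  refine isTrivialising_of_isNormalAt Symbolic.isCovariant_knownSolution Symbolic.preservesPolyFamilies_knownSolution
    fun N p hN => ?_
  obtain ⟨e, hJ⟩ := Symbolic.exists_isJet₄ hN
  have h : ∀ i j : Fin 4, SPoly.isNil (Symbolic.defect₄ i j) = true →
      defect knownSolution N i j p = 0 := fun i j h0 => by
    have := Symbolic.eval_defect₄ hJ i j
    rw [SPoly.eval_of_isNil e h0] at this
    linarith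
  exact ⟨h 0 1 Symbolic.defect₄_zero_one, h 0 2 Symbolic.defect₄_zero_two,
    h 0 3 Symbolic.defect₄_zero_three, h 2 3 Symbolic.defect₄_two_three⟩

/-! ### Relations between the formulas over dimension three -/

namespace Symbolic

open SPoly

/-- The codes of the partial derivatives of order at most four of `ϱ, a¹` on `ℝ³`. -/
noncomputable def jet₃ (f : ℕ) (L : List ℕ) : ℕ :=
  lookup (keyOf L) (((multisets 3 4).map keyOf).zip (primes.drop (35 * f)))

/-- The function and the list of indices that belong to a variable. -/
def variable₃ (q : ℕ) : ℕ × List (Fin 3) :=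
  (primes.idxOf q / 35, ((multisets 3 4).getD (primes.idxOf q % 35) []).map (Fin.ofNat 3))

theorem jet₃_free : ∀ f ∈ [0, 1], ∀ L ∈ words 3 4, jet₃ f (L.map Fin.val) ∈ primes ∧
    (variable₃ (jet₃ f (L.map Fin.val))).1 = f ∧
    (variable₃ (jet₃ f (L.map Fin.val))).2.Perm L := by
  decide +kernel

theorem exists_isJet₃ (N : NambuData 1) (p : Fin 3 → ℝ) : ∃ e : ℕ →*₀ ℝ, IsJet e jet₃ N p 4 := by
  obtain ⟨e, he⟩ := exists_hom_of_primes fun q => match (variable₃ q).1 with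
    | 0 => pds (variable₃ q).2 N.rho p
    | _ => pds (variable₃ q).2 (N.cas 0) p
  refine ⟨e, fun L hL => ?_, fun l L hL => ?_⟩
  · obtain ⟨h1, h2, h3⟩ := jet₃_free 0 (by decide) L (mem_words hL)
    rw [he _ (prime_of_mem_primes _ h1), h2, ← pds_perm N.rho_smooth h3]
    rfl
  · obtain rfl : l = 0 := Subsingleton.elim _ _
    obtain ⟨h1, h2, h3⟩ := jet₃_free 1 (by decide) L (mem_words hL)
    refine (he _ (prime_of_mem_primes _ h1)).trans ?_
    rw [h2, ← pds_perm (N.cas_smooth 0) h3]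
    rfl

/-- The `m`-th component of a linear combination of formulas. -/
noncomputable def combination (l : List (ℤ × MicroGraph 1)) (m : ℕ) : SPoly :=
  treeSum 3 (l.map fun q => formula jet₃ (signedPerms 3) [] (nodes 1 q.2) m q.1)

/-- The first edge of the first source is the only one that goes to the sink, and no vertex has more
than three incoming edges. -/
def IsAdmissible {n : ℕ} (G : MicroGraph n) : Prop :=
  edgesTo G 0 = [(0, 0)] ∧ ∀ v, (edgesTo G v).length + 1 ≤ 4

instance {n : ℕ} (G : MicroGraph n) : Decidable (IsAdmissible G) := by
  unfold IsAdmissible; infer_instance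

theorem combination_eq_zero {l : List (ℤ × MicroGraph 1)} (hl : ∀ q ∈ l, IsAdmissible q.2)
    (h : ∀ m : Fin 3, isNil (combination l m) = true) :
    (l.map fun q => (q.1 : ℝ) • φ q.2).sum = 0 := by
  funext N m p
  obtain ⟨e, hJ⟩ := exists_isJet₃ N p
  have h1 : eval e (combination l m) = (l.map fun q => (q.1 : ℝ) • φ q.2).sum N m p := by
    rw [combination, eval_treeSum, List.map_map]
    clear h
    induction l with
    | nil => rfl
    | cons q l ih =>
      obtain ⟨h2, h3⟩ := hl q List.mem_cons_self
      rw [List.map_cons, List.sum_cons, List.map_cons, List.sum_cons,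
        ih fun q hq => hl q (List.mem_cons_of_mem _ hq)]
      exact congrArg (· + _) (eval_formula_eq hJ isSignedPerms_three 1 h2 h3 m [] q.1)
  rw [← h1, eval_of_isNil e (h m)]
  rfl

end Symbolic

open Symbolic

/-- Each of the three components of the formulas in the vanishing list expands to zero. -/
theorem vanishing_relations : ∀ k, IsAdmissible (vanishing k) ∧
    ∀ m : Fin 3, SPoly.isNil (combination [(1, vanishing k)] m) = true := by
  decide +kernel

theorem φ_vanishing (k : Fin 13) : φ (vanishing k) = 0 := by
  have := combination_eq_zero (l := [(1, vanishing k)])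
    (by simpa using (vanishing_relations k).1) (vanishing_relations k).2
  simpa using this

/-- The sunflower micro-graphs `H` that are in neither list, with the coefficients `c` and the
indices `k` of the relations `2 φ(H) = ∑ c φ(basis k)`. -/
def dependent : Fin 15 → MicroGraph 1 × List (ℤ × Fin 20) :=
  ![(![![0, 1, 4], ![1, 3, 5], ![1, 5, 6]], [(2, 1)]),
    (![![0, 1, 4], ![1, 3, 5], ![4, 5, 6]], [(2, 4)]),
    (![![0, 1, 4], ![4, 3, 5], ![1, 2, 6]], [(2, 2)]),
    (![![0, 1, 4], ![4, 3, 5], ![1, 5, 6]], [(2, 3)]),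
    (![![0, 1, 4], ![4, 3, 5], ![4, 5, 6]], [(2, 6)]),
    (![![0, 2, 4], ![1, 6, 5], ![4, 2, 6]], [(2, 3), (-2, 4)]),
    (![![0, 2, 4], ![4, 3, 5], ![1, 2, 6]], [(-2, 2)]),
    (![![0, 2, 4], ![4, 3, 5], ![4, 5, 6]], [(2, 6)]),
    (![![0, 2, 4], ![4, 6, 5], ![1, 2, 6]], [(-2, 4)]),
    (![![0, 2, 4], ![4, 6, 5], ![4, 5, 6]], [(2, 8)]),
    (![![0, 5, 4], ![1, 6, 5], ![1, 2, 6]], [(2, 3), (1, 14)]),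
    (![![0, 5, 4], ![1, 6, 5], ![4, 5, 6]], [(-1, 8)]),
    (![![0, 5, 4], ![4, 3, 5], ![1, 5, 6]], [(-2, 17)]),
    (![![0, 5, 4], ![4, 6, 5], ![1, 5, 6]], [(-1, 8)]),
    (![![0, 5, 4], ![4, 6, 5], ![4, 2, 6]], [(1, 8)])]

/-- The coefficient of the `k`-th basic formula. -/
def coefficient (l : List (ℤ × Fin 20)) (k : Fin 20) : ℤ :=
  (l.map fun q => if q.2 = k then q.1 else 0).sum

theorem sum_coefficient {M : Type*} [AddCommGroup M] [Module ℝ M] (v : Fin 20 → M)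
    (l : List (ℤ × Fin 20)) :
    (l.map fun q => (q.1 : ℝ) • v q.2).sum = ∑ k, (coefficient l k : ℝ) • v k := by
  induction l with
  | nil => simp [coefficient]
  | cons q l ih =>
    have h : ∀ k, coefficient (q :: l) k = (if q.2 = k then q.1 else 0) + coefficient l k :=
      fun k => by simp [coefficient]
    simp only [List.map_cons, List.sum_cons, h, ih, Int.cast_add, add_smul, Finset.sum_add_distrib]
    simp

theorem dependent_relations : ∀ i, IsAdmissible (dependent i).1 ∧
    (∀ q ∈ (dependent i).2, IsAdmissible (basis q.2)) ∧
    (∃ k, coefficient (dependent i).2 k ≠ 0) ∧ ∀ m : Fin 3, SPoly.isNil (combination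
      ((-2, (dependent i).1) :: (dependent i).2.map fun q => (q.1, basis q.2)) m) = true := by
  decide +kernel

theorem two_smul_φ_dependent (i : Fin 15) : (2 : ℝ) • φ (dependent i).1 =
    ∑ k, (coefficient (dependent i).2 k : ℝ) • φ (basis k) := by
  obtain ⟨h1, h2, -, h3⟩ := dependent_relations i
  have := combination_eq_zero (l := (-2, (dependent i).1) :: (dependent i).2.map fun q =>
    (q.1, basis q.2)) (by
      intro q hq
      rcases List.mem_cons.1 hq with rfl | hq
      · exact h1
      · obtain ⟨q', hq', rfl⟩ := List.mem_map.1 hq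
        exact h2 q' hq') h3
  rw [List.map_cons, List.sum_cons, List.map_map] at this
  rw [← sum_coefficient fun k => φ (basis k)]
  have h4 := eq_neg_of_add_eq_zero_right this
  refine Eq.trans ?_ h4.symm
  rw [← neg_smul]
  norm_num

/-! ### Linear independence of the basic formulas -/

section Independence

/-- A sum of exponentials; `Λ` is the list of the exponents. -/
noncomputable def expSum (Λ : List (List ℕ)) (x : Fin 3 → ℝ) : ℝ :=
  (Λ.map fun u => Real.exp (∑ i : Fin 3, (nth u i : ℝ) * x i)).sum

/-- The partial derivatives of a sum of exponentials at the origin. -/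
noncomputable def expJet (Λ : List (List ℕ)) (L : List ℕ) : ℕ :=
  (Λ.map fun u => (L.map fun i => nth u i).prod).sum

theorem smooth_exp_linear (u : Fin 3 → ℝ) :
    ContDiff ℝ ∞ fun x : Fin 3 → ℝ => Real.exp (∑ i, u i * x i) :=
  Real.contDiff_exp.comp (ContDiff.sum fun i _ => contDiff_const.mul (smooth_coord i))

theorem smooth_expSum (Λ : List (List ℕ)) : ContDiff ℝ ∞ (expSum Λ) := by
  induction Λ with
  | nil => exact contDiff_const
  | cons u Λ ih => exact (smooth_exp_linear fun i => nth u i).add ih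

theorem pd_exp_linear (u : Fin 3 → ℝ) (i : Fin 3) :
    pd i (fun x : Fin 3 → ℝ => Real.exp (∑ i, u i * x i)) =
      fun x => u i * Real.exp (∑ i, u i * x i) := by
  funext x
  have h1 : ContDiff ℝ ∞ fun x : Fin 3 → ℝ => ∑ i, u i * x i :=
    ContDiff.sum fun i _ => contDiff_const.mul (smooth_coord i)
  have h2 : pd i (fun x : Fin 3 → ℝ => ∑ i, u i * x i) x = u i := by
    rw [pd_eq_dd, dd_sum _ fun i => contDiff_const.mul (smooth_coord i)]
    simp only [dd_const_mul (smooth_coord _), ← pd_eq_dd, pd_coord]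
    simp
  have h3 := (smooth_diffAt h1 x).hasFDerivAt.exp
  rw [pd, h3.fderiv]
  change Real.exp _ * pd i (fun x : Fin 3 → ℝ => ∑ i, u i * x i) x = _
  rw [h2, mul_comm]

theorem pds_expSum (Λ : List (List ℕ)) (L : List (Fin 3)) :
    pds L (expSum Λ) 0 = expJet Λ (L.map Fin.val) := by
  have h1 : ∀ (u : Fin 3 → ℝ) (L : List (Fin 3)),
      pds L (fun x : Fin 3 → ℝ => Real.exp (∑ i, u i * x i)) =
        fun x => (L.map u).prod * Real.exp (∑ i, u i * x i) := fun u L => by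
    induction L with
    | nil => simp
    | cons i L ih =>
      rw [pds_cons, ih, pd_eq_dd, dd_const_mul (smooth_exp_linear u), ← pd_eq_dd, pd_exp_linear]
      funext x
      rw [List.map_cons, List.prod_cons]
      ring
  induction Λ with
  | nil =>
    have : expSum [] = fun _ => 0 := rfl
    rw [this, pds_zero]
    simp [expJet]
  | cons u Λ ih =>
    have h : expSum (u :: Λ) =
        fun x => Real.exp (∑ i : Fin 3, (nth u i : ℝ) * x i) + expSum Λ x := rfl
    have h2 : expJet (u :: Λ) (L.map Fin.val) =
        ((L.map Fin.val).map fun i => nth u i).prod + expJet Λ (L.map Fin.val) := rfl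
    rw [h, pds_add (smooth_exp_linear fun i => nth u i) (smooth_expSum Λ),
      h1 (fun i => nth u i), h2]
    simp [ih, Nat.cast_list_prod, Function.comp_def]

/-- The Nambu-Poisson structures on which the basic formulas are evaluated: the exponents of `ϱ` and
of `a¹`, which are sums of exponentials. -/
def samples : List (List (List ℕ) × List (List ℕ)) :=
  [([[0, 1, 1], [0, 1, 1], [0, 1, 1], [0, 0, 1]], [[1, 1, 0], [1, 0, 0], [1, 0, 1], [0, 0, 1]]),
    ([[0, 1, 1], [0, 1, 0], [0, 1, 1], [0, 0, 0]], [[0, 1, 0], [0, 1, 1], [1, 0, 0], [0, 0, 1]]),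
    ([[0, 1, 0], [1, 1, 0], [0, 0, 1], [1, 0, 0]], [[0, 1, 1], [1, 1, 0], [0, 1, 0], [1, 0, 1]]),
    ([[0, 1, 0], [1, 1, 0], [1, 0, 1], [1, 1, 0]], [[0, 0, 1], [0, 0, 1], [0, 1, 0], [0, 0, 1]]),
    ([[1, 1, 0], [1, 0, 0], [1, 0, 0], [0, 1, 0]], [[1, 0, 1], [1, 0, 0], [1, 0, 1], [0, 0, 1]]),
    ([[1, 1, 1], [1, 1, 0], [0, 1, 0], [0, 1, 0]], [[0, 1, 0], [0, 0, 0], [1, 0, 0], [1, 0, 0]]),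
    ([[0, 1, 1], [0, 1, 1], [1, 0, 0], [1, 1, 1]], [[1, 1, 0], [0, 1, 0], [0, 1, 0], [1, 1, 1]])]

/-- The exponents of the `t`-th sample. -/
def sample (t : ℕ) : List (List ℕ) × List (List ℕ) := samples.getD t ([], [])

/-- The `t`-th sample. -/
noncomputable def sampleData (t : ℕ) : NambuData 1 where
  rho := expSum (sample t).1
  cas := fun _ => expSum (sample t).2
  rho_smooth := smooth_expSum _
  cas_smooth := fun _ => smooth_expSum _

/-- The partial derivatives of the functions of the `t`-th sample at the origin. -/
noncomputable def sampleJet (t f : ℕ) (L : List ℕ) : ℕ :=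
  Nat.rec (expJet (sample t).1 L) (fun _ _ => expJet (sample t).2 L) f

theorem isJet_sampleJet (t : ℕ) :
    IsJet (Nat.castRingHom ℝ).toMonoidWithZeroHom (sampleJet t) (sampleData t) 0 4 where
  rho := fun L _ => (pds_expSum (sample t).1 L).symm
  cas := fun _ L _ => (pds_expSum (sample t).2 L).symm

/-- The sum of the coefficients times the codes of the monomials. -/
noncomputable def integerValue (p : SPoly) : ℤ :=
  SPoly.rec 0 (fun c m _ ih => Int.add (Int.mul c (Int.ofNat m)) ih) p

theorem eval_natCast (p : SPoly) :
    SPoly.eval (Nat.castRingHom ℝ).toMonoidWithZeroHom p = integerValue p := by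
  induction p with
  | nil => exact Int.cast_zero.symm
  | cons c m t ih =>
    change (c : ℝ) * (m : ℝ) + SPoly.eval _ t = ((c * (m : ℤ) + integerValue t : ℤ) : ℝ)
    rw [ih]
    push_cast
    rfl

/-- The values at the origin of the components of the basic formulas on the samples: row `i` belongs
to the component `i % 3` on the sample `i / 3`. -/
noncomputable def sampleMatrix : Matrix (Fin 20) (Fin 20) ℤ := Matrix.of fun i k =>
  integerValue (formula (sampleJet (i.val / 3)) (signedPerms 3) [] (nodes 1 (basis k)) (i.val % 3) 1)

/-- The inverse of the sample matrix modulo `5`. -/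
def inverseRows : List (List ℕ) :=
  [[3, 2, 4, 3, 2, 0, 0, 3, 0, 0, 4, 1, 3, 1, 2, 4, 2, 0, 2, 3],
    [1, 3, 3, 3, 0, 3, 3, 1, 1, 2, 0, 2, 1, 3, 1, 2, 2, 0, 4, 2],
    [0, 0, 0, 0, 0, 0, 0, 0, 0, 0, 0, 0, 4, 0, 4, 0, 0, 0, 0, 0],
    [4, 2, 2, 1, 4, 1, 3, 4, 0, 1, 2, 3, 1, 0, 0, 1, 1, 3, 0, 1],
    [4, 4, 2, 4, 4, 3, 2, 0, 2, 1, 4, 1, 4, 1, 0, 2, 1, 4, 2, 2],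
    [0, 0, 0, 0, 0, 0, 0, 0, 0, 0, 3, 4, 3, 0, 3, 1, 3, 0, 0, 0],
    [2, 4, 3, 4, 2, 0, 4, 4, 3, 0, 3, 2, 1, 1, 2, 0, 0, 3, 0, 4],
    [1, 2, 3, 0, 3, 0, 0, 2, 2, 1, 0, 2, 3, 4, 0, 1, 3, 4, 2, 0],
    [1, 3, 0, 1, 3, 2, 3, 4, 3, 1, 1, 2, 2, 1, 3, 4, 2, 4, 2, 2],
    [4, 1, 1, 4, 0, 3, 0, 1, 3, 3, 3, 1, 1, 3, 2, 1, 1, 3, 0, 1],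
    [4, 1, 3, 3, 0, 4, 2, 0, 0, 0, 2, 0, 0, 4, 0, 0, 2, 0, 1, 1],
    [0, 0, 0, 0, 0, 0, 0, 0, 0, 0, 3, 4, 3, 0, 3, 3, 4, 0, 0, 0],
    [0, 1, 1, 3, 2, 1, 0, 2, 0, 1, 4, 1, 4, 1, 0, 4, 2, 4, 2, 2],
    [3, 4, 4, 4, 0, 4, 4, 3, 3, 1, 4, 3, 3, 4, 1, 3, 2, 0, 2, 1],
    [0, 0, 0, 2, 3, 4, 0, 3, 3, 0, 3, 2, 1, 4, 0, 4, 1, 1, 1, 0],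
    [1, 3, 0, 3, 4, 1, 2, 3, 0, 3, 1, 0, 1, 3, 1, 3, 0, 3, 4, 0],
    [3, 4, 3, 4, 2, 0, 4, 4, 1, 0, 1, 4, 3, 4, 2, 4, 3, 4, 0, 3],
    [4, 2, 0, 3, 1, 4, 0, 0, 1, 4, 1, 1, 1, 3, 4, 2, 1, 3, 3, 4],
    [3, 3, 1, 1, 2, 0, 2, 1, 3, 0, 3, 4, 2, 1, 2, 2, 4, 2, 1, 3],
    [0, 3, 3, 4, 4, 3, 1, 3, 2, 4, 1, 3, 3, 3, 1, 4, 4, 0, 0, 2]]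

/-- The rows in `inverseRows` as a matrix. -/
noncomputable def inverseMod : Matrix (Fin 20) (Fin 20) ℤ := Matrix.of fun i k =>
  nth (inverseRows.getD i []) k

theorem inverseMod_mul : ∀ i k : Fin 20, (((List.finRange 20).map fun j =>
    inverseMod i j * sampleMatrix j k).sum - if i = k then 1 else 0) % 5 = 0 := by
  decide +kernel

theorem det_sampleMatrix_ne_zero : sampleMatrix.det ≠ 0 := by
  intro h
  have h1 : (inverseMod.map (Int.castRingHom (ZMod 5))) * sampleMatrix.map (Int.castRingHom (ZMod 5)) =
      1 := by
    ext i k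
    have h2 := inverseMod_mul i k
    rw [← Fin.sum_univ_def, ← Int.dvd_iff_emod_eq_zero] at h2
    have h3 := (ZMod.intCast_zmod_eq_zero_iff_dvd _ 5).2 (by exact_mod_cast h2)
    rw [Int.cast_sub, sub_eq_zero, Int.cast_sum] at h3
    rw [Matrix.mul_apply, Matrix.one_apply]
    simpa using h3
  have h2 := congrArg Matrix.det h1
  rw [Matrix.det_mul, Matrix.det_one, ← RingHom.mapMatrix_apply, ← RingHom.mapMatrix_apply,
    ← RingHom.map_det, ← RingHom.map_det, h, map_zero, mul_zero] at h2
  exact absurd h2 (by decide)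

theorem basis_isAdmissible : ∀ k, IsAdmissible (basis k) := by
  decide +kernel

theorem sampleMatrix_eq (i k : Fin 20) : (sampleMatrix i k : ℝ) =
    φ (basis k) (sampleData (i.val / 3)) (Fin.ofNat 3 i.val) 0 := by
  have h := eval_formula_eq (isJet_sampleJet (i.val / 3)) isSignedPerms_three 1
    (basis_isAdmissible k).1 (basis_isAdmissible k).2 (Fin.ofNat 3 i.val) [] 1
  rw [eval_natCast] at h
  refine h.trans ?_
  rw [Int.cast_one, one_mul]
  rfl

theorem linearIndependent_basis : LinearIndependent ℝ fun k => φ (basis k) := by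
  rw [Fintype.linearIndependent_iff]
  intro g hg
  have hdet : (sampleMatrix.map (Int.castRingHom ℝ)).det ≠ 0 := by
    rw [← RingHom.mapMatrix_apply, ← RingHom.map_det]
    exact Int.cast_ne_zero.2 det_sampleMatrix_ne_zero
  refine congrFun (Matrix.eq_zero_of_mulVec_eq_zero hdet ?_)
  funext i
  have h := congrFun (congrFun (congrFun hg (sampleData (i.val / 3))) (Fin.ofNat 3 i.val)) 0
  simp only [Finset.sum_apply, Pi.smul_apply, smul_eq_mul, ← sampleMatrix_eq] at h
  change ∑ k, (sampleMatrix i k : ℝ) * g k = 0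
  simp only [mul_comm (sampleMatrix i _ : ℝ)]
  exact h

end Independence

theorem φ_dependent_mem_span (i : Fin 15) :
    φ (dependent i).1 ∈ Submodule.span ℝ (Set.range fun k => φ (basis k)) := by
  have h : φ (dependent i).1 = (1 / 2 : ℝ) • ∑ k, (coefficient (dependent i).2 k : ℝ) • φ (basis k) := by
    rw [← two_smul_φ_dependent, smul_smul]
    norm_num
  rw [h]
  exact Submodule.smul_mem _ _ (Submodule.sum_mem _ fun k _ =>
    Submodule.smul_mem _ _ (Submodule.subset_span ⟨k, rfl⟩))

theorem φ_dependent_ne_zero (i : Fin 15) : φ (dependent i).1 ≠ 0 := fun h => by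
  have h1 := two_smul_φ_dependent i
  rw [h, smul_zero] at h1
  obtain ⟨-, -, ⟨k, hk⟩, -⟩ := dependent_relations i
  exact hk (by exact_mod_cast Fintype.linearIndependent_iff.1 linearIndependent_basis _ h1.symm k)

/-! ### Enumeration of the sunflower micro-graphs -/

section Sunflower

theorem wellFormed_iff {n : ℕ} (H : MicroGraph n) : WellFormed H ↔
    (∀ (s : Fin 3) (l : Fin n), (H s l.succ.succ).val = 3 * (l + 1) + s + 1) ∧
      ∀ s, (List.ofFn fun e => (H s e).val).Nodup := by
  simp only [WellFormed, List.nodup_ofFn, casimir, Fin.ext_iff]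
  refine and_congr_right fun _ => forall_congr' fun s => ?_
  exact (Fin.val_injective.of_comp_iff (H s)).symm

/-- The vertices to which an edge to a source may go are those with the same number modulo three,
except the sink. -/
theorem redirects_iff (n : ℕ) (v : Vertex 0) (t : Vertex n) :
    Redirects n v t ↔ (v.val = 0 ↔ t.val = 0) ∧ t.val % 3 = v.val % 3 := by
  constructor
  · rintro (⟨rfl, rfl⟩ | ⟨s, rfl, rfl | ⟨l, rfl⟩⟩)
    · simp
    · simp [source]
    · simp only [source, casimir]
      omega
  · rintro ⟨h0, h3⟩
    have hv := v.isLt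
    have ht := t.isLt
    by_cases hv0 : v.val = 0
    · exact Or.inl ⟨Fin.ext hv0, Fin.ext (h0.1 hv0)⟩
    · refine Or.inr ⟨⟨v.val - 1, by omega⟩, Fin.ext (by simp only [source]; omega), ?_⟩
      by_cases hs : t.val = v.val
      · exact Or.inl (Fin.ext (by simp only [source]; omega))
      · refine Or.inr ⟨⟨(t.val - 1) / 3 - 1, by omega⟩, Fin.ext ?_⟩
        simp only [casimir]
        omega

theorem redirects₃₄_iff (v : Vertex 1) (t : Vertex 2) :
    Redirects₃₄ v t ↔ t.val = v.val ∨ 4 ≤ v.val ∧ t.val = v.val + 3 := by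
  refine or_congr_right ⟨?_, fun ⟨hv, ht⟩ => ⟨⟨v.val - 4, by omega⟩, Fin.ext ?_, Fin.ext ?_⟩⟩
  · rintro ⟨s, rfl, rfl⟩
    simp only [casimir]
    omega
  · simp only [casimir]; simp; omega
  · simp only [casimir]; simp; omega

instance {n : ℕ} (H : MicroGraph n) : Decidable (WellFormed H) :=
  decidable_of_iff' _ (wellFormed_iff H)

instance (n : ℕ) (v : Vertex 0) (t : Vertex n) : Decidable (Redirects n v t) :=
  decidable_of_iff' _ (redirects_iff n v t)

instance (v : Vertex 1) (t : Vertex 2) : Decidable (Redirects₃₄ v t) :=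
  decidable_of_iff' _ (redirects₃₄_iff v t)

instance {n : ℕ} (K : MicroGraph 0) (H : MicroGraph n) : Decidable (IsDescendant K H) :=
  inferInstanceAs (Decidable (_ ∧ _))

instance (G : MicroGraph 1) (H : MicroGraph 2) : Decidable (IsDescendant₃₄ G H) :=
  inferInstanceAs (Decidable (_ ∧ _))

instance (n : ℕ) : DecidablePred (· ∈ sunflower n) := fun H =>
  inferInstanceAs (Decidable (IsDescendant sunflowerΓ₁ H ∨ IsDescendant sunflowerΓ₂ H))

/-- The targets of all edges, read as the digits of a number. -/
def code {n : ℕ} (G : MicroGraph n) : ℕ :=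
  ((List.ofFn fun s => List.ofFn fun e => (G s e).val).flatten).foldr
    (fun a c => a + (3 * n + 4) * c) 0

theorem foldr_digits_injective {b : ℕ} : ∀ {k l : List ℕ}, k.length = l.length →
    (∀ a ∈ k, a < b) → (∀ a ∈ l, a < b) →
    k.foldr (fun a c => a + b * c) 0 = l.foldr (fun a c => a + b * c) 0 → k = l
  | [], [], _, _, _, _ => rfl
  | a :: k, a' :: l, h, hk, hl, he => by
    have ha := hk a (by simp)
    have ha' := hl a' (by simp)
    simp only [List.foldr_cons] at he
    have h1 := congrArg (· % b) he
    simp only [Nat.add_mul_mod_self_left, Nat.mod_eq_of_lt ha, Nat.mod_eq_of_lt ha'] at h1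
    subst h1
    have h2 := Nat.eq_of_mul_eq_mul_left (by omega) (Nat.add_left_cancel he)
    rw [foldr_digits_injective (by simpa using h) (fun a h => hk a (by simp [h]))
      (fun a h => hl a (by simp [h])) h2]

theorem code_injective {n : ℕ} : Function.Injective (code (n := n)) := by
  intro G G' h
  have hlt : ∀ G : MicroGraph n, ∀ a ∈ (List.ofFn fun s => List.ofFn fun e => (G s e).val).flatten,
      a < 3 * n + 4 := by
    intro G a ha
    simp only [List.mem_flatten, List.mem_ofFn] at ha
    obtain ⟨_, ⟨s, rfl⟩, ha⟩ := ha
    obtain ⟨e, rfl⟩ := List.mem_ofFn.1 ha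
    exact (G s e).isLt
  have h1 := foldr_digits_injective (by simp) (hlt G) (hlt G') h
  have h2 := List.eq_iff_flatten_eq.2 ⟨h1, by simp⟩
  funext s e
  exact Fin.ext (congrFun (List.ofFn_injective (congrFun (List.ofFn_injective h2) s)) e)

instance (n : ℕ) : DecidableEq (MicroGraph n) := fun _ _ => decidable_of_iff _ code_injective.eq_iff

/-- The sunflower micro-graphs over dimension three. -/
def sunflowerList : List (MicroGraph 1) :=
  List.ofFn vanishing ++ List.ofFn basis ++ List.ofFn fun i => (dependent i).1
/-- All well-formed choices of the redirected edges are listed; with `x = 4` the first source would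
have two edges to `4`. -/
theorem sunflowerList_complete : ∀ x ∈ ([1, 4, 2, 5] : List (Vertex 1)),
    ∀ y ∈ ([1, 4] : List (Vertex 1)), ∀ z ∈ ([3, 6] : List (Vertex 1)),
    ∀ u ∈ ([1, 4] : List (Vertex 1)), ∀ w ∈ ([2, 5] : List (Vertex 1)), x = 4 ∨
      (![![0, x, 4], ![y, z, 5], ![u, w, 6]] : MicroGraph 1) ∈ sunflowerList := by
  decide +kernel

theorem mem_sunflowerList {G : MicroGraph 1} (hG : G ∈ sunflower 1) : G ∈ sunflowerList := by
  have h0 : ∀ t : Vertex 1, Redirects 1 0 t → t = 0 := by decide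
  have h1 : ∀ t : Vertex 1, Redirects 1 1 t → t ∈ ([1, 4] : List (Vertex 1)) := by decide
  have h2 : ∀ t : Vertex 1, Redirects 1 2 t → t ∈ ([2, 5] : List (Vertex 1)) := by decide
  have h3 : ∀ t : Vertex 1, Redirects 1 3 t → t ∈ ([3, 6] : List (Vertex 1)) := by decide
  have h12 : ∀ t : Vertex 1, Redirects 1 1 t ∨ Redirects 1 2 t →
      t ∈ ([1, 4, 2, 5] : List (Vertex 1)) := by decide
  have hr : ((∀ s, G s 2 = casimir 0 s) ∧ ∀ s, Function.Injective (G s)) ∧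
      Redirects 1 0 (G 0 0) ∧ (Redirects 1 1 (G 0 1) ∨ Redirects 1 2 (G 0 1)) ∧
      Redirects 1 1 (G 1 0) ∧ Redirects 1 3 (G 1 1) ∧ Redirects 1 1 (G 2 0) ∧
      Redirects 1 2 (G 2 1) := by
    rcases hG with ⟨hw, h⟩ | ⟨hw, h⟩
    · exact ⟨⟨fun s => hw.1 s 0, hw.2⟩, (h 0).1, Or.inl (h 0).2, (h 1).1, (h 1).2, (h 2).1, (h 2).2⟩
    · exact ⟨⟨fun s => hw.1 s 0, hw.2⟩, (h 0).1, Or.inr (h 0).2, (h 1).1, (h 1).2, (h 2).1, (h 2).2⟩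
  obtain ⟨⟨hc, hi⟩, g00, g01, g10, g11, g20, g21⟩ := hr
  have hG' : G = ![![0, G 0 1, 4], ![G 1 0, G 1 1, 5], ![G 2 0, G 2 1, 6]] := by
    funext s e
    fin_cases s <;> fin_cases e
    all_goals first | rfl | exact hc _ | exact h0 _ g00
  rw [hG']
  refine (sunflowerList_complete _ (h12 _ g01) _ (h1 _ g10) _ (h3 _ g11) _ (h1 _ g20) _
    (h2 _ g21)).resolve_left fun h4 => ?_
  have : G 0 1 = G 0 2 := h4.trans (hc 0).symm
  exact absurd (hi 0 this) (by decide)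

theorem mem_sunflower_cases {G : MicroGraph 1} (hG : G ∈ sunflower 1) :
    (∃ k, vanishing k = G) ∨ (∃ k, basis k = G) ∨ ∃ i, (dependent i).1 = G := by
  have := mem_sunflowerList hG
  simpa only [sunflowerList, List.mem_append, List.mem_ofFn, or_assoc, Set.mem_range] using this

theorem vanishing_mem_sunflower : ∀ k, vanishing k ∈ sunflower 1 := by decide +kernel

theorem basis_mem_sunflower : ∀ k, basis k ∈ sunflower 1 := by decide +kernel

theorem dependent_mem_sunflower : ∀ i, (dependent i).1 ∈ sunflower 1 := by decide +kernel

theorem eq_zero_of_target_eq_zero {G : MicroGraph 1} (hG : G ∈ sunflower 1) {s e : Fin 3}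
    (h : G s e = 0) : s = 0 := by
  have h₁ : ∀ k s e, vanishing k s e = 0 → s = 0 := by decide +kernel
  have h₂ : ∀ k s e, basis k s e = 0 → s = 0 := by decide +kernel
  have h₃ : ∀ i s e, (dependent i).1 s e = 0 → s = 0 := by decide +kernel
  rcases mem_sunflower_cases hG with ⟨k, rfl⟩ | ⟨k, rfl⟩ | ⟨i, rfl⟩
  · exact h₁ k s e h
  · exact h₂ k s e h
  · exact h₃ i s e h

theorem vanishing_eq : {G ∈ sunflower 1 | φ G = 0} = Set.range vanishing := by
  ext G
  refine ⟨fun ⟨hG, h0⟩ => ?_, ?_⟩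
  · rcases mem_sunflower_cases hG with ⟨k, rfl⟩ | ⟨k, rfl⟩ | ⟨i, rfl⟩
    · exact ⟨k, rfl⟩
    · exact absurd h0 (linearIndependent_basis.ne_zero k)
    · exact absurd h0 (φ_dependent_ne_zero i)
  · rintro ⟨k, rfl⟩
    exact ⟨vanishing_mem_sunflower k, φ_vanishing k⟩

theorem span_basis : Submodule.span ℝ (Set.range fun k => φ (basis k)) =
    Submodule.span ℝ (φ '' sunflower 1) := by
  refine le_antisymm (Submodule.span_mono ?_) (Submodule.span_le.2 ?_)
  · rintro _ ⟨k, rfl⟩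
    exact ⟨basis k, basis_mem_sunflower k, rfl⟩
  · rintro _ ⟨G, hG, rfl⟩
    rcases mem_sunflower_cases hG with ⟨k, rfl⟩ | ⟨k, rfl⟩ | ⟨i, rfl⟩
    · rw [φ_vanishing]
      exact Submodule.zero_mem _
    · exact Submodule.subset_span ⟨k, rfl⟩
    · exact φ_dependent_mem_span i

theorem extra_properties : ∀ G ∈ ({extra₁, extra₂} : Set (MicroGraph 1)), G ∈ sunflower 1 ∧ φ G ≠ 0 ∧
    G ∉ Set.range basis ∧ φ G ∈ Submodule.span ℝ (Set.range fun k => φ (basis k)) := by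
  have h : ∀ i ∈ ([10, 14] : List (Fin 15)), ∀ k, basis k ≠ (dependent i).1 := by decide +kernel
  have h1 : extra₁ = (dependent 10).1 := rfl
  have h2 : extra₂ = (dependent 14).1 := rfl
  rintro G (rfl | rfl)
  · rw [h1]
    exact ⟨dependent_mem_sunflower _, φ_dependent_ne_zero _, fun ⟨k, hk⟩ => h 10 (by simp) k hk,
      φ_dependent_mem_span _⟩
  · rw [h2]
    exact ⟨dependent_mem_sunflower _, φ_dependent_ne_zero _, fun ⟨k, hk⟩ => h 14 (by simp) k hk,
      φ_dependent_mem_span _⟩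

theorem sink_target {n : ℕ} {H : MicroGraph n} (hH : H ∈ sunflower n) : H 0 0 = 0 := by
  have h : Redirects n 0 (H 0 0) := hH.elim (fun h => (h.2 0).1) fun h => (h.2 0).1
  exact Fin.ext (((redirects_iff n 0 _).1 h).1.1 rfl)

theorem occurring_subset : occurring ⊆ sunflower 2 := by
  have h : ∀ q ∈ knownTerms, q.2 ∈ sunflower 2 ∧ swapCasimirs q.2 ∈ sunflower 2 := by
    decide +kernel
  rintro H ⟨q, hq, rfl | rfl⟩
  · exact (h q hq).1
  · exact (h q hq).2

end Sunflower

/-! ### The parents of the micro-graphs of the known solution -/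

section Parents

/-- The vertex of a 3D micro-graph from which an edge to a vertex of a 4D-descendant may stem: the
copies of the two Casimirs are identified. -/
def collapseVertex (t : Vertex 2) : Vertex 1 :=
  (![0, 1, 2, 3, 4, 5, 6, 4, 5, 6] : Fin 10 → Fin 7) t

/-- The only possible 3D parent of a 4D micro-graph. -/
def collapse (H : MicroGraph 2) : MicroGraph 1 := fun s =>
  ![collapseVertex (H s 0), collapseVertex (H s 1), casimir 0 s]

theorem eq_collapse {G : MicroGraph 1} {H : MicroGraph 2} (hG : G ∈ sunflower 1)
    (h : IsDescendant₃₄ G H) : G = collapse H := by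
  have hr : ∀ v t, Redirects₃₄ v t → v = collapseVertex t := by decide +kernel
  have hw : WellFormed G := by
    rcases hG with hG | hG
    · exact hG.1
    · exact hG.1
  funext s e
  fin_cases e
  · exact hr _ _ (h.2 s).1
  · exact hr _ _ (h.2 s).2
  · exact hw.1 s 0

/-- The seventeen parents. -/
def parents : List (MicroGraph 1) :=
  [9, 6, 12].map vanishing ++ [0, 3, 5, 6, 7, 8, 9, 13, 14, 15, 16, 19].map basis ++
    [extra₁, extra₂]

theorem parents_nodup : parents.Nodup := by decide +kernel

theorem parents_subset : ∀ G ∈ parents, G ∈ sunflower 1 := by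
  intro G hG
  simp only [parents, List.mem_append, List.mem_map, or_assoc] at hG
  rcases hG with ⟨k, -, rfl⟩ | ⟨k, -, rfl⟩ | hG
  · exact vanishing_mem_sunflower k
  · exact basis_mem_sunflower k
  · exact (extra_properties G (by simpa using hG)).1

theorem ncard_parents : {G | G ∈ parents}.ncard = 17 := by
  have : {G | G ∈ parents} = (parents.toFinset : Set (MicroGraph 1)) := by ext; simp
  rw [this, Set.ncard_coe_finset, List.toFinset_card_of_nodup parents_nodup]
  rfl

theorem collapse_mem_parents : ∀ q ∈ knownTerms,
    (collapse q.2 ∈ parents ∧ IsDescendant₃₄ (collapse q.2) q.2) ∧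
      collapse (swapCasimirs q.2) ∈ parents ∧
      IsDescendant₃₄ (collapse (swapCasimirs q.2)) (swapCasimirs q.2) := by
  decide +kernel

/-- The micro-graph in the `i`-th term of the known solution. -/
def knownGraph (i : Fin 27) : MicroGraph 2 := (knownTerms.get i).2

/-- Micro-graphs that occur in the known solution and have the seventeen different parents. -/
def representatives : List (MicroGraph 2) :=
  swapCasimirs (knownGraph 15) ::
    ([20, 25, 0, 1, 2, 3, 7, 8, 11, 12, 13, 16, 18, 24, 19, 21] : List (Fin 27)).map knownGraph

theorem representatives_occur : ∀ H ∈ representatives, H ∈ occurring := by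
  intro H hH
  rcases List.mem_cons.1 hH with rfl | hH
  · exact ⟨_, List.get_mem knownTerms _, Or.inr rfl⟩
  · obtain ⟨i, -, rfl⟩ := List.mem_map.1 hH
    exact ⟨_, List.get_mem knownTerms _, Or.inl rfl⟩

theorem map_collapse_representatives : representatives.map collapse = parents := by decide +kernel

theorem exists_representative (G) (hG : G ∈ parents) : ∃ H ∈ representatives, collapse H = G :=
  List.mem_map.1 (map_collapse_representatives ▸ hG)

theorem isLeast_parents : IsLeast {A : Set (MicroGraph 1) | A ⊆ sunflower 1 ∧
    occurring ⊆ descendants₃₄ A} {G | G ∈ parents} := by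
  refine ⟨⟨parents_subset, ?_⟩, ?_⟩
  · rintro H ⟨q, hq, rfl | rfl⟩
    · exact ⟨_, (collapse_mem_parents q hq).1⟩
    · exact ⟨_, (collapse_mem_parents q hq).2⟩
  · rintro A ⟨hA, hocc⟩ G hG
    obtain ⟨H, hH, rfl⟩ := exists_representative G hG
    obtain ⟨G', hG', hd⟩ := hocc (representatives_occur H hH)
    rw [← eq_collapse (hA hG') hd]
    exact hG'

/-- The permutations of the three sources. -/
def perms₃ : List (Fin 3 → Fin 3) :=
  [![0, 1, 2], ![0, 2, 1], ![1, 0, 2], ![1, 2, 0], ![2, 0, 1], ![2, 1, 0]]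

/-- The permutations of the three sources that fix the source of the edge to the sink. -/
def permsFixing : List (Fin 3 → Fin 3) := [![0, 1, 2], ![0, 2, 1]]

theorem coe_mem_permsFixing : ∀ σ : Equiv.Perm (Fin 3), σ 0 = 0 → (σ : Fin 3 → Fin 3) ∈ permsFixing := by
  decide +kernel

theorem coe_mem_perms₃ : ∀ σ : Equiv.Perm (Fin 3), (σ : Fin 3 → Fin 3) ∈ perms₃ := by decide +kernel

/-- The collapse of a vertex after a relabelling by permutations of the sources and of the copies of
the Casimirs. -/
def relabel (b g₀ g₁ : Fin 3 → Fin 3) (t : Vertex 2) : Vertex 1 :=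
  (![0, source 1 (b 0), source 1 (b 1), source 1 (b 2), casimir 0 (g₀ 0), casimir 0 (g₀ 1),
    casimir 0 (g₀ 2), casimir 0 (g₁ 0), casimir 0 (g₁ 1), casimir 0 (g₁ 2)] : Fin 10 → Vertex 1) t

theorem vertex_cases : ∀ t : Vertex 2, t = 0 ∨ (∃ s, t = source 2 s) ∨ (∃ s, t = casimir 0 s) ∨
    ∃ s, t = casimir 1 s := by decide

theorem collapseVertex_zero : collapseVertex 0 = 0 := rfl

theorem relabel_zero (b g₀ g₁ : Fin 3 → Fin 3) : relabel b g₀ g₁ 0 = 0 := rfl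

theorem relabel_source (b g₀ g₁ : Fin 3 → Fin 3) (s : Fin 3) :
    relabel b g₀ g₁ (source 2 s) = source 1 (b s) := by fin_cases s <;> rfl

theorem relabel_casimir_zero (b g₀ g₁ : Fin 3 → Fin 3) (s : Fin 3) :
    relabel b g₀ g₁ (casimir 0 s) = casimir 0 (g₀ s) := by fin_cases s <;> rfl

theorem relabel_casimir_one (b g₀ g₁ : Fin 3 → Fin 3) (s : Fin 3) :
    relabel b g₀ g₁ (casimir 1 s) = casimir 0 (g₁ s) := by fin_cases s <;> rfl

/-- The set of the elements of a list of vertices, as a bit mask. -/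
def mask (l : List (Vertex 1)) : ℕ := l.foldr (fun a m => 1 <<< a.val ||| m) 0

theorem testBit_mask (i : ℕ) : ∀ l : List (Vertex 1), (mask l).testBit i = true ↔ ∃ a ∈ l, a.val = i
  | [] => by simp [mask]
  | a :: l => by
    have : mask (a :: l) = 1 <<< a.val ||| mask l := rfl
    simp [this, Nat.testBit_or, Nat.one_shiftLeft, Nat.testBit_two_pow, testBit_mask i l]

theorem mask_congr {k l : List (Vertex 1)} (h : ∀ a, a ∈ k ↔ a ∈ l) : mask k = mask l := by
  refine Nat.eq_of_testBit_eq fun i => Bool.eq_iff_iff.2 ?_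
  simp only [testBit_mask, h]

/-- The set of the targets of a source of a 3D micro-graph. -/
def rowMask (r : Fin 3 → Vertex 1) : ℕ := mask (List.ofFn r)

/-- The set of the targets of a source of a 4D micro-graph, relabelled and collapsed. -/
def relabelledMask (b g₀ g₁ : Fin 3 → Fin 3) (H : MicroGraph 2) (s : Fin 3) : ℕ :=
  mask (List.ofFn fun e => relabel b g₀ g₁ (H s e))

theorem rowMask_eq_of_isomorphic {G : MicroGraph 1} {H H' : MicroGraph 2} (hG : G ∈ sunflower 1)
    (hd : IsDescendant₃₄ G H') (hz : H 0 0 = 0) (h : Isomorphic H H') :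
    ∃ β : Equiv.Perm (Fin 3), β 0 = 0 ∧ ∃ g₀ ∈ perms₃, ∃ g₁ ∈ perms₃,
      ∀ s, rowMask (G (β s)) = relabelledMask β g₀ g₁ H s := by
  obtain ⟨α, β, γ, h0, hs, hc, hr⟩ := h
  have hcc : ∀ l s, collapseVertex (casimir l s) = casimir 0 s := by decide
  have hα : ∀ t, relabel β (γ 0) (γ 1) t = collapseVertex (α t) := by
    have hsc : ∀ s, collapseVertex (source 2 s) = source 1 s := by decide
    intro t
    rcases vertex_cases t with rfl | ⟨s, rfl⟩ | ⟨s, rfl⟩ | ⟨s, rfl⟩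
    · rw [h0, relabel_zero, collapseVertex_zero]
    · rw [hs, hsc, relabel_source]
    · rw [hc, hcc, relabel_casimir_zero]
    · rw [hc, hcc, relabel_casimir_one]
  -- The rows of `G` are the collapses of the rows of `H'`, as sets.
  have hrow : ∀ s a, (∃ e, G s e = a) ↔ ∃ e, collapseVertex (H' s e) = a := by
    intro s a
    have h2 : collapseVertex (H' s 2) = casimir 0 s := by
      rw [show H' s 2 = casimir 0 s from hd.1.1 s 0, hcc]
    have h3 : collapseVertex (H' s 3) = casimir 0 s := by
      rw [show H' s 3 = casimir 1 s from hd.1.1 s 1, hcc]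
    rw [eq_collapse hG hd, Fin.exists_fin_succ, Fin.exists_fin_succ, Fin.exists_fin_one,
      Fin.exists_fin_succ, Fin.exists_fin_succ, Fin.exists_fin_two]
    change (_ = a ∨ _ = a ∨ casimir 0 s = a) ↔
      (_ = a ∨ _ = a ∨ collapseVertex (H' s 2) = a ∨ collapseVertex (H' s 3) = a)
    rw [h2, h3, or_self]
    rfl
  refine ⟨β, ?_, γ 0, coe_mem_perms₃ _, γ 1, coe_mem_perms₃ _, ?_⟩
  · obtain ⟨e, he⟩ := (hr 0 0).1 ⟨0, hz⟩
    obtain ⟨e', he'⟩ := (hrow (β 0) 0).2 ⟨e, by rw [he, h0, collapseVertex_zero]⟩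
    exact eq_zero_of_target_eq_zero hG he'
  intro s
  refine mask_congr fun a => ?_
  simp only [List.mem_ofFn, hα, hrow]
  constructor
  · rintro ⟨e, rfl⟩
    obtain ⟨e', he'⟩ := (hr s (α.symm (H' (β s) e))).2 ⟨e, (α.apply_symm_apply _).symm⟩
    exact ⟨e', by rw [he', α.apply_symm_apply]⟩
  · rintro ⟨e, rfl⟩
    obtain ⟨e', he'⟩ := (hr s (H s e)).1 ⟨e, rfl⟩
    exact ⟨e', by rw [he']⟩

/-- Replaces two sunflower micro-graphs by parents of the known solution that have isomorphic
4D-descendants. -/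
def merge (G : MicroGraph 1) : MicroGraph 1 :=
  if G = ![![0, 1, 4], ![4, 3, 5], ![1, 5, 6]] then basis 3
  else if G = ![![0, 1, 4], ![4, 3, 5], ![4, 5, 6]] then basis 6 else G

/-- The value of a function at a number; in the kernel, the number is evaluated first. -/
noncomputable def withValue (n : ℕ) (f : ℕ → Bool) : Bool := Nat.rec (f 0) (fun k _ => f (k + 1)) n

theorem withValue_eq (n : ℕ) (f : ℕ → Bool) : withValue n f = f n := by cases n <;> rfl

/-- The sets of the targets of the three sources, as one number. -/
def key (G : MicroGraph 1) : ℕ := rowMask (G 0) + rowMask (G 1) <<< 7 + rowMask (G 2) <<< 14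

/-- The number that `key` assigns to the collapse of a micro-graph isomorphic to `H`. -/
def relabelledKey (b g₀ g₁ : Fin 3 → Fin 3) (H : MicroGraph 2) : ℕ :=
  relabelledMask b g₀ g₁ H 0 <<< (7 * (b 0).val) + relabelledMask b g₀ g₁ H 1 <<< (7 * (b 1).val) +
    relabelledMask b g₀ g₁ H 2 <<< (7 * (b 2).val)

theorem key_eq_of_isomorphic {G : MicroGraph 1} {H H' : MicroGraph 2} (hG : G ∈ sunflower 1)
    (hd : IsDescendant₃₄ G H') (hz : H 0 0 = 0) (h : Isomorphic H H') :
    ∃ b ∈ permsFixing, ∃ g₀ ∈ perms₃, ∃ g₁ ∈ perms₃, key G = relabelledKey b g₀ g₁ H := by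
  obtain ⟨β, hβ, g₀, h₀, g₁, h₁, hm⟩ := rowMask_eq_of_isomorphic hG hd hz h
  refine ⟨β, coe_mem_permsFixing β hβ, g₀, h₀, g₁, h₁, ?_⟩
  have := Equiv.sum_comp β fun s => rowMask (G s) <<< (7 * s.val)
  simp only [Fin.sum_univ_three, hm] at this
  exact this.symm

/-- The value of a function at the list of the keys and the numbers of the merged micro-graphs. -/
noncomputable def withKeys : List (MicroGraph 1) → (List (ℕ × ℕ) → Bool) → Bool
  | [], f => f []
  | G :: l, f => withValue (key G) fun k => withValue (code (merge G)) fun c =>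
      withKeys l fun t => f ((k, c) :: t)

theorem withKeys_eq : ∀ (l : List (MicroGraph 1)) (f : List (ℕ × ℕ) → Bool),
    withKeys l f = f (l.map fun G => (key G, code (merge G)))
  | [], _ => rfl
  | G :: l, f => by simp only [withKeys, withValue_eq, withKeys_eq l, List.map_cons]

/-- A check for all sunflower micro-graphs `G`, representatives `H` and relabellings: if the keys are
equal, then `merge G = collapse H`. -/
noncomputable def mergeCheck : Bool :=
  withKeys sunflowerList fun t =>
    representatives.all fun H => withValue (code (collapse H)) fun c =>
      permsFixing.all fun b => perms₃.all fun g₀ => perms₃.all fun g₁ =>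
        withValue (relabelledKey b g₀ g₁ H) fun k =>
          t.all fun p => !Nat.beq p.1 k || Nat.beq p.2 c

theorem mergeCheck_eq_true : mergeCheck = true := by decide +kernel

theorem merge_eq_collapse {G : MicroGraph 1} {H H' : MicroGraph 2} (hG : G ∈ sunflower 1)
    (hH : H ∈ representatives) (hd : IsDescendant₃₄ G H') (h : Isomorphic H H') :
    merge G = collapse H := by
  obtain ⟨b, hb, g₀, h₀, g₁, h₁, hk⟩ := key_eq_of_isomorphic hG hd (sink_target (occurring_subset (representatives_occur H hH))) h
  have hc := mergeCheck_eq_true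
  simp only [mergeCheck, withKeys_eq, withValue_eq, List.all_eq_true] at hc
  have := hc H hH b hb g₀ h₀ g₁ h₁ _ (List.mem_map_of_mem (mem_sunflowerList hG))
  simp only [hk, Nat.beq_refl, Bool.not_true, Bool.false_or] at this
  exact code_injective (Nat.eq_of_beq_eq_true this)

theorem seventeen_le_ncard {A : Set (MicroGraph 1)} (hA : A ⊆ sunflower 1)
    (h : ∀ H ∈ occurring, ∃ H' ∈ descendants₃₄ A, Isomorphic H H') : 17 ≤ A.ncard := by
  have hsub : {G | G ∈ parents} ⊆ merge '' A := by
    intro G hG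
    obtain ⟨H, hH, rfl⟩ := exists_representative G hG
    obtain ⟨H', ⟨G', hG', hd⟩, hi⟩ := h H (representatives_occur H hH)
    exact ⟨G', hG', merge_eq_collapse (hA hG') hH hd hi⟩
  calc 17 = {G | G ∈ parents}.ncard := ncard_parents.symm
    _ ≤ (merge '' A).ncard := Set.ncard_le_ncard hsub (Set.toFinite _)
    _ ≤ A.ncard := Set.ncard_image_le (Set.toFinite _)

end Parents

/-! ### The parents in the two lists -/

section Lists

theorem vanishing_injective : Function.Injective vanishing := by
  have h : ∀ ⦃i j⦄, vanishing i = vanishing j → i = j := by decide +kernel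
  exact @h

theorem basis_injective : Function.Injective basis := fun _ _ h =>
  linearIndependent_basis.injective (congrArg φ h)

theorem parents_inter_vanishing :
    {G | G ∈ parents} ∩ Set.range vanishing = vanishing '' {6, 9, 12} := by
  have h : ∀ k, vanishing k ∈ parents ↔ k ∈ ([6, 9, 12] : List (Fin 13)) := by decide +kernel
  ext G
  constructor
  · rintro ⟨hG, k, rfl⟩
    exact ⟨k, by simpa using (h k).1 hG, rfl⟩
  · rintro ⟨k, hk, rfl⟩
    exact ⟨(h k).2 (by simpa using hk), k, rfl⟩

theorem parents_inter_basis : {G | G ∈ parents} ∩ Set.range basis =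
    basis '' {0, 3, 5, 6, 7, 8, 9, 13, 14, 15, 16, 19} := by
  have h : ∀ k, basis k ∈ parents ↔
      k ∈ ([0, 3, 5, 6, 7, 8, 9, 13, 14, 15, 16, 19] : List (Fin 20)) := by decide +kernel
  ext G
  constructor
  · rintro ⟨hG, k, rfl⟩
    exact ⟨k, by simpa using (h k).1 hG, rfl⟩
  · rintro ⟨k, hk, rfl⟩
    exact ⟨(h k).2 (by simpa using hk), k, rfl⟩

theorem parents_diff : {G | G ∈ parents} \ (Set.range vanishing ∪ Set.range basis) =
    {extra₁, extra₂} := by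
  have h : ∀ G ∈ parents, (∃ k, vanishing k = G) ∨ (∃ k, basis k = G) ∨ G = extra₁ ∨
      G = extra₂ := by
    intro G hG
    simp only [parents, List.mem_append, List.mem_map, or_assoc] at hG
    rcases hG with ⟨k, -, hk⟩ | ⟨k, -, hk⟩ | hG
    · exact Or.inl ⟨k, hk⟩
    · exact Or.inr (Or.inl ⟨k, hk⟩)
    · exact Or.inr (Or.inr (by simpa using hG))
  have he : extra₁ ∈ parents ∧ extra₂ ∈ parents := by decide +kernel
  ext G
  constructor
  · rintro ⟨hG, hn⟩
    rcases h G hG with hk | hk | hG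
    · exact absurd (Or.inl hk) hn
    · exact absurd (Or.inr hk) hn
    · exact hG
  · intro hG
    obtain ⟨-, h0, hb, -⟩ := extra_properties G hG
    refine ⟨?_, ?_⟩
    · rcases hG with rfl | rfl
      · exact he.1
      · exact he.2
    · rintro (⟨k, rfl⟩ | hk)
      · exact h0 (φ_vanishing k)
      · exact hb hk

end Lists

end NambuMicro

open NambuMicro in
theorem mainTheorem7 :
    -- the known combination of 27 skew pairs of 4D sunflower micro-graphs is a solution
    knownTerms.length = 27 ∧ occurring ⊆ sunflower 2 ∧ IsTrivialising knownSolution ∧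
    -- the vanishing list is complete, and the basic micro-graphs give a basis of the formulas
    {G ∈ sunflower 1 | φ G = 0} = Set.range vanishing ∧
    Set.range basis ⊆ sunflower 1 ∧
    LinearIndependent ℝ (fun k => φ (basis k)) ∧
    Submodule.span ℝ (Set.range fun k => φ (basis k)) = Submodule.span ℝ (φ '' sunflower 1) ∧
    -- the two remaining micro-graphs are not zero, not basic, and depend on the basis
    (∀ G ∈ ({extra₁, extra₂} : Set (MicroGraph 1)), G ∈ sunflower 1 ∧ φ G ≠ 0 ∧
      G ∉ Set.range basis ∧ φ G ∈ Submodule.span ℝ (Set.range fun k => φ (basis k))) ∧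
    -- seventeen 3D sunflower micro-graphs are sufficient and needed
    ∃ S : Set (MicroGraph 1),
      S.ncard = 17 ∧
      IsLeast {A : Set (MicroGraph 1) | A ⊆ sunflower 1 ∧ occurring ⊆ descendants₃₄ A} S ∧
      (∀ A : Set (MicroGraph 1), A ⊆ sunflower 1 →
        (∀ H ∈ occurring, ∃ H' ∈ descendants₃₄ A, Isomorphic H H') → 17 ≤ A.ncard) ∧
      S ∩ Set.range vanishing = vanishing '' {6, 9, 12} ∧
      (vanishing '' {6, 9, 12}).ncard = 3 ∧
      S ∩ Set.range basis = basis '' {0, 3, 5, 6, 7, 8, 9, 13, 14, 15, 16, 19} ∧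
      (basis '' {0, 3, 5, 6, 7, 8, 9, 13, 14, 15, 16, 19}).ncard = 12 ∧
      S \ (Set.range vanishing ∪ Set.range basis) = {extra₁, extra₂} := by
  refine ⟨rfl, occurring_subset, isTrivialising_knownSolution, vanishing_eq,
    Set.range_subset_iff.2 basis_mem_sunflower, linearIndependent_basis, span_basis, extra_properties,
    {G | G ∈ parents}, ncard_parents, isLeast_parents, fun _ => seventeen_le_ncard,
    parents_inter_vanishing, ?_, parents_inter_basis, ?_, parents_diff⟩
  · rw [Set.ncard_image_of_injective _ vanishing_injective, Set.ncard_eq_toFinset_card']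
    decide
  · rw [Set.ncard_image_of_injective _ basis_injective, Set.ncard_eq_toFinset_card']
    decide
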